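/- **Theorem 1.2.** Let $M$ be a connected smooth manifold of dimension $n\ge 3$, $\alpha=\sqrt{a_{ij}(x)y^iy^j}$ a Riemannian metric and $\beta=b_i(x)y^i$ a smooth 1-form on $M$, and let $F=\alpha\,\phi(\beta/\alpha)$ be an $(\alpha,\beta)$-metric, i.e. $\phi$ is smooth on an open set containing all values of $\beta/\alpha$, $\phi(0)=1$, and $F$ is a Finsler metric (smooth and positive off the zero section, positively homogeneous of degree one, with positive definite fundamental tensor $g_{ij}=\frac12[F^2]_{y^iy^j}$). Suppose that $F$ is non-Riemannian in the following sense: $\beta\not\equiv 0$, and there are no constant $k$ and open set $U\subset M$ with $\beta\not\equiv0$ on $U$ such that $\phi(s)=\sqrt{1+ks^2}$ for all values $s=\beta/\alpha$ taken over $U$. Put $b^2=\|\beta\|_\alpha^2$ and let $$h=\sqrt{u(b^2)\alpha^2+v(b^2)\beta^2},\qquad \rho=w(b^2)\beta ,$$ where $u\neq 0$, $v$, $w\ne0$ are smooth functions on an open set containing the values of $b^2$ and $h$ is a Riemannian metric. Suppose that $\rho=p_iy^i$ is a conformal 1-form of $h$, i.e. $p_{i|j}+p_{j|i}=-4\theta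 h_{ij}$ for some scalar function $\theta$ (covariant derivatives with respect to $h$), and that $h$ has constant sectional curvature $\mu$. A smooth vector field $V$ on an open subset of $M$ is called conformal for $F$ with conformal factor $c=c(x)$ if $V_{0|0}=-2cF^2$ there, where $V_{0|0}=V_{i|j}y^iy^j$, $V_i=g_{im}V^m$ and $|$ is the horizontal covariant derivative of the Chern connection of $F$; it is a Killing field if $c=0$. Consider the forms $$h=\frac{2}{1+\mu|x|^2}|y|,\qquad \rho=\frac{4}{(1+\mu|x|^2)^2}\Big\{-2(\lambda+\langle d,x\rangle)\langle x,y\rangle+|x|^2\langle d,y\rangle+\langle Px,y\rangle+\langle e,y\rangle\Big\},\tag{4}$$ with a constant $\lambda\in\mathbb R$, constant vectors $d,e\in\mathbb R^n$ and a constant skew-symmetric matrix $P$. **(A)** Around every point of $M$ there are local coordinates on a connected open set $U$ and constants $\lambda,d,e,P$ for which (4) holds and such that every conformal vector field $V$ on $U$, with conformal factor $c$, belongs to one of the following three cases, where $\tau\in\mathbb R$ and $\gamma\in\mathbb R^n$ are constant and $Q$ is a constant skew-symmetric matrix: (i) $\mu=0$, $\lambda=0$, $d=0$, and $$V=-2\tau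 x+Qx+\gamma,\qquad Qe=P\gamma,\quad PQ-QP=2\tau P;\tag{5, 6}$$ in this case $c=\tau$. (ii) $\mu=0$, $\lambda\neq0$, and $$V=Qx+\gamma,\qquad \langle d,\gamma\rangle=0,\quad Qd=0,\quad Qe=-2\lambda\gamma+P\gamma,\quad PQ-QP=2R,\tag{7, 8}$$ where $R=(r^i_j)$, $r^i_j=\gamma^id^j-\gamma^jd^i$; in this case $c=0$, so $V$ is a Killing field. (iii) $\mu\neq0$, and $$V=2\mu\langle\gamma,x\rangle x+(1-\mu|x|^2)\gamma+Qx,\tag{9}$$ $$\langle d+\mu e,\gamma\rangle=0,\quad Qd=-\mu(2\lambda\gamma+P\gamma),\quad Qe=-2\lambda\gamma+P\gamma,\quad PQ-QP=2R,\tag{10}$$ where $R=(r^i_j)$, $r^i_j=\mu(e^i\gamma^j-e^j\gamma^i)+\gamma^id^j-\gamma^jd^i$; in this case $c=0$, so $V$ is a Killing field. **(B)** In any local coordinates on a connected open set $U$ in which $h=\frac{2}{1+\mu|x|^2}|y|$, there are constants $\lambda,d,e,P$ as above for which $\rho$ has the form (4), and every conformal vector field on $U$ belongs to one of the cases (i),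 (ii), (iii), with the condition $\lambda\ne0$ in (ii) replaced by $(\lambda,d)\neq(0,0)$. -/

import Mathlib

open scoped Manifold ContDiff Matrix InnerProductSpace Topology

noncomputable section

namespace FinslerConformal

/-! ## Calculus in coordinates on `ℝⁿ` -/

/-- The coordinate space `ℝⁿ` with its Euclidean inner product. -/
abbrev Coord (n : ℕ) := EuclideanSpace ℝ (Fin n)

/-- The `i`-th coordinate vector `∂/∂xⁱ`. -/
abbrev basisVec {n : ℕ} (i : Fin n) : Coord n := EuclideanSpace.single i (1 : ℝ)

/-- The partial derivative `∂f/∂xⁱ`. -/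
def pd {n : ℕ} (f : Coord n → ℝ) (i : Fin n) (x : Coord n) : ℝ :=
  fderiv ℝ f x (basisVec i)

/-- `∂f/∂xⁱ` for a function `f(x, y)` of a position `x` and a direction `y`. -/
def pdX {n : ℕ} (f : Coord n → Coord n → ℝ) (i : Fin n) (x y : Coord n) : ℝ :=
  pd (fun z => f z y) i x

/-- `∂f/∂yⁱ` for a function `f(x, y)` of a position `x` and a direction `y`. -/
def pdY {n : ℕ} (f : Coord n → Coord n → ℝ) (i : Fin n) (x y : Coord n) : ℝ :=
  pd (f x) i y

/-! ## Riemannian geometry in coordinates; `g x` is the matrix `(g_ij(x))` -/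

/-- Christoffel symbols `Γ^k_ij` of the Levi-Civita connection of `g`. -/
def christoffel {n : ℕ} (g : Coord n → Matrix (Fin n) (Fin n) ℝ) (k i j : Fin n)
    (x : Coord n) : ℝ :=
  1 / 2 * ∑ l, (g x)⁻¹ k l *
    (pd (fun z => g z l j) i x + pd (fun z => g z i l) j x - pd (fun z => g z i j) l x)

/-- Components of the curvature tensor: `R(∂_i, ∂_j) ∂_k = ∑ l, (curvature g l k i j) ∂_l`, where
`R(X, Y) = [∇_X, ∇_Y] - ∇_[X, Y]`. -/
def curvature {n : ℕ} (g : Coord n → Matrix (Fin n) (Fin n) ℝ) (l k i j : Fin n)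
    (x : Coord n) : ℝ :=
  pd (christoffel g l j k) i x - pd (christoffel g l i k) j x
    + ∑ m, (christoffel g l i m x * christoffel g m j k x
      - christoffel g l j m x * christoffel g m i k x)

/-- The scalar product `g_x(a, b)`. -/
def innerAt {n : ℕ} (g : Coord n → Matrix (Fin n) (Fin n) ℝ) (x a b : Coord n) : ℝ :=
  ∑ i, ∑ j, g x i j * a i * b j

/-- The sectional curvature
`g(R(a, b) b, a) / (g(a, a) g(b, b) - g(a, b)²)` of the plane spanned by `a` and `b`. -/
def sectionalCurvature {n : ℕ} (g : Coord n → Matrix (Fin n) (Fin n) ℝ) (x a b : Coord n) : ℝ :=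
  (∑ m, ∑ l, ∑ k, ∑ i, ∑ j, g x m l * curvature g l k i j x * a i * b j * b k * a m) /
    (innerAt g x a a * innerAt g x b b - innerAt g x a b ^ 2)

/-- The covariant derivative `p_{i|j}` of the 1-form `p = ∑ p_i dxⁱ` with respect to the
Levi-Civita connection of `g`. -/
def formCovDeriv {n : ℕ} (g : Coord n → Matrix (Fin n) (Fin n) ℝ) (p : Coord n → Fin n → ℝ)
    (i j : Fin n) (x : Coord n) : ℝ :=
  pd (fun z => p z i) j x - ∑ k, christoffel g k i j x * p x k

/-! ## Finsler geometry in coordinates; `F x y` is the metric at position `x`, direction `y` -/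

/-- The fundamental tensor `g_ij = (1/2) ∂²(F²)/∂yⁱ∂yʲ`. -/
def fundamentalTensor {n : ℕ} (F : Coord n → Coord n → ℝ) (x y : Coord n) :
    Matrix (Fin n) (Fin n) ℝ :=
  Matrix.of fun i j => 1 / 2 * pdY (pdY (fun z w => F z w ^ 2) j) i x y

/-- The spray coefficients
`Gⁱ = (1/4) g^{il} (∂²(F²)/∂x^k∂y^l y^k - ∂(F²)/∂x^l)`. -/
def sprayCoeff {n : ℕ} (F : Coord n → Coord n → ℝ) (i : Fin n) (x y : Coord n) : ℝ :=
  1 / 4 * ∑ l, (fundamentalTensor F x y)⁻¹ i l *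
    (∑ k, pdX (pdY (fun z w => F z w ^ 2) l) k x y * y k - pdX (fun z w => F z w ^ 2) l x y)

/-- The nonlinear connection `Nⁱ_j = ∂Gⁱ/∂yʲ`. -/
def nonlinearConn {n : ℕ} (F : Coord n → Coord n → ℝ) (i j : Fin n) (x y : Coord n) : ℝ :=
  pdY (sprayCoeff F i) j x y

/-- The horizontal derivative `δf/δxʲ = ∂f/∂xʲ - N^m_j ∂f/∂y^m`. -/
def hDeriv {n : ℕ} (F : Coord n → Coord n → ℝ) (f : Coord n → Coord n → ℝ) (j : Fin n)
    (x y : Coord n) : ℝ :=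
  pdX f j x y - ∑ m, nonlinearConn F m j x y * pdY f m x y

/-- The coefficients `Γ^k_ij = (1/2) g^{kl} (δ_i g_lj + δ_j g_il - δ_l g_ij)` of the Chern
connection. -/
def chernCoeff {n : ℕ} (F : Coord n → Coord n → ℝ) (k i j : Fin n) (x y : Coord n) : ℝ :=
  1 / 2 * ∑ l, (fundamentalTensor F x y)⁻¹ k l *
    (hDeriv F (fun z w => fundamentalTensor F z w l j) i x y
      + hDeriv F (fun z w => fundamentalTensor F z w i l) j x y
      - hDeriv F (fun z w => fundamentalTensor F z w i j) l x y)

/-- The lowered components `V_i = g_im(x, y) V^m(x)` of a vector field `V`. -/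
def lowerIndex {n : ℕ} (F : Coord n → Coord n → ℝ) (V : Coord n → Coord n) (i : Fin n)
    (x y : Coord n) : ℝ :=
  ∑ m, fundamentalTensor F x y i m * V x m

/-- The horizontal covariant derivative `V_{i|j} = δ_j V_i - Γ^k_ij V_k` with respect to the
Chern connection. -/
def hCovDeriv {n : ℕ} (F : Coord n → Coord n → ℝ) (V : Coord n → Coord n) (i j : Fin n)
    (x y : Coord n) : ℝ :=
  hDeriv F (lowerIndex F V i) j x y - ∑ k, chernCoeff F k i j x y * lowerIndex F V k x y

/-- `V_{0|0} = V_{i|j} yⁱ yʲ`. -/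
def hCovDeriv00 {n : ℕ} (F : Coord n → Coord n → ℝ) (V : Coord n → Coord n)
    (x y : Coord n) : ℝ :=
  ∑ i, ∑ j, hCovDeriv F V i j x y * y i * y j

/-! ## Objects on a manifold and their coordinate expressions -/

section Manifold

variable {n : ℕ} {M : Type*} [TopologicalSpace M] [ChartedSpace (Coord n) M]

/-- The local coordinate systems of the smooth manifold `M`: all members of its maximal smooth
atlas. -/
def charts (n : ℕ) (M : Type*) [TopologicalSpace M] [ChartedSpace (Coord n) M] :
    Set (OpenPartialHomeomorph M (Coord n)) :=
  IsManifold.maximalAtlas 𝓘(ℝ, Coord n) ∞ M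

/-- Smooth Riemannian metrics on `M`. -/
abbrev RiemMetric (n : ℕ) (M : Type*) [TopologicalSpace M] [ChartedSpace (Coord n) M]
    [IsManifold 𝓘(ℝ, Coord n) ∞ M] :=
  Bundle.ContMDiffRiemannianMetric (B := M) 𝓘(ℝ, Coord n) ∞ (Coord n)
    (fun x : M => TangentSpace 𝓘(ℝ, Coord n) x)

/-- The tangent vector `∑ yⁱ ∂/∂xⁱ` of `M` at the point with coordinates `x`. -/
def tangentOf (κ : OpenPartialHomeomorph M (Coord n)) (x y : Coord n) :
    TangentSpace 𝓘(ℝ, Coord n) (κ.symm x) :=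
  mfderiv 𝓘(ℝ, Coord n) 𝓘(ℝ, Coord n) κ.symm x y

/-- The components `h_ij(x)` of a Riemannian metric. -/
def metricInChart [IsManifold 𝓘(ℝ, Coord n) ∞ M] (h : RiemMetric n M)
    (κ : OpenPartialHomeomorph M (Coord n)) (x : Coord n) : Matrix (Fin n) (Fin n) ℝ :=
  Matrix.of fun i j =>
    h.inner (κ.symm x) (tangentOf κ x (basisVec i)) (tangentOf κ x (basisVec j))

/-- The components `p_i(x)` of a 1-form. -/
def formInChart (ρ : ∀ x : M, TangentSpace 𝓘(ℝ, Coord n) x →L[ℝ] ℝ)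
    (κ : OpenPartialHomeomorph M (Coord n)) (x : Coord n) (i : Fin n) : ℝ :=
  ρ (κ.symm x) (tangentOf κ x (basisVec i))

/-- The components `(V¹(x), …, Vⁿ(x))` of a vector field. -/
def fieldInChart (V : ∀ x : M, TangentSpace 𝓘(ℝ, Coord n) x)
    (κ : OpenPartialHomeomorph M (Coord n)) (x : Coord n) : Coord n :=
  mfderiv 𝓘(ℝ, Coord n) 𝓘(ℝ, Coord n) κ (κ.symm x) (V (κ.symm x))

/-- The coordinate expression `F(x, y)` of a function on the tangent bundle. -/
def finslerInChart (F : TangentBundle 𝓘(ℝ, Coord n) M → ℝ)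
    (κ : OpenPartialHomeomorph M (Coord n)) (x y : Coord n) : ℝ :=
  F ⟨κ.symm x, tangentOf κ x y⟩

/-- A smooth 1-form: its components are smooth in every coordinate system. -/
def IsSmoothForm (ρ : ∀ x : M, TangentSpace 𝓘(ℝ, Coord n) x →L[ℝ] ℝ) : Prop :=
  ∀ κ ∈ charts n M, ∀ i, ContDiffOn ℝ ∞ (fun x => formInChart ρ κ x i) κ.target

/-- `h` has constant sectional curvature `μ`. -/
def HasConstSectionalCurvature [IsManifold 𝓘(ℝ, Coord n) ∞ M] (h : RiemMetric n M)
    (μ : ℝ) : Prop :=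
  ∀ κ ∈ charts n M, ∀ x ∈ κ.target, ∀ a b : Coord n, LinearIndependent ℝ ![a, b] →
    sectionalCurvature (metricInChart h κ) x a b = μ

/-- The smooth 1-form `ρ` is conformal with respect to `h`:
`p_{i|j} + p_{j|i} = -4 θ h_ij` for some scalar function `θ`. -/
structure IsConformalForm [IsManifold 𝓘(ℝ, Coord n) ∞ M] (h : RiemMetric n M)
    (ρ : ∀ x : M, TangentSpace 𝓘(ℝ, Coord n) x →L[ℝ] ℝ) : Prop where
  smooth : IsSmoothForm ρ
  conformal : ∃ θ : M → ℝ, ∀ κ ∈ charts n M, ∀ x ∈ κ.target, ∀ i j,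
    formCovDeriv (metricInChart h κ) (formInChart ρ κ) i j x
      + formCovDeriv (metricInChart h κ) (formInChart ρ κ) j i x
      = -4 * θ (κ.symm x) * metricInChart h κ x i j

/-- `‖β‖²`, the square of the norm of the linear form `β_x` with respect to the scalar product
`α_x` on the tangent space. -/
def formNormSq [IsManifold 𝓘(ℝ, Coord n) ∞ M] (α : RiemMetric n M)
    (β : ∀ x : M, TangentSpace 𝓘(ℝ, Coord n) x →L[ℝ] ℝ) (x : M) : ℝ :=
  sSup {t : ℝ | ∃ y : TangentSpace 𝓘(ℝ, Coord n) x, α.inner x y y ≤ 1 ∧ t = (β x y) ^ 2}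

/-- A (regular, positively homogeneous, strongly convex) Finsler metric on `M`. -/
structure IsFinslerMetric [IsManifold 𝓘(ℝ, Coord n) ∞ M]
    (F : TangentBundle 𝓘(ℝ, Coord n) M → ℝ) : Prop where
  smooth : ContMDiffOn (𝓘(ℝ, Coord n)).tangent 𝓘(ℝ, ℝ) ∞ F {v | v.2 ≠ 0}
  pos : ∀ (x : M) (y : TangentSpace 𝓘(ℝ, Coord n) x), y ≠ 0 → 0 < F ⟨x, y⟩
  homogeneous : ∀ (x : M) (y : TangentSpace 𝓘(ℝ, Coord n) x) (t : ℝ), 0 ≤ t →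
    F ⟨x, t • y⟩ = t * F ⟨x, y⟩
  convex : ∀ κ ∈ charts n M, ∀ x ∈ κ.target, ∀ y : Coord n, y ≠ 0 →
    (fundamentalTensor (finslerInChart F κ) x y).PosDef

/-- The ratio `s = β/α` at the tangent vector `y`. -/
def ratio [IsManifold 𝓘(ℝ, Coord n) ∞ M] (α : RiemMetric n M)
    (β : ∀ x : M, TangentSpace 𝓘(ℝ, Coord n) x →L[ℝ] ℝ) (x : M)
    (y : TangentSpace 𝓘(ℝ, Coord n) x) : ℝ :=
  β x y / √(α.inner x y y)

/-- `F = α φ(β/α)` is an (α, β)-metric: `α` is a Riemannian metric, `β` a smooth 1-form, `φ` is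
smooth on an open set containing all values of `β/α`, and `F` is a Finsler metric. -/
structure IsAlphaBetaMetric [IsManifold 𝓘(ℝ, Coord n) ∞ M] (α : RiemMetric n M)
    (β : ∀ x : M, TangentSpace 𝓘(ℝ, Coord n) x →L[ℝ] ℝ) (φ : ℝ → ℝ)
    (F : TangentBundle 𝓘(ℝ, Coord n) M → ℝ) : Prop where
  smooth_form : IsSmoothForm β
  smooth_phi : ∃ S : Set ℝ, IsOpen S ∧ ContDiffOn ℝ ∞ φ S ∧
    ∀ (x : M) (y : TangentSpace 𝓘(ℝ, Coord n) x), y ≠ 0 → ratio α β x y ∈ S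
  eq : ∀ (x : M) (y : TangentSpace 𝓘(ℝ, Coord n) x),
    F ⟨x, y⟩ = √(α.inner x y y) * φ (ratio α β x y)
  finsler : IsFinslerMetric F

/-- On the open set `U`, the vector field `V` is a conformal vector field of `(M, F)` with
conformal factor `c`: it is smooth and `V_{0|0} = -2 c F²`. -/
structure IsConformalFieldOn [IsManifold 𝓘(ℝ, Coord n) ∞ M]
    (F : TangentBundle 𝓘(ℝ, Coord n) M → ℝ) (V : ∀ x : M, TangentSpace 𝓘(ℝ, Coord n) x)
    (c : M → ℝ) (U : Set M) : Prop where
  smooth : ContMDiffOn 𝓘(ℝ, Coord n) (𝓘(ℝ, Coord n)).tangent ∞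
    (fun x => (⟨x, V x⟩ : TangentBundle 𝓘(ℝ, Coord n) M)) U
  conformal : ∀ κ ∈ charts n M, ∀ x ∈ κ.target, κ.symm x ∈ U → ∀ y : Coord n, y ≠ 0 →
    hCovDeriv00 (finslerInChart F κ) (fieldInChart V κ) x y
      = -2 * c (κ.symm x) * finslerInChart F κ x y ^ 2

/-! ## The explicit local forms -/

/-- In the coordinates `κ`, `h = 2 |y| / (1 + μ |x|²)`. -/
def MetricHasForm [IsManifold 𝓘(ℝ, Coord n) ∞ M] (h : RiemMetric n M)
    (κ : OpenPartialHomeomorph M (Coord n)) (μ : ℝ) : Prop :=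
  ∀ x ∈ κ.target, ∀ y : Coord n,
    √(h.inner (κ.symm x) (tangentOf κ x y) (tangentOf κ x y)) = 2 / (1 + μ * ‖x‖ ^ 2) * ‖y‖

/-- In the coordinates `κ`, `ρ = 4 (1 + μ|x|²)⁻²
(-2 (l + ⟨d, x⟩) ⟨x, y⟩ + |x|² ⟨d, y⟩ + ⟨P x, y⟩ + ⟨e, y⟩)`. -/
def FormHasForm (ρ : ∀ x : M, TangentSpace 𝓘(ℝ, Coord n) x →L[ℝ] ℝ)
    (κ : OpenPartialHomeomorph M (Coord n)) (μ l : ℝ) (d e : Coord n)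
    (P : Matrix (Fin n) (Fin n) ℝ) : Prop :=
  ∀ x ∈ κ.target, ∀ y : Coord n,
    ρ (κ.symm x) (tangentOf κ x y) = 4 / (1 + μ * ‖x‖ ^ 2) ^ 2 *
      (-2 * (l + ⟪d, x⟫_ℝ) * ⟪x, y⟫_ℝ + ‖x‖ ^ 2 * ⟪d, y⟫_ℝ
        + ⟪P.toEuclideanLin x, y⟫_ℝ + ⟪e, y⟫_ℝ)

/-- The first family: `V = -2 τ x + Q x + γ` and `c = τ`, where
`Q e = P γ` and `P Q - Q P = 2 τ P`. -/
def FirstFamily (V : ∀ x : M, TangentSpace 𝓘(ℝ, Coord n) x) (c : M → ℝ)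
    (κ : OpenPartialHomeomorph M (Coord n)) (e : Coord n)
    (P : Matrix (Fin n) (Fin n) ℝ) : Prop :=
  ∃ (τ : ℝ) (γ : Coord n) (Q : Matrix (Fin n) (Fin n) ℝ), Qᵀ = -Q ∧
    Q.toEuclideanLin e = P.toEuclideanLin γ ∧ P * Q - Q * P = (2 * τ) • P ∧
    (∀ x ∈ κ.target, fieldInChart V κ x = (-2 * τ) • x + Q.toEuclideanLin x + γ) ∧
    ∀ z ∈ κ.source, c z = τ

/-- The second family: `V = Q x + γ` and `c = 0`, where `⟨d, γ⟩ = 0`, `Q d = 0`,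
`Q e = -2 l γ + P γ` and `P Q - Q P = 2 R` with `rⁱ_j = γⁱ dʲ - γʲ dⁱ`. -/
def SecondFamily (V : ∀ x : M, TangentSpace 𝓘(ℝ, Coord n) x) (c : M → ℝ)
    (κ : OpenPartialHomeomorph M (Coord n)) (l : ℝ) (d e : Coord n)
    (P : Matrix (Fin n) (Fin n) ℝ) : Prop :=
  ∃ (γ : Coord n) (Q : Matrix (Fin n) (Fin n) ℝ), Qᵀ = -Q ∧
    ⟪d, γ⟫_ℝ = 0 ∧ Q.toEuclideanLin d = 0 ∧
    Q.toEuclideanLin e = (-2 * l) • γ + P.toEuclideanLin γ ∧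
    P * Q - Q * P = (2 : ℝ) • Matrix.of (fun i j => γ i * d j - γ j * d i) ∧
    (∀ x ∈ κ.target, fieldInChart V κ x = Q.toEuclideanLin x + γ) ∧
    ∀ z ∈ κ.source, c z = 0

/-- The third family: `V = 2 μ ⟨γ, x⟩ x + (1 - μ |x|²) γ + Q x` and `c = 0`, where
`⟨d + μ e, γ⟩ = 0`, `Q d = -μ (2 l γ + P γ)`, `Q e = -2 l γ + P γ` and `P Q - Q P = 2 R` with
`rⁱ_j = μ (eⁱ γʲ - eʲ γⁱ) + γⁱ dʲ - γʲ dⁱ`. -/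
def ThirdFamily (V : ∀ x : M, TangentSpace 𝓘(ℝ, Coord n) x) (c : M → ℝ)
    (κ : OpenPartialHomeomorph M (Coord n)) (μ l : ℝ) (d e : Coord n)
    (P : Matrix (Fin n) (Fin n) ℝ) : Prop :=
  ∃ (γ : Coord n) (Q : Matrix (Fin n) (Fin n) ℝ), Qᵀ = -Q ∧
    ⟪d + μ • e, γ⟫_ℝ = 0 ∧
    Q.toEuclideanLin d = (-μ) • ((2 * l) • γ + P.toEuclideanLin γ) ∧
    Q.toEuclideanLin e = (-2 * l) • γ + P.toEuclideanLin γ ∧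
    P * Q - Q * P = (2 : ℝ) • Matrix.of
      (fun i j => μ * (e i * γ j - e j * γ i) + γ i * d j - γ j * d i) ∧
    (∀ x ∈ κ.target, fieldInChart V κ x =
      (2 * μ * ⟪γ, x⟫_ℝ) • x + (1 - μ * ‖x‖ ^ 2) • γ + Q.toEuclideanLin x) ∧
    ∀ z ∈ κ.source, c z = 0

end Manifold

end FinslerConformal

end

open FinslerConformal

/-!
# Conformal vector fields of `(α, β)`-metrics related to constant curvature

The Chern connection enters the conformality condition `V_{0|0} = -2 c F²` only apparently: by
homogeneity, `V_{0|0}` is one half of the derivative of `F²` along the complete lift of `V`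
(`hCovDeriv00_eq`). For `F² = α² ψ(β/α)` with `ψ = φ²` the condition at a point therefore reads
`T (ψ - s ψ' / 2) + α ψ' B = 0`, where `T = L_V α² + 4 c α²` is a quadratic form,
`B = L_V β + 2 c β` is a linear form, and `s = β/α`. Splitting a direction into its part along
the dual of `β` and an orthogonal part, and taking even and odd parts in the latter, one finds that either `T = 0` and
`B = 0`, or `ψ` solves a first order linear differential equation whose solutions are `1 + k s²`
(`eq_zero_or_exists_eq_one_add_mul_sq`, `lie_alternative`). At a point where `β ≠ 0` and `φ²` is
not of that form (`genericPoints`), `V` thus rescales `α` and `β`, preserves `b²`, and rescales `h`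
and `ρ` in the same way (`conformal_relations_of_generic`).

The metric `h` of constant curvature `μ` is locally isometric to `2 |y| / (1 + μ |x|²)`: the
equation `∇²f = -μ f h` is a flat linear system for `(f, df)` and so has `n + 1` independent local
solutions, whose quotients `f_i / (1 + f_0)` are the stereographic coordinates
(`exists_solution_of_flat`, `exists_hessianEq`, `exists_local_isometry`). In such coordinates
conformality with respect to `h` is Euclidean conformality, and for `n ≥ 3` Liouville's theorem
(`exists_eq_confField`) lists the conformal fields of connected open sets: they are the polynomials
`confField`. Applied to the dual of `ρ` it gives the explicit form of `ρ` (`exists_formHasForm`).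
In particular `ρ` has unique continuation (`exists_form_ne_zero`), so that `β` vanishes on no open
set, and as `F` is non-Riemannian the generic points are dense (`exists_mem_genericPoints`).

By density the rescaling of `h` and `ρ` by `V` holds everywhere. Hence `V` is a `confField` as
well, and the rescaling of `ρ` becomes the bracket relation `[V, ξ] = 2 c ξ` for the field `ξ` dual
to `ρ`. Comparing coefficients (`confField_relations`) forces `c` to be a constant `τ` with
`μ τ = 0` and yields the relations of the three families; for `μ = 0` and `(l, d) ≠ 0` the relation
`⟨d, γ⟩ = 2 τ l` and the skew-symmetry of the linear part of `V` give `τ = 0`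
(`conformalField_classification`). A flat metric with `l = 0` and `d ≠ 0` is brought to `l ≠ 0` by
translating the coordinates by `d` (`exists_translated_chart`).
-/

open scoped Manifold ContDiff Matrix InnerProductSpace Topology

namespace FinslerConformal

/-! ### Partial derivatives -/

section PartialDerivatives
variable {n : ℕ}

lemma eq_sum_basisVec (y : Coord n) : y = ∑ i, y i • (basisVec i : Coord n) := by
  ext j
  simp [Finset.sum_apply, Pi.single_apply]

lemma inner_eq_sum (x y : Coord n) : ⟪x, y⟫_ℝ = ∑ i, x i * y i := by
  simp [PiLp.inner_apply, mul_comm]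

lemma normSq_eq_sum (x : Coord n) : ‖x‖ ^ 2 = ∑ i, x i * x i := by
  rw [← inner_eq_sum, real_inner_self_eq_norm_sq]

lemma toEuclideanLin_apply_apply (P : Matrix (Fin n) (Fin n) ℝ) (x : Coord n) (i : Fin n) :
    P.toEuclideanLin x i = ∑ j, P i j * x j := by
  simp [Matrix.toLpLin_apply, Matrix.mulVec, dotProduct]

lemma fderiv_eq_sum_pd (f : Coord n → ℝ) (x v : Coord n) :
    fderiv ℝ f x v = ∑ i, v i * pd f i x := by
  conv_lhs => rw [eq_sum_basisVec v]
  simp [pd]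

lemma fderiv_eq_zero_of_pd {f : Coord n → ℝ} {x : Coord n} (h : ∀ i, pd f i x = 0) :
    fderiv ℝ f x = 0 := by
  ext v; simp [fderiv_eq_sum_pd, h]

variable {f g : Coord n → ℝ} {x : Coord n} {i j : Fin n} {s : Set (Coord n)}

lemma pd_congr (h : f =ᶠ[𝓝 x] g) : pd f i x = pd g i x := by
  simp [pd, h.fderiv_eq]

lemma pd_congr_of_mem (hs : IsOpen s) (hx : x ∈ s) (h : ∀ y ∈ s, f y = g y) :
    pd f i x = pd g i x :=
  pd_congr (Filter.eventuallyEq_of_mem (hs.mem_nhds hx) h)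

lemma pd_add (hf : DifferentiableAt ℝ f x) (hg : DifferentiableAt ℝ g x) :
    pd (fun z => f z + g z) i x = pd f i x + pd g i x := by
  simp [pd, fderiv_fun_add hf hg]

lemma pd_sub (hf : DifferentiableAt ℝ f x) (hg : DifferentiableAt ℝ g x) :
    pd (fun z => f z - g z) i x = pd f i x - pd g i x := by
  simp [pd, fderiv_fun_sub hf hg]

lemma pd_mul (hf : DifferentiableAt ℝ f x) (hg : DifferentiableAt ℝ g x) :
    pd (fun z => f z * g z) i x = pd f i x * g x + f x * pd g i x := by
  simp [pd, fderiv_fun_mul hf hg]; ring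

lemma pd_const (c : ℝ) : pd (fun _ : Coord n => c) i x = 0 := by simp [pd]

lemma pd_const_mul (c : ℝ) (hf : DifferentiableAt ℝ f x) :
    pd (fun z => c * f z) i x = c * pd f i x := by
  rw [pd_mul (differentiableAt_const c) hf, pd_const]; ring

lemma pd_sum {ι : Type*} {t : Finset ι} {f : ι → Coord n → ℝ}
    (hf : ∀ k ∈ t, DifferentiableAt ℝ (f k) x) :
    pd (fun z => ∑ k ∈ t, f k z) i x = ∑ k ∈ t, pd (f k) i x := by
  simp [pd, fderiv_fun_sum hf]

lemma pd_coord : pd (fun z : Coord n => z j) i x = if i = j then 1 else 0 := by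
  have h : HasFDerivAt (fun z : Coord n => z j) (EuclideanSpace.proj (𝕜 := ℝ) j) x :=
    (EuclideanSpace.proj (𝕜 := ℝ) j : Coord n →L[ℝ] ℝ).hasFDerivAt
  simp [pd, h.fderiv, eq_comm]

lemma contDiffOn_pd (hs : IsOpen s) (hf : ContDiffOn ℝ ∞ f s) (i : Fin n) :
    ContDiffOn ℝ ∞ (pd f i) s :=
  (hf.fderiv_of_isOpen hs (by simp)).clm_apply contDiffOn_const

lemma differentiableAt_of_contDiffOn {E F : Type*} [NormedAddCommGroup E] [NormedSpace ℝ E]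
    [NormedAddCommGroup F] [NormedSpace ℝ F] {f : E → F} {s : Set E} {x : E} (hs : IsOpen s)
    (hf : ContDiffOn ℝ ∞ f s) (hx : x ∈ s) : DifferentiableAt ℝ f x :=
  (hf.contDiffAt (hs.mem_nhds hx)).differentiableAt (by simp)

lemma pd_comm (hs : IsOpen s) (hf : ContDiffOn ℝ ∞ f s) (hx : x ∈ s) (i j : Fin n) :
    pd (pd f i) j x = pd (pd f j) i x := by
  have hfx := hf.contDiffAt (hs.mem_nhds hx)
  have hd : DifferentiableAt ℝ (fderiv ℝ f) x :=
    (hfx.fderiv_right (m := 1) (by norm_cast)).differentiableAt (by simp)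
  have hsymm : IsSymmSndFDerivAt ℝ f x := hfx.isSymmSndFDerivAt (by
    simp only [minSmoothness_of_isRCLikeNormedField]
    exact WithTop.coe_le_coe.2 (le_top : (2 : ℕ∞) ≤ ⊤))
  have key : ∀ k l : Fin n,
      pd (pd f k) l x = fderiv ℝ (fderiv ℝ f) x (basisVec l) (basisVec k) := by
    intro k l
    unfold pd
    rw [fderiv_clm_apply hd (differentiableAt_const _)]
    simp
  rw [key, key, hsymm]

/-- A function with vanishing partial derivatives on a connected open set is constant there. -/
lemma eq_of_pd_eq_zero (hs : IsOpen s) (hc : IsPreconnected s) (hf : DifferentiableOn ℝ f s)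
    (h : ∀ x ∈ s, ∀ i, pd f i x = 0) {x y : Coord n} (hx : x ∈ s) (hy : y ∈ s) : f x = f y :=
  hs.is_const_of_fderiv_eq_zero hc hf (fun z hz => fderiv_eq_zero_of_pd (h z hz)) hx hy

lemma fderiv_apply_coord {f : Coord n → Coord n} (hf : DifferentiableAt ℝ f x) (v : Coord n) :
    fderiv ℝ f x v i = ∑ j, v j * pd (fun z => f z i) j x := by
  rw [← fderiv_eq_sum_pd]
  have h : HasFDerivAt (fun z => f z i) ((EuclideanSpace.proj (𝕜 := ℝ) i).comp (fderiv ℝ f x)) x :=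
    (EuclideanSpace.proj (𝕜 := ℝ) i : Coord n →L[ℝ] ℝ).hasFDerivAt.comp x hf.hasFDerivAt
  simp [h.fderiv]

lemma contDiffOn_coord_iff {f : Coord n → Coord n} {k : WithTop ℕ∞} :
    ContDiffOn ℝ k f s ↔ ∀ i, ContDiffOn ℝ k (fun z => f z i) s :=
  contDiffOn_euclidean

end PartialDerivatives

section MatrixSmooth
variable {n m : ℕ} {E : Type*} [NormedAddCommGroup E] [NormedSpace ℝ E]

lemma contDiffOn_det {A : E → Matrix (Fin m) (Fin m) ℝ} {s : Set E}
    (hA : ∀ i j, ContDiffOn ℝ ∞ (fun x => A x i j) s) : ContDiffOn ℝ ∞ (fun x => (A x).det) s := by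
  simp only [Matrix.det_apply]
  exact ContDiffOn.sum fun σ _ => (contDiffOn_prod fun i _ => hA _ _).const_smul _

/-- The entries of the inverse of an invertible matrix are smooth functions of its entries. -/
lemma contDiffOn_inv_apply {A : E → Matrix (Fin m) (Fin m) ℝ} {s : Set E}
    (hA : ∀ i j, ContDiffOn ℝ ∞ (fun x => A x i j) s) (hdet : ∀ x ∈ s, (A x).det ≠ 0)
    (i j : Fin m) : ContDiffOn ℝ ∞ (fun x => (A x)⁻¹ i j) s := by
  have h1 : ContDiffOn ℝ ∞ (fun x => (A x).adjugate i j) s := by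
    simp only [Matrix.adjugate_apply]
    refine contDiffOn_det fun k l => ?_
    by_cases hk : k = j
    · subst hk; simpa using contDiffOn_const
    · simpa [Matrix.updateRow_ne hk] using hA k l
  have h2 : ContDiffOn ℝ ∞ (fun x => ((A x).det)⁻¹ * (A x).adjugate i j) s :=
    ((contDiffOn_det hA).inv hdet).mul h1
  refine h2.congr fun x hx => ?_
  simp [Matrix.inv_def]

end MatrixSmooth

/-! ### Coordinate expressions -/
section Charts
open Set Bundle

variable {n : ℕ} {M : Type*} [TopologicalSpace M] [ChartedSpace (Coord n) M]
  {κ : OpenPartialHomeomorph M (Coord n)}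

lemma tangentOf_smul (x : Coord n) (t : ℝ) (y : Coord n) :
    tangentOf κ x (t • y) = t • tangentOf κ x y :=
  map_smul (mfderiv 𝓘(ℝ, Coord n) 𝓘(ℝ, Coord n) κ.symm x) t y

lemma chart_mdifferentiable (hκ : κ ∈ charts n M) :
    κ.MDifferentiable 𝓘(ℝ, Coord n) 𝓘(ℝ, Coord n) :=
  ⟨(contMDiffOn_of_mem_maximalAtlas hκ).mdifferentiableOn (by simp),
    (contMDiffOn_symm_of_mem_maximalAtlas hκ).mdifferentiableOn (by simp)⟩

lemma tangentOf_surjective (hκ : κ ∈ charts n M) {x : Coord n} (hx : x ∈ κ.target)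
    (v : TangentSpace 𝓘(ℝ, Coord n) (κ.symm x)) : ∃ y : Coord n, tangentOf κ x y = v := by
  have := (chart_mdifferentiable hκ).symm.mfderiv_surjective hx v
  exact this

lemma tangentOf_eq_zero_iff (hκ : κ ∈ charts n M) {x : Coord n} (hx : x ∈ κ.target)
    (y : Coord n) : tangentOf κ x y = 0 ↔ y = 0 := by
  have := (chart_mdifferentiable hκ).symm.mfderiv_injective hx
  exact map_eq_zero_iff (mfderiv 𝓘(ℝ, Coord n) 𝓘(ℝ, Coord n) κ.symm x) this

lemma form_tangentOf (ρ : ∀ x : M, TangentSpace 𝓘(ℝ, Coord n) x →L[ℝ] ℝ) (x y : Coord n) :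
    ρ (κ.symm x) (tangentOf κ x y) = ∑ i, formInChart ρ κ x i * y i := by
  have hy := eq_sum_basisVec y
  have h2 := map_sum ((ρ (κ.symm x)).comp (mfderiv 𝓘(ℝ, Coord n) 𝓘(ℝ, Coord n) κ.symm x))
      (fun i => y i • (basisVec i : Coord n)) Finset.univ
  calc ρ (κ.symm x) (tangentOf κ x y) = ρ (κ.symm x) (tangentOf κ x (∑ i, y i • basisVec i)) := by
        rw [← hy]
    _ = ∑ i, ρ (κ.symm x) (tangentOf κ x (y i • basisVec i)) := h2
    _ = _ := by
      refine Finset.sum_congr rfl fun i _ => ?_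
      rw [tangentOf_smul, map_smul, formInChart, smul_eq_mul, mul_comm]

lemma tangentOf_trans (hκ : κ ∈ charts n M) {ψ : OpenPartialHomeomorph (Coord n) (Coord n)}
    {x : Coord n} (hx : x ∈ (κ ≫ₕ ψ).target) (h2 : DifferentiableAt ℝ ψ.symm x) (y : Coord n) :
    tangentOf (κ ≫ₕ ψ) x y = tangentOf κ (ψ.symm x) (fderiv ℝ ψ.symm x y) := by
  have hx2 : ψ.symm x ∈ κ.target := by
    rw [OpenPartialHomeomorph.trans_target] at hx; exact hx.2
  have h3 := mfderiv_comp x (I := 𝓘(ℝ, Coord n)) (I' := 𝓘(ℝ, Coord n)) (I'' := 𝓘(ℝ, Coord n))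
    (g := κ.symm) (f := ψ.symm)
    ((chart_mdifferentiable hκ).mdifferentiableAt_symm hx2) h2.mdifferentiableAt
  have h4 := DFunLike.congr_fun h3 y
  rw [mfderiv_eq_fderiv] at h4
  exact h4

variable [IsManifold 𝓘(ℝ, Coord n) ∞ M]

/-- The tangent vector with given coordinates depends smoothly on the coordinates. -/
lemma contMDiffOn_tangentOf (hκ : κ ∈ charts n M) :
    ContMDiffOn 𝓘(ℝ, Coord n × Coord n) (𝓘(ℝ, Coord n)).tangent ∞
      (fun p : Coord n × Coord n => (⟨κ.symm p.1, tangentOf κ p.1 p.2⟩ :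
        TangentBundle 𝓘(ℝ, Coord n) M)) (κ.target ×ˢ univ) := by
  have h1 := (contMDiffOn_symm_of_mem_maximalAtlas hκ).contMDiffOn_tangentMapWithin
    (m := ∞) (by simp) κ.open_target.uniqueMDiffOn
  have h2 : ContMDiff 𝓘(ℝ, Coord n × Coord n) (𝓘(ℝ, Coord n)).tangent ∞
      (fun p : Coord n × Coord n => (⟨p.1, p.2⟩ : TangentBundle 𝓘(ℝ, Coord n) (Coord n))) := by
    intro p
    rw [Bundle.contMDiffAt_totalSpace]
    constructor
    · exact contDiff_fst.contMDiff.contMDiffAt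
    · simpa using contDiff_snd.contMDiff.contMDiffAt
  have h3 := h1.comp (h2.contMDiffOn (s := κ.target ×ˢ univ)) (by
    rintro ⟨x, y⟩ ⟨hx, -⟩; exact hx)
  refine h3.congr ?_
  rintro ⟨x, y⟩ ⟨hx, -⟩
  simp [tangentMapWithin, tangentOf, mfderivWithin_of_isOpen κ.open_target hx]

lemma contDiffOn_finslerInChart (hκ : κ ∈ charts n M) {F : TangentBundle 𝓘(ℝ, Coord n) M → ℝ}
    (hF : ContMDiffOn (𝓘(ℝ, Coord n)).tangent 𝓘(ℝ, ℝ) ∞ F {v | v.2 ≠ 0}) :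
    ContDiffOn ℝ ∞ (fun p : Coord n × Coord n => finslerInChart F κ p.1 p.2)
      (κ.target ×ˢ {0}ᶜ) := by
  have h0 : MapsTo (fun p : Coord n × Coord n => (⟨κ.symm p.1, tangentOf κ p.1 p.2⟩ :
      TangentBundle 𝓘(ℝ, Coord n) M)) (κ.target ×ˢ {0}ᶜ) {v | v.2 ≠ 0} := by
    rintro p ⟨hx, hy⟩
    exact (tangentOf_eq_zero_iff hκ hx p.2).not.2 hy
  have h := hF.comp ((contMDiffOn_tangentOf hκ).mono
    (show κ.target ×ˢ {0}ᶜ ⊆ κ.target ×ˢ univ from prod_mono le_rfl (subset_univ _))) h0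
  rw [contMDiffOn_iff_contDiffOn] at h
  exact h

/-- The components of a Riemannian metric as a quadratic expression. -/
lemma inner_tangentOf (h : RiemMetric n M) (x y z : Coord n) :
    h.inner (κ.symm x) (tangentOf κ x y) (tangentOf κ x z) =
      innerAt (metricInChart h κ) x y z := by
  have hb : ∀ y : Coord n, tangentOf κ x y = ∑ i, y i • tangentOf κ x (basisVec i) := by
    intro y
    have hy := eq_sum_basisVec y
    have h2 := map_sum (mfderiv 𝓘(ℝ, Coord n) 𝓘(ℝ, Coord n) κ.symm x)
      (fun i => y i • (basisVec i : Coord n)) Finset.univ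
    calc tangentOf κ x y = tangentOf κ x (∑ i, y i • basisVec i) := by rw [← hy]
      _ = ∑ i, tangentOf κ x (y i • basisVec i) := h2
      _ = _ := by simp only [tangentOf_smul]
  rw [hb y, hb z]
  simp only [map_sum, sum_apply, map_smul, smul_apply,
    innerAt, metricInChart, Matrix.of_apply, smul_eq_mul]
  simp only [Finset.mul_sum]
  rw [Finset.sum_comm]
  refine Finset.sum_congr rfl fun i _ => Finset.sum_congr rfl fun j _ => ?_
  ring

lemma contDiffOn_metricInChart (hκ : κ ∈ charts n M) (h : RiemMetric n M) (i j : Fin n) :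
    ContDiffOn ℝ ∞ (fun x => metricInChart h κ x i j) κ.target := by
  have hc : ∀ i : Fin n, ContMDiffOn 𝓘(ℝ, Coord n) (𝓘(ℝ, Coord n)).tangent ∞
      (fun x : Coord n => (⟨κ.symm x, tangentOf κ x (basisVec i)⟩ :
        TangentBundle 𝓘(ℝ, Coord n) M)) κ.target := fun i =>
    (contMDiffOn_tangentOf hκ).comp (t := κ.target ×ˢ univ)
      (f := fun x : Coord n => (x, (basisVec i : Coord n)))
      (contDiff_id.prodMk contDiff_const).contMDiff.contMDiffOn (fun x hx => ⟨hx, trivial⟩)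
  intro x hx
  have hb : ContMDiffWithinAt 𝓘(ℝ, Coord n) 𝓘(ℝ, Coord n) ∞ κ.symm κ.target x :=
    contMDiffOn_symm_of_mem_maximalAtlas hκ x hx
  have h3 : ContMDiffWithinAt 𝓘(ℝ, Coord n) (𝓘(ℝ, Coord n).prod 𝓘(ℝ)) ∞
      (fun m => TotalSpace.mk' ℝ (E := Bundle.Trivial M ℝ) (κ.symm m)
        (h.inner (κ.symm m) (tangentOf κ m (basisVec i)) (tangentOf κ m (basisVec j))))
      κ.target x := by
    apply ContMDiffWithinAt.clm_bundle_apply₂ (F₁ := Coord n) (F₂ := Coord n)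
    · exact ContMDiffAt.comp_contMDiffWithinAt x h.contMDiff.contMDiffAt hb
    · exact hc i x hx
    · exact hc j x hx
  simp only [contMDiffWithinAt_totalSpace] at h3
  exact h3.2.contDiffWithinAt

lemma contDiffOn_fieldInChart (hκ : κ ∈ charts n M) {V : ∀ x : M, TangentSpace 𝓘(ℝ, Coord n) x}
    (hV : ContMDiffOn 𝓘(ℝ, Coord n) (𝓘(ℝ, Coord n)).tangent ∞
    (fun x => (⟨x, V x⟩ : TangentBundle 𝓘(ℝ, Coord n) M)) κ.source) :
    ContDiffOn ℝ ∞ (fieldInChart V κ) κ.target := by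
  have h1 := (contMDiffOn_of_mem_maximalAtlas hκ).contMDiffOn_tangentMapWithin
    (m := ∞) (by simp) κ.open_source.uniqueMDiffOn
  have h2 := (h1.comp hV (fun x hx => hx)).comp (contMDiffOn_symm_of_mem_maximalAtlas hκ)
    (fun x hx => κ.map_target hx)
  intro x hx
  have h3 := h2 x hx
  rw [contMDiffWithinAt_totalSpace] at h3
  have h4 := h3.2.contDiffWithinAt
  refine h4.congr_of_mem ?_ hx
  intro y hy
  simp [fieldInChart, tangentMapWithin, mfderivWithin_of_isOpen κ.open_source (κ.map_target hy)]
  rfl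

/-- Changing coordinates by a diffeomorphism between open subsets of `ℝⁿ`. -/
lemma trans_mem_charts (hκ : κ ∈ charts n M) {ψ : OpenPartialHomeomorph (Coord n) (Coord n)}
    (h1 : ContDiffOn ℝ ∞ ψ ψ.source) (h2 : ContDiffOn ℝ ∞ ψ.symm ψ.target) :
    κ ≫ₕ ψ ∈ charts n M := by
  apply OpenPartialHomeomorph.mem_maximalAtlas_of_contMDiffOn
  · exact h1.contMDiffOn.comp' (contMDiffOn_of_mem_maximalAtlas hκ)
  · exact (contMDiffOn_symm_of_mem_maximalAtlas hκ).comp' h2.contMDiffOn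

end Charts

/-! ### Metrics of constant sectional curvature -/

section Curvature
variable {n : ℕ}

/-- A tensor with the symmetries of a curvature tensor vanishes if all its sectional values do. -/
lemma eq_zero_of_sectional_eq_zero {ι : Type*} [Fintype ι] [DecidableEq ι]
    {T : ι → ι → ι → ι → ℝ}
    (h1 : ∀ m k i j, T k m i j = -T m k i j) (h2 : ∀ m k i j, T i j m k = T m k i j)
    (h3 : ∀ m k i j, T m k i j + T m i j k + T m j k i = 0)
    (h0 : ∀ a b : ι → ℝ, ∑ m, ∑ k, ∑ i, ∑ j, T m k i j * a m * b k * a i * b j = 0)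
    (m k i j : ι) : T m k i j = 0 := by
  -- polarizing twice
  set Q : (ι → ℝ) → (ι → ℝ) → (ι → ℝ) → (ι → ℝ) → ℝ := fun a b c d =>
    ∑ m, ∑ k, ∑ i, ∑ j, T m k i j * a m * b k * c i * d j with hQ
  have add1 : ∀ a a' b c d, Q (a + a') b c d = Q a b c d + Q a' b c d := by
    intro a a' b c d
    simp only [hQ, ← Finset.sum_add_distrib, Pi.add_apply]
    refine Finset.sum_congr rfl fun _ _ => Finset.sum_congr rfl fun _ _ =>
      Finset.sum_congr rfl fun _ _ => Finset.sum_congr rfl fun _ _ => by ring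
  have add2 : ∀ a b b' c d, Q a (b + b') c d = Q a b c d + Q a b' c d := by
    intro a b b' c d
    simp only [hQ, ← Finset.sum_add_distrib, Pi.add_apply]
    refine Finset.sum_congr rfl fun _ _ => Finset.sum_congr rfl fun _ _ =>
      Finset.sum_congr rfl fun _ _ => Finset.sum_congr rfl fun _ _ => by ring
  have add3 : ∀ a b c c' d, Q a b (c + c') d = Q a b c d + Q a b c' d := by
    intro a b c c' d
    simp only [hQ, ← Finset.sum_add_distrib, Pi.add_apply]
    refine Finset.sum_congr rfl fun _ _ => Finset.sum_congr rfl fun _ _ =>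
      Finset.sum_congr rfl fun _ _ => Finset.sum_congr rfl fun _ _ => by ring
  have add4 : ∀ a b c d d', Q a b c (d + d') = Q a b c d + Q a b c d' := by
    intro a b c d d'
    simp only [hQ, ← Finset.sum_add_distrib, Pi.add_apply]
    refine Finset.sum_congr rfl fun _ _ => Finset.sum_congr rfl fun _ _ =>
      Finset.sum_congr rfl fun _ _ => Finset.sum_congr rfl fun _ _ => by ring
  have hb : ∀ m k i j, Q (Pi.single m 1) (Pi.single k 1) (Pi.single i 1) (Pi.single j 1)
      = T m k i j := by
    intro m k i j
    simp [hQ, Pi.single_apply, Finset.sum_ite_eq', mul_ite]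
  have h0' : ∀ a b, Q a b a b = 0 := h0
  have p1 : ∀ a b d, Q a b a d + Q a d a b = 0 := by
    intro a b d
    have := h0' a (b + d)
    rw [add2, add4, add4, h0', h0'] at this
    linarith
  have p2 : ∀ m k i j, T m k i j + T m j i k + T i k m j + T i j m k = 0 := by
    intro m k i j
    have := p1 (Pi.single m 1 + Pi.single i 1) (Pi.single k 1) (Pi.single j 1)
    rw [add1, add3, add3, add1, add3, add3] at this
    simp only [hb] at this
    have e1 := p1 (Pi.single m 1) (Pi.single k 1) (Pi.single j 1)
    have e2 := p1 (Pi.single i 1) (Pi.single k 1) (Pi.single j 1)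
    simp only [hb] at e1 e2
    linarith
  have a1 := p2 m k i j
  have b1 := p2 m i k j
  have b2 := p2 m i j k
  have c1 := h3 m k i j
  have s1 := h2 m k i j
  have s2 := h2 m j i k
  have s3 := h1 m j i k
  have s4 := h2 m i k j
  have s5 := h2 m j k i
  have s6 : T m j i k = -T m j k i := by rw [← h2 m j i k, h1 k i m j, h2 m j k i]
  have s7 : T m i k j = -T m i j k := by rw [← h2 m i k j, h1 j k m i, h2 m i j k]
  linarith

/-! ### The curvature tensor in coordinates -/

variable {g : Coord n → Matrix (Fin n) (Fin n) ℝ} {s : Set (Coord n)} {x : Coord n}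

lemma innerAt_comm (hsymm : ∀ i j, g x i j = g x j i) (a b : Coord n) :
    innerAt g x a b = innerAt g x b a := by
  unfold innerAt
  rw [Finset.sum_comm]
  refine Finset.sum_congr rfl fun i _ => Finset.sum_congr rfl fun j _ => ?_
  rw [hsymm]; ring

lemma innerAt_add_left (a a' b : Coord n) :
    innerAt g x (a + a') b = innerAt g x a b + innerAt g x a' b := by
  simp only [innerAt, ← Finset.sum_add_distrib, PiLp.add_apply]
  refine Finset.sum_congr rfl fun i _ => Finset.sum_congr rfl fun j _ => by ring

lemma innerAt_add_right (a b b' : Coord n) :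
    innerAt g x a (b + b') = innerAt g x a b + innerAt g x a b' := by
  simp only [innerAt, ← Finset.sum_add_distrib, PiLp.add_apply]
  refine Finset.sum_congr rfl fun i _ => Finset.sum_congr rfl fun j _ => by ring

lemma innerAt_smul_left (t : ℝ) (a b : Coord n) :
    innerAt g x (t • a) b = t * innerAt g x a b := by
  simp only [innerAt, Finset.mul_sum, PiLp.smul_apply, smul_eq_mul]
  refine Finset.sum_congr rfl fun i _ => Finset.sum_congr rfl fun j _ => by ring

lemma innerAt_smul_right (t : ℝ) (a b : Coord n) :
    innerAt g x a (t • b) = t * innerAt g x a b := by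
  simp only [innerAt, Finset.mul_sum, PiLp.smul_apply, smul_eq_mul]
  refine Finset.sum_congr rfl fun i _ => Finset.sum_congr rfl fun j _ => by ring

lemma innerAt_basisVec (i j : Fin n) : innerAt g x (basisVec i) (basisVec j) = g x i j := by
  simp [innerAt, Finset.sum_ite_eq', mul_ite]

lemma det_ne_zero_of_pos (hpos : ∀ y : Coord n, y ≠ 0 → 0 < innerAt g x y y) :
    (g x).det ≠ 0 := by
  intro h
  obtain ⟨v, hv, hv0⟩ := Matrix.exists_mulVec_eq_zero_iff.2 h
  have h1 := hpos (WithLp.toLp 2 v) (by simpa using hv)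
  have h2 : innerAt g x (WithLp.toLp 2 v) (WithLp.toLp 2 v) = ∑ i, v i * (g x *ᵥ v) i := by
    simp only [innerAt, Matrix.mulVec, dotProduct, Finset.mul_sum]
    refine Finset.sum_congr rfl fun i _ => Finset.sum_congr rfl fun j _ => by ring
  rw [h2, hv0] at h1
  simp at h1

lemma sum_mul_inv_mul (hdet : (g x).det ≠ 0) (f : Fin n → ℝ) (m : Fin n) :
    ∑ k, g x m k * ∑ l, (g x)⁻¹ k l * f l = f m := by
  have h := congrFun (congrArg (fun A => A *ᵥ f)
    (Matrix.mul_nonsing_inv (g x) (isUnit_iff_ne_zero.2 hdet))) m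
  simp only [← Matrix.mulVec_mulVec, Matrix.one_mulVec] at h
  simpa [Matrix.mulVec, dotProduct] using h

lemma inv_symm (hsymm : ∀ i j, g x i j = g x j i) (i j : Fin n) : (g x)⁻¹ i j = (g x)⁻¹ j i := by
  have h : (g x)ᵀ = g x := by ext i j; exact hsymm j i
  have h2 : ((g x)⁻¹)ᵀ = (g x)⁻¹ := by rw [Matrix.transpose_nonsing_inv, h]
  exact congrFun (congrFun h2 j) i

/-- Christoffel symbols of the first kind `Γ_{l,ij}`. -/
noncomputable def christoffelLow (g : Coord n → Matrix (Fin n) (Fin n) ℝ) (l i j : Fin n)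
    (x : Coord n) : ℝ :=
  1 / 2 * (pd (fun z => g z l j) i x + pd (fun z => g z i l) j x - pd (fun z => g z i j) l x)

lemma christoffel_eq (k i j : Fin n) :
    christoffel g k i j x = ∑ l, (g x)⁻¹ k l * christoffelLow g l i j x := by
  simp only [christoffel, christoffelLow, Finset.mul_sum]
  refine Finset.sum_congr rfl fun l _ => by ring

lemma sum_mul_christoffel (hdet : (g x).det ≠ 0) (m i j : Fin n) :
    ∑ k, g x m k * christoffel g k i j x = christoffelLow g m i j x := by
  simp only [christoffel_eq]
  exact sum_mul_inv_mul hdet (fun l => christoffelLow g l i j x) m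

lemma contDiffOn_christoffelLow (hs : IsOpen s)
    (hg : ∀ i j, ContDiffOn ℝ ∞ (fun x => g x i j) s) (l i j : Fin n) :
    ContDiffOn ℝ ∞ (christoffelLow g l i j) s :=
  contDiffOn_const.mul (((contDiffOn_pd hs (hg _ _) _).add (contDiffOn_pd hs (hg _ _) _)).sub
    (contDiffOn_pd hs (hg _ _) _))

lemma contDiffOn_christoffel (hs : IsOpen s) (hg : ∀ i j, ContDiffOn ℝ ∞ (fun x => g x i j) s)
    (hdet : ∀ x ∈ s, (g x).det ≠ 0) (k i j : Fin n) :
    ContDiffOn ℝ ∞ (christoffel g k i j) s := by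
  have : ContDiffOn ℝ ∞ (fun x => ∑ l, (g x)⁻¹ k l * christoffelLow g l i j x) s :=
    ContDiffOn.sum fun l _ => (contDiffOn_inv_apply hg hdet k l).mul
      (contDiffOn_christoffelLow hs hg l i j)
  exact this.congr fun x _ => christoffel_eq k i j

/-- The Levi-Civita connection is metric. -/
lemma pd_metric (hs : IsOpen s) (hx : x ∈ s) (hsymm : ∀ x ∈ s, ∀ i j, g x i j = g x j i)
    (i m l : Fin n) :
    pd (fun z => g z m l) i x = christoffelLow g m i l x + christoffelLow g l i m x := by
  have h : ∀ a b c, pd (fun z => g z a b) c x = pd (fun z => g z b a) c x := fun a b c =>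
    pd_congr_of_mem hs hx fun y hy => hsymm y hy a b
  unfold christoffelLow
  rw [h l m i, h i l m, h i m l, h l i m]
  ring

lemma christoffelLow_symm (hs : IsOpen s) (hx : x ∈ s)
    (hsymm : ∀ x ∈ s, ∀ i j, g x i j = g x j i) (l i j : Fin n) :
    christoffelLow g l i j x = christoffelLow g l j i x := by
  have h : ∀ a b c, pd (fun z => g z a b) c x = pd (fun z => g z b a) c x := fun a b c =>
    pd_congr_of_mem hs hx fun y hy => hsymm y hy a b
  unfold christoffelLow
  rw [h l j i, h i l j, h i j l]
  ring

/-- The scalar product of Christoffel symbols that enters the lowered curvature tensor. -/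
noncomputable def christoffelProd (g : Coord n → Matrix (Fin n) (Fin n) ℝ) (a b c d : Fin n)
    (x : Coord n) : ℝ :=
  ∑ l, christoffelLow g l a b x * christoffel g l c d x

lemma christoffelProd_symm (hsymm : ∀ i j, g x i j = g x j i) (a b c d : Fin n) :
    christoffelProd g a b c d x = christoffelProd g c d a b x := by
  simp only [christoffelProd, christoffel_eq, Finset.mul_sum]
  rw [Finset.sum_comm]
  refine Finset.sum_congr rfl fun i _ => Finset.sum_congr rfl fun j _ => ?_
  rw [inv_symm hsymm i j]; ring

/-- The lowered curvature tensor: the derivatives of the inverse metric cancel. -/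
lemma sum_mul_curvature (hs : IsOpen s) (hx : x ∈ s)
    (hg : ∀ i j, ContDiffOn ℝ ∞ (fun x => g x i j) s)
    (hsymm : ∀ x ∈ s, ∀ i j, g x i j = g x j i) (hdet : ∀ x ∈ s, (g x).det ≠ 0)
    (m k i j : Fin n) :
    ∑ l, g x m l * curvature g l k i j x =
      pd (christoffelLow g m j k) i x - pd (christoffelLow g m i k) j x
        - christoffelProd g i m j k x + christoffelProd g j m i k x := by
  have hΓ : ∀ k i j, DifferentiableAt ℝ (christoffel g k i j) x := fun k i j =>
    differentiableAt_of_contDiffOn hs (contDiffOn_christoffel hs hg hdet k i j) hx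
  have hgd : ∀ i j, DifferentiableAt ℝ (fun x => g x i j) x := fun i j =>
    differentiableAt_of_contDiffOn hs (hg i j) hx
  have hd : ∀ i j k, ∑ l, g x m l * pd (christoffel g l j k) i x =
      pd (christoffelLow g m j k) i x
        - ∑ l, (christoffelLow g m i l x + christoffelLow g l i m x) * christoffel g l j k x := by
    intro i j k
    have h1 : pd (fun z => ∑ l, g z m l * christoffel g l j k z) i x =
        pd (christoffelLow g m j k) i x :=
      pd_congr_of_mem hs hx fun y hy => sum_mul_christoffel (hdet y hy) m j k
    rw [pd_sum (fun l _ => (hgd m l).fun_mul (hΓ l j k))] at h1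
    simp only [pd_mul (hgd m _) (hΓ _ j k)] at h1
    simp only [Finset.sum_add_distrib, pd_metric hs hx hsymm] at h1
    linarith
  have hq : ∀ i j, ∑ l, g x m l * ∑ p, christoffel g l i p x * christoffel g p j k x =
      ∑ p, christoffelLow g m i p x * christoffel g p j k x := by
    intro i j
    simp only [Finset.mul_sum]
    rw [Finset.sum_comm]
    refine Finset.sum_congr rfl fun p _ => ?_
    rw [← sum_mul_christoffel (hdet x hx) m i p, Finset.sum_mul]
    refine Finset.sum_congr rfl fun l _ => by ring
  have e : ∀ l, g x m l * curvature g l k i j x =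
      g x m l * pd (christoffel g l j k) i x - g x m l * pd (christoffel g l i k) j x
      + g x m l * ∑ p, christoffel g l i p x * christoffel g p j k x
      - g x m l * ∑ p, christoffel g l j p x * christoffel g p i k x := by
    intro l
    simp only [curvature, Finset.sum_sub_distrib]
    ring
  simp only [e, Finset.sum_add_distrib, Finset.sum_sub_distrib, hd, hq, christoffelProd, add_mul]
  ring

lemma pd_christoffelLow (hs : IsOpen s) (hx : x ∈ s)
    (hg : ∀ i j, ContDiffOn ℝ ∞ (fun x => g x i j) s) (m j k i : Fin n) :
    pd (christoffelLow g m j k) i x = 1 / 2 * (pd (pd (fun z => g z m k) j) i x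
      + pd (pd (fun z => g z j m) k) i x - pd (pd (fun z => g z j k) m) i x) := by
  have hd : ∀ a b c, DifferentiableAt ℝ (pd (fun z => g z a b) c) x := fun a b c =>
    differentiableAt_of_contDiffOn hs (contDiffOn_pd hs (hg a b) c) hx
  have e : christoffelLow g m j k = fun x => 1 / 2 * (pd (fun z => g z m k) j x
      + pd (fun z => g z j m) k x - pd (fun z => g z j k) m x) := rfl
  rw [e, pd_const_mul _ (((hd _ _ _).fun_add (hd _ _ _)).fun_sub (hd _ _ _)),
    pd_sub ((hd _ _ _).fun_add (hd _ _ _)) (hd _ _ _), pd_add (hd _ _ _) (hd _ _ _)]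

/-- In a metric of constant sectional curvature `μ` the curvature tensor is
`R(∂_i, ∂_j) ∂_k = μ (g_kj ∂_i - g_ki ∂_j)`. -/
theorem curvature_eq_of_sectionalCurvature_eq (hs : IsOpen s)
    (hg : ∀ i j, ContDiffOn ℝ ∞ (fun x => g x i j) s)
    (hsymm : ∀ x ∈ s, ∀ i j, g x i j = g x j i)
    (hpos : ∀ x ∈ s, ∀ y : Coord n, y ≠ 0 → 0 < innerAt g x y y) {μ : ℝ}
    (hμ : ∀ x ∈ s, ∀ a b : Coord n, LinearIndependent ℝ ![a, b] → sectionalCurvature g x a b = μ)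
    (hx : x ∈ s) (l k i j : Fin n) :
    curvature g l k i j x
      = μ * ((if l = i then g x k j else 0) - if l = j then g x k i else 0) := by
  have hdet : ∀ x ∈ s, (g x).det ≠ 0 := fun x hx => det_ne_zero_of_pos (hpos x hx)
  set R : Fin n → Fin n → Fin n → Fin n → ℝ := fun m k i j =>
    ∑ l, g x m l * curvature g l k i j x with hR
  set G : Fin n → Fin n → Fin n → Fin n → ℝ := fun a b c d =>
    pd (pd (fun z => g z a b) c) d x with hG
  have hG1 : ∀ a b c d, G a b c d = G b a c d := fun a b c d =>
    pd_congr_of_mem hs hx fun y hy => pd_congr_of_mem hs hy fun z hz => hsymm z hz a b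
  have hG2 : ∀ a b c d, G a b c d = G a b d c := fun a b c d => pd_comm hs (hg a b) hx c d
  set Γ : Fin n → Fin n → Fin n → Fin n → ℝ := fun a b c d => christoffelProd g a b c d x with hΓ
  have hΓ1 : ∀ a b c d, Γ a b c d = Γ c d a b := christoffelProd_symm (hsymm x hx)
  have hΓ2 : ∀ a b c d, Γ a b c d = Γ b a c d := by
    intro a b c d
    simp only [hΓ, christoffelProd]
    exact Finset.sum_congr rfl fun l _ => by rw [christoffelLow_symm hs hx hsymm]
  have hRf : ∀ m k i j, R m k i j = 1 / 2 * (G j m k i - G j k m i - G i m k j + G i k m j)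
      - Γ i m j k + Γ j m i k := by
    intro m k i j
    simp only [hR]
    rw [sum_mul_curvature hs hx hg hsymm hdet, pd_christoffelLow hs hx hg,
      pd_christoffelLow hs hx hg]
    change 1 / 2 * (G m k j i + G j m k i - G j k m i) - 1 / 2 * (G m k i j + G i m k j - G i k m j)
      - Γ i m j k + Γ j m i k = _
    rw [hG2 m k j i]; ring
  have hΓ3 : ∀ a b c d, Γ a b c d = Γ a b d c := fun a b c d => by
    rw [hΓ1, hΓ2, hΓ1]
  set W : Fin n → Fin n → Fin n → Fin n → ℝ := fun m k i j =>
    g x m i * g x k j - g x m j * g x k i with hW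
  have hsx := hsymm x hx
  set T : Fin n → Fin n → Fin n → Fin n → ℝ := fun m k i j => R m k i j - μ * W m k i j with hT
  have t1 : ∀ m k i j, T k m i j = -T m k i j := by
    intro m k i j
    have hw : W k m i j = -W m k i j := by simp only [hW]; ring
    simp only [hT, hRf, hw]
    linarith [hΓ1 i m j k, hΓ1 j m i k]
  have t2 : ∀ m k i j, T i j m k = T m k i j := by
    intro m k i j
    have hw : W i j m k = W m k i j := by
      simp only [hW]; rw [hsx i m, hsx j k, hsx i k, hsx j m]; ring
    simp only [hT, hRf, hw]
    linarith [hG1 j m k i, hG2 m j k i, hG1 j k m i, hG2 k j m i, hG1 i m k j, hG2 m i k j,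
      hG1 i k m j, hG2 k i m j, hΓ2 m i k j, hΓ3 i m k j, hΓ1 k i m j, hΓ2 m j k i, hΓ3 j m k i]
  have t3 : ∀ m k i j, T m k i j + T m i j k + T m j k i = 0 := by
    intro m k i j
    have hw : W m k i j + W m i j k + W m j k i = 0 := by
      simp only [hW]; rw [hsx k i, hsx k j, hsx j i]; ring
    have hw' : μ * W m k i j + μ * W m i j k + μ * W m j k i = 0 := by
      rw [← mul_add, ← mul_add, hw, mul_zero]
    simp only [hT, hRf]
    linarith [hG2 j m k i, hG1 j k m i, hG2 i m k j, hG1 i k m j, hG2 k m i j, hG1 j i m k,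
      hΓ3 i m j k, hΓ3 j m i k, hΓ3 k m j i]
  -- the sectional values of `T` vanish
  have t0 : ∀ a b : Fin n → ℝ, ∑ m, ∑ k, ∑ i, ∑ j, T m k i j * a m * b k * a i * b j = 0 := by
    intro a b
    set a' : Coord n := WithLp.toLp 2 a
    set b' : Coord n := WithLp.toLp 2 b
    by_cases hab : LinearIndependent ℝ ![a', b']
    · have hsec := hμ x hx a' b' hab
      have ha0 : a' ≠ 0 := hab.ne_zero 0
      have hD : 0 < innerAt g x a' a' * innerAt g x b' b' - innerAt g x a' b' ^ 2 := by
        have ha := hpos x hx a' ha0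
        have hw0 : innerAt g x a' a' • b' + (-innerAt g x a' b') • a' ≠ 0 := by
          intro h0
          have := (LinearIndependent.pair_iff.1 hab) _ _ ((add_comm _ _).trans h0)
          exact ha.ne' this.2
        have hw := hpos x hx _ hw0
        simp only [innerAt_add_left, innerAt_add_right, innerAt_smul_left,
          innerAt_smul_right] at hw
        rw [innerAt_comm hsx b' a'] at hw
        by_contra hcon
        push Not at hcon
        have := mul_nonneg ha.le (sub_nonneg.2 hcon)
        nlinarith
      unfold sectionalCurvature at hsec
      rw [div_eq_iff hD.ne'] at hsec
      have hnum : ∑ m, ∑ l, ∑ k, ∑ i, ∑ j,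
          g x m l * curvature g l k i j x * a' i * b' j * b' k * a' m =
          ∑ m, ∑ k, ∑ i, ∑ j, R m k i j * a m * b k * a i * b j := by
        refine Finset.sum_congr rfl fun m _ => ?_
        rw [Finset.sum_comm]
        refine Finset.sum_congr rfl fun k _ => ?_
        rw [Finset.sum_comm]
        refine Finset.sum_congr rfl fun i _ => ?_
        rw [Finset.sum_comm]
        refine Finset.sum_congr rfl fun j _ => ?_
        simp only [hR, Finset.sum_mul]
        refine Finset.sum_congr rfl fun l _ => ?_
        simp only [a', b']; ring
      have hWs : innerAt g x a' a' * innerAt g x b' b' - innerAt g x a' b' ^ 2 =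
          ∑ m, ∑ k, ∑ i, ∑ j, W m k i j * a m * b k * a i * b j := by
        have e1 : innerAt g x a' a' * innerAt g x b' b' =
            ∑ m, ∑ k, ∑ i, ∑ j, (g x m i * a m * a i) * (g x k j * b k * b j) := by
          simp only [innerAt, a', b', Finset.sum_mul_sum]
        have e2 : innerAt g x a' b' ^ 2 =
            ∑ m, ∑ k, ∑ i, ∑ j, (g x m j * a m * b j) * (g x k i * b k * a i) := by
          rw [sq]
          nth_rw 2 [innerAt_comm hsx]
          simp only [innerAt, a', b', Finset.sum_mul_sum]
          refine Finset.sum_congr rfl fun m _ => Finset.sum_congr rfl fun k _ => ?_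
          rw [Finset.sum_comm]
        rw [e1, e2]
        simp only [← Finset.sum_sub_distrib, hW]
        refine Finset.sum_congr rfl fun _ _ => Finset.sum_congr rfl fun _ _ =>
          Finset.sum_congr rfl fun _ _ => Finset.sum_congr rfl fun _ _ => by ring
      rw [hnum, hWs] at hsec
      simp only [hT, sub_mul, Finset.sum_sub_distrib]
      rw [hsec, sub_eq_zero]
      simp only [Finset.mul_sum]
      refine Finset.sum_congr rfl fun _ _ => Finset.sum_congr rfl fun _ _ =>
          Finset.sum_congr rfl fun _ _ => Finset.sum_congr rfl fun _ _ => by ring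
    · -- for proportional vectors the sum vanishes by antisymmetry
      have hanti : ∀ (c : Fin n → ℝ) (i j : Fin n), ∑ m, ∑ k, T m k i j * c m * c k = 0 := by
        intro c i j
        have h : ∑ m, ∑ k, T m k i j * c m * c k = -∑ m, ∑ k, T m k i j * c m * c k := by
          conv_lhs => rw [Finset.sum_comm]
          rw [← Finset.sum_neg_distrib]
          refine Finset.sum_congr rfl fun m _ => ?_
          rw [← Finset.sum_neg_distrib]
          refine Finset.sum_congr rfl fun k _ => ?_
          rw [t1]; ring
        linarith
      have hpar : ∃ (c : Fin n → ℝ) (p q : ℝ), a = p • c ∧ b = q • c := by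
        rw [LinearIndependent.pair_iff] at hab
        push Not at hab
        obtain ⟨p, q, h1, h2⟩ := hab
        have h1' : ∀ i, p * a i + q * b i = 0 := fun i => by
          simpa [a', b'] using congrFun (congrArg (fun v : Coord n => (v : Fin n → ℝ)) h1) i
        by_cases hp : p = 0
        · refine ⟨a, 1, 0, by simp, funext fun i => ?_⟩
          have := h1' i
          rw [hp, zero_mul, zero_add] at this
          simpa using (mul_eq_zero.1 this).resolve_left (h2 hp)
        · refine ⟨b, -q / p, 1, funext fun i => ?_, by simp⟩
          simp only [Pi.smul_apply, smul_eq_mul]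
          field_simp
          linarith [h1' i]
      obtain ⟨c, p, q, rfl, rfl⟩ := hpar
      have : ∑ m, ∑ k, ∑ i, ∑ j, T m k i j * (p • c) m * (q • c) k * (p • c) i * (q • c) j
          = ∑ i, ∑ j, p * q * p * q * c i * c j * ∑ m, ∑ k, T m k i j * c m * c k := by
        simp only [Finset.mul_sum]
        rw [Finset.sum_congr rfl fun m _ => Finset.sum_comm, Finset.sum_comm]
        refine Finset.sum_congr rfl fun i _ => ?_
        rw [Finset.sum_congr rfl fun m _ => Finset.sum_comm, Finset.sum_comm]
        refine Finset.sum_congr rfl fun j _ => Finset.sum_congr rfl fun m _ =>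
          Finset.sum_congr rfl fun k _ => ?_
        simp only [Pi.smul_apply, smul_eq_mul]; ring
      rw [this]
      simp [hanti]
  have hfin := eq_zero_of_sectional_eq_zero t1 t2 t3 t0
  -- raising an index
  set Z : Fin n → ℝ := fun l => curvature g l k i j x
      - μ * ((if l = i then g x k j else 0) - if l = j then g x k i else 0) with hZ
  have hgZ : g x *ᵥ Z = 0 := by
    funext m
    have h := hfin m k i j
    simp only [hT, hR, hW] at h
    simp only [Matrix.mulVec, dotProduct, hZ, mul_sub, Finset.sum_sub_distrib, mul_ite, mul_zero,
      Finset.sum_ite_eq', Finset.mem_univ, if_true, Pi.zero_apply]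
    linarith
  have hZ0 : Z = 0 := Matrix.eq_zero_of_mulVec_eq_zero (hdet x hx) hgZ
  have := congrFun hZ0 l
  simp only [hZ, Pi.zero_apply] at this
  linarith

end Curvature

/-! ### Flat linear systems of partial differential equations -/

section FlatSystem
open Metric Set
set_option maxSynthPendingDepth 3

variable {X E : Type*} [NormedAddCommGroup X] [NormedSpace ℝ X]
  [NormedAddCommGroup E] [NormedSpace ℝ E]

lemma exists_ball_bounds_of_contDiffAt {A : X → X →L[ℝ] E →L[ℝ] E} {x₀ : X}
    (hA : ContDiffAt ℝ ∞ A x₀) :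
    ∃ r > 0, ∃ C : ℝ, 0 ≤ C ∧ r ≤ 1 ∧ C * r ≤ 1 / 2 ∧ ∀ x ∈ ball x₀ r,
      DifferentiableAt ℝ A x ∧ ‖A x‖ ≤ C ∧ ‖fderiv ℝ A x‖ ≤ C ∧
      ∀ z ∈ ball x₀ r, ‖fderiv ℝ A z - fderiv ℝ A x‖ ≤ C * ‖z - x‖ := by
  have h1 : ContDiffAt ℝ 1 (fderiv ℝ A) x₀ := hA.fderiv_right (m := 1) (by norm_cast)
  obtain ⟨K, s, hs, hK⟩ := h1.exists_lipschitzOnWith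
  have hd : ∀ᶠ x in 𝓝 x₀, DifferentiableAt ℝ A x :=
    ((hA.of_le (m := 1) (by norm_cast)).eventually (by simp)).mono
      fun x hx => hx.differentiableAt one_ne_zero
  have hb1 : ∀ᶠ x in 𝓝 x₀, ‖A x‖ < ‖A x₀‖ + 1 :=
    hA.continuousAt.norm.eventually_lt continuousAt_const (by linarith)
  have hb2 : ∀ᶠ x in 𝓝 x₀, ‖fderiv ℝ A x‖ < ‖fderiv ℝ A x₀‖ + 1 :=
    h1.continuousAt.norm.eventually_lt continuousAt_const (by linarith)
  obtain ⟨r, hr, hball⟩ := Metric.eventually_nhds_iff_ball.1 (hd.and (hb1.and (hb2.and hs)))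
  set C : ℝ := ‖A x₀‖ + ‖fderiv ℝ A x₀‖ + 1 + K with hC
  have hC0 : 0 < C := by positivity
  refine ⟨min r (min 1 (1 / (2 * C))), by positivity, C, hC0.le,
    (min_le_right _ _).trans (min_le_left _ _), ?_, ?_⟩
  · calc C * min r (min 1 (1 / (2 * C))) ≤ C * (1 / (2 * C)) := by
          gcongr; exact (min_le_right _ _).trans (min_le_right _ _)
      _ = 1 / 2 := by field_simp
  · intro x hx
    have hx' := ball_subset_ball (min_le_left _ _) hx
    obtain ⟨a1, a2, a3, a4⟩ := hball x hx'
    refine ⟨a1, ?_, ?_, fun z hz => ?_⟩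
    · have := norm_nonneg (fderiv ℝ A x₀); have := K.2; linarith! [NNReal.coe_nonneg K]
    · have := norm_nonneg (A x₀); linarith [NNReal.coe_nonneg K]
    · have hz' := ball_subset_ball (min_le_left _ _) hz
      have := hK.norm_sub_le (hball z hz').2.2.2 a4
      refine this.trans ?_
      gcongr
      have := norm_nonneg (A x₀); have := norm_nonneg (fderiv ℝ A x₀)
      linarith

/-- Solving the linear equation `Y' = A (x₀ + t z) z Y` along the segment from `x₀` to `x₀ + z`. -/
lemma exists_radial_solution [CompleteSpace E] {A : X → X →L[ℝ] E →L[ℝ] E} {x₀ : X} {r C : ℝ}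
    (hC : 0 ≤ C) (hCr : C * r ≤ 1 / 2)
    (hA : ∀ x ∈ ball x₀ r, DifferentiableAt ℝ A x ∧ ‖A x‖ ≤ C) (y₀ : E) {z : X} (hz : ‖z‖ < r) :
    ∃ α : ℝ → E, α 0 = y₀ ∧ ∀ t ∈ Icc (0 : ℝ) 1,
      HasDerivWithinAt α (A (x₀ + t • z) z (α t)) (Icc 0 1) t := by
  have hmem : ∀ t ∈ Icc (0 : ℝ) 1, x₀ + t • z ∈ ball x₀ r := by
    intro t ht
    simp only [mem_ball, dist_self_add_left, norm_smul, Real.norm_eq_abs, abs_of_nonneg ht.1]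
    nlinarith [norm_nonneg z, ht.2]
  have hop : ∀ t ∈ Icc (0 : ℝ) 1, ‖A (x₀ + t • z) z‖ ≤ 1 / 2 := by
    intro t ht
    calc ‖A (x₀ + t • z) z‖ ≤ ‖A (x₀ + t • z)‖ * ‖z‖ := ContinuousLinearMap.le_opNorm _ _
      _ ≤ C * r := by gcongr; exact (hA _ (hmem t ht)).2
      _ ≤ _ := hCr
  have hpl : IsPicardLindelof (fun t y => A (x₀ + t • z) z y)
      (⟨0, by simp⟩ : Icc (0 : ℝ) 1) y₀ ‖y₀‖₊ 0 ‖y₀‖₊ 1 := by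
    constructor
    · intro t ht
      refine LipschitzWith.lipschitzOnWith (LipschitzWith.of_dist_le_mul fun a b => ?_)
      rw [dist_eq_norm, ← map_sub, dist_eq_norm]
      refine (ContinuousLinearMap.le_opNorm _ _).trans ?_
      gcongr
      simpa using (hop t ht).trans (by norm_num)
    · intro y _ t ht
      have hc : ContinuousAt (fun t : ℝ => A (x₀ + t • z)) t :=
        ContinuousAt.comp (f := fun t : ℝ => x₀ + t • z) (hA _ (hmem t ht)).1.continuousAt
          (by fun_prop)
      exact ((hc.clm_apply continuousAt_const).clm_apply continuousAt_const).continuousWithinAt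
    · intro t ht y hy
      refine (ContinuousLinearMap.le_opNorm _ _).trans ?_
      have h1 : ‖y‖ ≤ 2 * ‖y₀‖ := by
        have : ‖y - y₀‖ ≤ ‖y₀‖ := by simpa [dist_eq_norm] using hy
        calc ‖y‖ = ‖y - y₀ + y₀‖ := by simp
          _ ≤ ‖y - y₀‖ + ‖y₀‖ := norm_add_le _ _
          _ ≤ _ := by linarith
      calc _ ≤ (1 / 2) * (2 * ‖y₀‖) := by
            gcongr; exact hop t ht
        _ = _ := by simp
    · simp
  simpa using hpl.exists_eq_forall_mem_Icc_hasDerivWithinAt₀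

set_option maxHeartbeats 1000000 in
/-- The value at time `1` of the radial solutions depends on the endpoint as prescribed by the
system. The curve `t ↦ α t + t A (x₀ + t z) v (α t)` solves the radial equation in the direction
`z + v` up to an error `O(‖v‖²)`, because the system is flat; Grönwall's inequality concludes. -/
lemma hasFDerivAt_of_radial_solutions {A : X → X →L[ℝ] E →L[ℝ] E} {x₀ : X} {r C : ℝ}
    (hC : 0 ≤ C) (hr1 : r ≤ 1) (hCr : C * r ≤ 1 / 2)
    (hA : ∀ x ∈ ball x₀ r, DifferentiableAt ℝ A x ∧ ‖A x‖ ≤ C ∧ ‖fderiv ℝ A x‖ ≤ C ∧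
      ∀ z ∈ ball x₀ r, ‖fderiv ℝ A z - fderiv ℝ A x‖ ≤ C * ‖z - x‖)
    (hflat : ∀ x ∈ ball x₀ r, ∀ u v y, fderiv ℝ A x u v y - fderiv ℝ A x v u y
      + A x v (A x u y) - A x u (A x v y) = 0)
    {y₀ : E} {α : X → ℝ → E} (h0 : ∀ z, ‖z‖ < r → α z 0 = y₀)
    (hα : ∀ z, ‖z‖ < r → ∀ t ∈ Icc (0 : ℝ) 1,
      HasDerivWithinAt (α z) (A (x₀ + t • z) z (α z t)) (Icc 0 1) t)
    {z : X} (hz : ‖z‖ < r) :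
    HasFDerivAt (fun z => α z 1) ((A (x₀ + z)).flip (α z 1)) z := by
  have hmem : ∀ z, ‖z‖ < r → ∀ t ∈ Icc (0 : ℝ) 1, x₀ + t • z ∈ ball x₀ r := by
    intro z hz t ht
    simp only [mem_ball, dist_self_add_left, norm_smul, Real.norm_eq_abs, abs_of_nonneg ht.1]
    nlinarith [norm_nonneg z, ht.2]
  have hr0 : 0 < r := (norm_nonneg z).trans_lt hz
  obtain ⟨m, hm⟩ : ∃ m, ∀ t ∈ Icc (0 : ℝ) 1, ‖α z t‖ ≤ m :=
    isCompact_Icc.exists_bound_of_continuousOn fun t ht => (hα z hz t ht).continuousWithinAt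
  have hm0 : 0 ≤ m := (norm_nonneg _).trans (hm 0 (by simp))
  set K : ℝ := C * C * m + C * m + C * C * m + C * C * m + C * (m + C * m) with hK
  have hK0 : 0 ≤ K := by positivity
  -- `g` is the comparison curve, and its defect in the equation for `z + v` is at most `K ‖v‖²`
  have key : ∀ v : X, ‖z + v‖ < r → ‖v‖ ≤ 1 →
      ‖α (z + v) 1 - α z 1 - A (x₀ + z) v (α z 1)‖ ≤ K * (Real.exp 1 - 1) * ‖v‖ ^ 2 := by
    intro v hzv hv
    set g : ℝ → E := fun t => α z t + t • A (x₀ + t • z) v (α z t) with hg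
    have hAd : ∀ t ∈ Icc (0 : ℝ) 1,
        HasDerivAt (fun t : ℝ => A (x₀ + t • z)) (fderiv ℝ A (x₀ + t • z) z) t := by
      intro t ht
      have h1 : HasDerivAt (fun t : ℝ => x₀ + t • z) z t := by
        simpa using ((hasDerivAt_id t).smul_const z).const_add x₀
      exact (hA _ (hmem z hz t ht)).1.hasFDerivAt.comp_hasDerivAt t h1
    set g' : ℝ → E := fun t => A (x₀ + t • z) z (α z t)
      + (t • (fderiv ℝ A (x₀ + t • z) z v (α z t)
          + A (x₀ + t • z) v (A (x₀ + t • z) z (α z t)))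
        + A (x₀ + t • z) v (α z t)) with hg'
    have hgd : ∀ t ∈ Icc (0 : ℝ) 1, HasDerivWithinAt g (g' t) (Icc 0 1) t := by
      intro t ht
      have h2 : HasDerivWithinAt (fun t : ℝ => A (x₀ + t • z) v (α z t))
          (fderiv ℝ A (x₀ + t • z) z v (α z t)
          + A (x₀ + t • z) v (A (x₀ + t • z) z (α z t))) (Icc 0 1) t := by
        have h3 := ((hAd t ht).hasDerivWithinAt (s := Icc 0 1)).clm_apply
          (hasDerivWithinAt_const t (Icc (0 : ℝ) 1) v)
        have h4 := h3.clm_apply (hα z hz t ht)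
        simpa using h4
      have h5 := (hasDerivWithinAt_id t (Icc (0 : ℝ) 1)).smul h2
      have h6 : HasDerivWithinAt g _ (Icc 0 1) t := (hα z hz t ht).add h5
      exact h6.congr_deriv (by simp [hg'])
    have hop : ∀ t ∈ Icc (0 : ℝ) 1, ‖A (x₀ + t • (z + v)) (z + v)‖ ≤ 1 := by
      intro t ht
      calc ‖A (x₀ + t • (z + v)) (z + v)‖ ≤ ‖A (x₀ + t • (z + v))‖ * ‖z + v‖ :=
            ContinuousLinearMap.le_opNorm _ _
        _ ≤ C * r := by gcongr; exact (hA _ (hmem _ hzv t ht)).2.1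
        _ ≤ _ := by linarith
    have hci : ∀ {f : ℝ → E} {f' : E} {t : ℝ}, t ∈ Ico (0 : ℝ) 1 →
        HasDerivWithinAt f f' (Icc 0 1) t → HasDerivWithinAt f f' (Ici t) t := by
      intro f f' t ht h
      exact h.mono_of_mem_nhdsWithin (Icc_mem_nhdsGE_of_mem ht)
    have hgron := dist_le_of_approx_trajectories_ODE_of_mem (K := 1) (a := 0) (b := 1)
      (v := fun t y => A (x₀ + t • (z + v)) (z + v) y) (s := fun _ => univ)
      (f := α (z + v)) (f' := fun t => A (x₀ + t • (z + v)) (z + v) (α (z + v) t))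
      (g := g) (g' := g') (εf := 0) (εg := K * ‖v‖ ^ 2) (δ := 0)
      (fun t ht => by
        refine LipschitzWith.lipschitzOnWith (LipschitzWith.of_dist_le_mul fun a b => ?_)
        rw [dist_eq_norm, ← map_sub, dist_eq_norm]
        refine (ContinuousLinearMap.le_opNorm _ _).trans ?_
        gcongr
        simpa using hop t (Ico_subset_Icc_self ht))
      (fun t ht => (hα _ hzv t ht).continuousWithinAt)
      (fun t ht => hci ht (hα _ hzv t (Ico_subset_Icc_self ht)))
      (fun t ht => by simp)
      (fun t ht => by trivial)
      (fun t ht => (hgd t ht).continuousWithinAt)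
      (fun t ht => hci ht (hgd t (Ico_subset_Icc_self ht)))
      (fun t ht => by
        have ht' := Ico_subset_Icc_self ht
        obtain ⟨b1, b2, b3, b4⟩ := hA _ (hmem z hz t ht')
        set a := α z t
        set B := A (x₀ + t • z)
        set D := fderiv ℝ A (x₀ + t • z)
        set R := A (x₀ + t • (z + v)) - B - t • D v with hR
        have hRb : ‖R‖ ≤ C * ‖v‖ ^ 2 := by
          have hsub : x₀ + t • (z + v) - (x₀ + t • z) = t • v := by
            rw [smul_add]; abel
          have hseg : ∀ w ∈ segment ℝ (x₀ + t • z) (x₀ + t • (z + v)),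
              ‖w - (x₀ + t • z)‖ ≤ ‖v‖ ∧ w ∈ ball x₀ r := by
            intro w hw
            refine ⟨?_, (convex_ball x₀ r).segment_subset (hmem z hz t ht') (hmem _ hzv t ht') hw⟩
            have := norm_sub_le_of_mem_segment hw
            rw [hsub, norm_smul, Real.norm_eq_abs, abs_of_nonneg ht'.1] at this
            nlinarith [norm_nonneg v, ht'.2]
          have hmv := (convex_segment (𝕜 := ℝ) (x₀ + t • z)
            (x₀ + t • (z + v))).norm_image_sub_le_of_norm_hasFDerivWithin_le'
            (f := A) (f' := fderiv ℝ A) (φ := D) (C := C * ‖v‖)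
            (fun w hw => ((hA w (hseg w hw).2).1.hasFDerivAt).hasFDerivWithinAt)
            (fun w hw => (b4 w (hseg w hw).2).trans (by gcongr; exact (hseg w hw).1))
            (left_mem_segment ℝ _ _) (right_mem_segment ℝ _ _)
          rw [hsub, map_smul] at hmv
          refine hmv.trans ?_
          rw [norm_smul, Real.norm_eq_abs, abs_of_nonneg ht'.1]
          have : t * ‖v‖ ≤ ‖v‖ := by nlinarith [norm_nonneg v, ht'.2]
          calc _ ≤ C * ‖v‖ * ‖v‖ := by gcongr
            _ = _ := by ring
        have hA' : A (x₀ + t • (z + v)) = B + t • D v + R := by rw [hR]; abel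
        have hfl := hflat _ (hmem z hz t ht') z v a
        -- flatness exchanges `z` and `v` in the first order terms; only quadratic terms remain
        have hdiff : g' t - A (x₀ + t • (z + v)) (z + v) (g t)
            = -(t • B v (B v a) + t • D v v a + (t * t) • D v z (B v a)
              + (t * t) • D v v (B v a) + R (z + v) (a + t • B v a)) := by
          have hfl' : t • (D z v a + B v (B z a)) = t • (D v z a + B z (B v a)) := by
            congr 1
            rw [← sub_eq_zero, ← hfl]; abel
          simp only [hg, hg', hA']
          change B z a + (t • (D z v a + B v (B z a)) + B v a)
            - (B + t • D v + R) (z + v) (a + t • B v a) = _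
          rw [hfl']
          simp only [add_apply, smul_apply, map_add,
            map_smul, smul_add, mul_smul]
          abel
        rw [dist_eq_norm, hdiff, norm_neg]
        have ha : ‖a‖ ≤ m := hm t ht'
        have htt : t * t ≤ 1 := by nlinarith [ht'.1, ht'.2]
        have hz1 : ‖z‖ ≤ 1 := hz.le.trans hr1
        have hzv1 : ‖z + v‖ ≤ 1 := hzv.le.trans hr1
        have nB : ∀ w y, ‖B w y‖ ≤ C * ‖w‖ * ‖y‖ := fun w y =>
          (B.le_opNorm₂ w y).trans (by gcongr)
        have nD : ∀ u w y, ‖D u w y‖ ≤ C * ‖u‖ * ‖w‖ * ‖y‖ := fun u w y =>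
          ((D u).le_opNorm₂ w y).trans (by gcongr; exact (D.le_opNorm u).trans (by gcongr))
        have nR : ∀ w y, ‖R w y‖ ≤ C * ‖v‖ ^ 2 * ‖w‖ * ‖y‖ := fun w y =>
          (R.le_opNorm₂ w y).trans (by gcongr)
        have nBa : ‖B v a‖ ≤ C * ‖v‖ * m := (nB v a).trans (by gcongr)
        have nsm : ∀ (s : ℝ) (y : E), 0 ≤ s → s ≤ 1 → ‖s • y‖ ≤ ‖y‖ := by
          intro s y h0 h1
          rw [norm_smul, Real.norm_eq_abs, abs_of_nonneg h0]
          nlinarith [norm_nonneg y]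
        have e1 : ‖t • B v (B v a)‖ ≤ C * C * m * ‖v‖ ^ 2 := by
          refine (nsm _ _ ht'.1 ht'.2).trans ((nB _ _).trans ?_)
          calc C * ‖v‖ * ‖B v a‖ ≤ C * ‖v‖ * (C * ‖v‖ * m) := by gcongr
            _ = _ := by ring
        have e2 : ‖t • D v v a‖ ≤ C * m * ‖v‖ ^ 2 := by
          refine (nsm _ _ ht'.1 ht'.2).trans ((nD _ _ _).trans ?_)
          calc C * ‖v‖ * ‖v‖ * ‖a‖ ≤ C * ‖v‖ * ‖v‖ * m := by gcongr
            _ = _ := by ring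
        have e3 : ‖(t * t) • D v z (B v a)‖ ≤ C * C * m * ‖v‖ ^ 2 := by
          refine (nsm _ _ (mul_self_nonneg t) htt).trans ((nD _ _ _).trans ?_)
          calc C * ‖v‖ * ‖z‖ * ‖B v a‖ ≤ C * ‖v‖ * 1 * (C * ‖v‖ * m) := by gcongr
            _ = _ := by ring
        have e4 : ‖(t * t) • D v v (B v a)‖ ≤ C * C * m * ‖v‖ ^ 2 := by
          refine (nsm _ _ (mul_self_nonneg t) htt).trans ((nD _ _ _).trans ?_)
          calc C * ‖v‖ * ‖v‖ * ‖B v a‖ ≤ C * ‖v‖ * 1 * (C * ‖v‖ * m) := by gcongr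
            _ = _ := by ring
        have e5 : ‖R (z + v) (a + t • B v a)‖ ≤ C * (m + C * m) * ‖v‖ ^ 2 := by
          refine (nR _ _).trans ?_
          have : ‖a + t • B v a‖ ≤ m + C * m := by
            refine (norm_add_le _ _).trans (add_le_add ha ((nsm _ _ ht'.1 ht'.2).trans
              (nBa.trans ?_)))
            calc C * ‖v‖ * m ≤ C * 1 * m := by gcongr
              _ = _ := by ring
          calc C * ‖v‖ ^ 2 * ‖z + v‖ * ‖a + t • B v a‖
              ≤ C * ‖v‖ ^ 2 * 1 * (m + C * m) := by gcongr
            _ = _ := by ring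
        calc _ ≤ ‖t • B v (B v a)‖ + ‖t • D v v a‖ + ‖(t * t) • D v z (B v a)‖
              + ‖(t * t) • D v v (B v a)‖ + ‖R (z + v) (a + t • B v a)‖ := by
              refine (norm_add_le _ _).trans ?_
              gcongr
              refine (norm_add_le _ _).trans ?_
              gcongr
              exact norm_add₃_le
          _ ≤ _ := by rw [hK]; linarith)
      (fun t ht => by trivial)
      (by simp [hg, h0 _ hzv, h0 _ hz]) 1 (by simp)
    rw [gronwallBound_of_K_ne_0 (by simp)] at hgron
    simp only [hg, dist_eq_norm, one_smul, NNReal.coe_one] at hgron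
    rw [sub_sub]
    refine hgron.trans (le_of_eq ?_)
    norm_num; ring
  rw [hasFDerivAt_iff_isLittleO_nhds_zero]
  have hO : (fun v => α (z + v) 1 - α z 1 - (A (x₀ + z)).flip (α z 1) v) =O[𝓝 0]
      fun v : X => ‖v‖ ^ 2 := by
    refine Asymptotics.IsBigO.of_bound (K * (Real.exp 1 - 1)) ?_
    have hcont : ContinuousAt (fun v : X => ‖z + v‖) 0 := by fun_prop
    have e1 : ∀ᶠ v : X in 𝓝 0, ‖z + v‖ < r :=
      hcont.eventually_lt continuousAt_const (by simpa using hz)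
    have e2 : ∀ᶠ v : X in 𝓝 0, ‖v‖ < 1 :=
      continuousAt_id.norm.eventually_lt continuousAt_const (by simp)
    filter_upwards [e1, e2] with v h1 h2
    simpa using key v h1 h2.le
  refine hO.trans_isLittleO ?_
  simpa using Asymptotics.isLittleO_norm_pow_id (E' := X) (n := 2) (by norm_num)

/-- **Flat linear systems are locally solvable**: if `dA + A ∧ A = 0` near `x₀`, then the system
`dY = A Y` has a solution near `x₀` with any prescribed value at `x₀`. -/
theorem exists_solution_of_flat [CompleteSpace E] {A : X → X →L[ℝ] E →L[ℝ] E} {x₀ : X} {U : Set X}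
    (hU : U ∈ 𝓝 x₀) (hA : ContDiffAt ℝ ∞ A x₀)
    (hflat : ∀ x ∈ U, ∀ u v y, fderiv ℝ A x u v y - fderiv ℝ A x v u y
      + A x v (A x u y) - A x u (A x v y) = 0) :
    ∃ r > 0, ball x₀ r ⊆ U ∧ ∀ y₀ : E, ∃ Y : X → E, Y x₀ = y₀ ∧
      ∀ x ∈ ball x₀ r, HasFDerivAt Y ((A x).flip (Y x)) x := by
  obtain ⟨r, hr, C, hC, hr1, hCr, hb⟩ := exists_ball_bounds_of_contDiffAt hA
  obtain ⟨s, hs, hsU⟩ := Metric.mem_nhds_iff.1 hU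
  set q := min r s
  have hq : 0 < q := lt_min hr hs
  have hqr : ball x₀ q ⊆ ball x₀ r := ball_subset_ball (min_le_left _ _)
  have hCq : C * q ≤ 1 / 2 := by
    refine le_trans ?_ hCr
    gcongr; exact min_le_left _ _
  refine ⟨q, hq, (ball_subset_ball (min_le_right _ _)).trans hsU, fun y₀ => ?_⟩
  have hex : ∀ z : X, ∃ α : ℝ → E, ‖z‖ < q → α 0 = y₀ ∧ ∀ t ∈ Icc (0 : ℝ) 1,
      HasDerivWithinAt α (A (x₀ + t • z) z (α t)) (Icc 0 1) t := by
    intro z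
    by_cases hz : ‖z‖ < q
    · obtain ⟨α, h1, h2⟩ := exists_radial_solution hC hCq
        (fun x hx => ⟨(hb x (hqr hx)).1, (hb x (hqr hx)).2.1⟩) y₀ hz
      exact ⟨α, fun _ => ⟨h1, h2⟩⟩
    · exact ⟨0, fun h => absurd h hz⟩
  choose α hα using hex
  have hd : ∀ z, ‖z‖ < q → HasFDerivAt (fun z => α z 1) ((A (x₀ + z)).flip (α z 1)) z :=
    fun z hz => hasFDerivAt_of_radial_solutions hC ((min_le_left _ _).trans hr1) hCq
      (fun x hx => ⟨(hb x (hqr hx)).1, (hb x (hqr hx)).2.1, (hb x (hqr hx)).2.2.1,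
        fun z hz => (hb x (hqr hx)).2.2.2 z (hqr hz)⟩)
      (fun x hx => hflat x (hsU (ball_subset_ball (min_le_right _ _) hx)))
      (fun z hz => (hα z hz).1) (fun z hz => (hα z hz).2) hz
  refine ⟨fun x => α (x - x₀) 1, ?_, fun x hx => ?_⟩
  · -- along the constant segment the solution is constant
    have h0 : ‖(0 : X)‖ < q := by simpa using hq
    obtain ⟨h1, h2⟩ := hα 0 h0
    have h3 := constant_of_has_deriv_right_zero (f := α 0) (a := 0) (b := 1)
      (fun t ht => (h2 t ht).continuousWithinAt) (fun t ht => by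
        have := h2 t (Ico_subset_Icc_self ht)
        rw [map_zero, zero_apply] at this
        exact this.mono_of_mem_nhdsWithin (Icc_mem_nhdsGE_of_mem ht)) 1 (by simp)
    simp [h3, h1]
  · have hx' : ‖x - x₀‖ < q := by simpa [dist_eq_norm] using hx
    have h1 := hd _ hx'
    have h2 : HasFDerivAt (fun x => x - x₀) (ContinuousLinearMap.id ℝ X) x :=
      (hasFDerivAt_id x).sub_const x₀
    have := h1.comp x h2
    simpa [Function.comp_def] using this

/-- Solutions of `dY = A Y` are as smooth as `A`. -/
lemma contDiffOn_of_hasFDerivAt_flip {A : X → X →L[ℝ] E →L[ℝ] E} {Y : X → E} {s : Set X}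
    (hs : IsOpen s) (hA : ContDiffOn ℝ ∞ A s)
    (hY : ∀ x ∈ s, HasFDerivAt Y ((A x).flip (Y x)) x) : ContDiffOn ℝ ∞ Y s := by
  rw [contDiffOn_infty]
  intro k
  induction k with
  | zero =>
    exact contDiffOn_zero.2 fun x hx => (hY x hx).continuousAt.continuousWithinAt
  | succ k ih =>
    have : ((k + 1 : ℕ) : WithTop ℕ∞) = (k : WithTop ℕ∞) + 1 := by norm_cast
    rw [this, contDiffOn_succ_iff_fderiv_of_isOpen hs]
    refine ⟨fun x hx => (hY x hx).differentiableAt.differentiableWithinAt, by simp, ?_⟩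
    have hflip : ContDiffOn ℝ k (fun x => (A x).flip (Y x)) s := by
      have hA' : ContDiffOn ℝ k (fun x => (A x).flip) s :=
        (ContinuousLinearMap.flipₗᵢ ℝ X E E).contDiff.comp_contDiffOn
          (hA.of_le (by exact_mod_cast (le_top : (k : ℕ∞) ≤ ⊤)))
      exact hA'.clm_apply ih
    exact hflip.congr fun x hx => (hY x hx).fderiv

end FlatSystem

/-! ### Local isometry with the model space -/

section LocalIsometry
open Metric Set

variable {n : ℕ} {g : Coord n → Matrix (Fin n) (Fin n) ℝ} {s : Set (Coord n)} {x : Coord n}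

/-- Derivative of the scalar product `∑ g^{kl} b_k b'_l` of two 1-forms; here `ζ = g⁻¹ b` and
`ζ' = g⁻¹ b'`. -/
lemma pd_sum_mul_inv_mul (hs : IsOpen s) (hx : x ∈ s)
    (hg : ∀ i j, ContDiffOn ℝ ∞ (fun x => g x i j) s)
    (hsymm : ∀ x ∈ s, ∀ i j, g x i j = g x j i) (hdet : ∀ x ∈ s, (g x).det ≠ 0)
    {b b' : Fin n → Coord n → ℝ} (hb : ∀ k, ContDiffOn ℝ ∞ (b k) s)
    (hb' : ∀ k, ContDiffOn ℝ ∞ (b' k) s) {ζ ζ' : Fin n → ℝ}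
    (hζ : ∀ k, ζ k = ∑ l, (g x)⁻¹ k l * b l x) (hζ' : ∀ k, ζ' k = ∑ l, (g x)⁻¹ k l * b' l x)
    (i : Fin n) :
    pd (fun z => ∑ k, b k z * ∑ l, (g z)⁻¹ k l * b' l z) i x =
      ∑ k, pd (b k) i x * ζ' k + ∑ k, ζ k * pd (b' k) i x
        - ∑ k, ∑ l, pd (fun z => g z k l) i x * ζ k * ζ' l := by
  set Z : Fin n → Coord n → ℝ := fun k z => ∑ l, (g z)⁻¹ k l * b' l z with hZ
  have hZs : ∀ k, ContDiffOn ℝ ∞ (Z k) s := fun k =>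
    ContDiffOn.sum fun l _ => (contDiffOn_inv_apply hg hdet k l).mul (hb' l)
  have dZ : ∀ k, DifferentiableAt ℝ (Z k) x := fun k => differentiableAt_of_contDiffOn hs (hZs k) hx
  have db : ∀ k, DifferentiableAt ℝ (b k) x := fun k => differentiableAt_of_contDiffOn hs (hb k) hx
  have dg : ∀ k l, DifferentiableAt ℝ (fun z => g z k l) x := fun k l =>
    differentiableAt_of_contDiffOn hs (hg k l) hx
  have h1 : ∀ k, ∑ l, g x k l * pd (Z l) i x =
      pd (b' k) i x - ∑ l, pd (fun z => g z k l) i x * ζ' l := by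
    intro k
    have h2 : pd (fun z => ∑ l, g z k l * Z l z) i x = pd (b' k) i x :=
      pd_congr_of_mem hs hx fun y hy => sum_mul_inv_mul (hdet y hy) (fun l => b' l y) k
    rw [pd_sum (fun l _ => (dg k l).fun_mul (dZ l))] at h2
    simp only [pd_mul (dg k _) (dZ _), Finset.sum_add_distrib] at h2
    simp only [hζ']
    linarith
  have hbx : ∀ k, b k x = ∑ l, g x k l * ζ l := fun k => by
    simp only [hζ]; exact (sum_mul_inv_mul (hdet x hx) (fun l => b l x) k).symm
  rw [pd_sum (fun k _ => (db k).fun_mul (dZ k))]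
  simp only [pd_mul (db _) (dZ _), Finset.sum_add_distrib]
  have h3 : ∑ k, b k x * pd (Z k) i x = ∑ k, ζ k * ∑ l, g x k l * pd (Z l) i x := by
    simp only [hbx, Finset.mul_sum, Finset.sum_mul]
    rw [Finset.sum_comm]
    refine Finset.sum_congr rfl fun k _ => Finset.sum_congr rfl fun l _ => ?_
    rw [hsymm x hx l k]; ring
  rw [h3]
  simp only [h1, mul_sub, Finset.sum_sub_distrib, Finset.mul_sum]
  have h4 : ∀ k, Z k x = ζ' k := fun k => (hζ' k).symm
  simp only [h4]
  have h5 : ∑ k, ∑ l, ζ k * (pd (fun z => g z k l) i x * ζ' l) =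
      ∑ k, ∑ l, pd (fun z => g z k l) i x * ζ k * ζ' l :=
    Finset.sum_congr rfl fun k _ => Finset.sum_congr rfl fun l _ => by ring
  rw [h5]; ring

/-- The gradient covector of a function. -/
noncomputable def grad (f : Coord n → ℝ) (x : Coord n) : Coord n :=
  WithLp.toLp 2 fun i => pd f i x

/-- `f` satisfies `∇²f = -μ f g` on `s`. -/
def HessianEq (g : Coord n → Matrix (Fin n) (Fin n) ℝ) (μ : ℝ) (s : Set (Coord n))
    (f : Coord n → ℝ) : Prop :=
  ContDiffOn ℝ ∞ f s ∧ ∀ x ∈ s, ∀ i j,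
    pd (pd f j) i x = ∑ k, christoffel g k i j x * pd f k x - μ * f x * g x i j

/-- The scalar product of covectors. -/
noncomputable abbrev coInner (g : Coord n → Matrix (Fin n) (Fin n) ℝ) (x a b : Coord n) : ℝ :=
  innerAt (fun x => (g x)⁻¹) x a b

/-- For solutions of `∇²f = -μ f g` the function `⟨df, df'⟩ + μ f f'` is constant. -/
lemma HessianEq.first_integral {μ : ℝ} (hs : IsOpen s) (hc : IsPreconnected s)
    (hg : ∀ i j, ContDiffOn ℝ ∞ (fun x => g x i j) s)
    (hsymm : ∀ x ∈ s, ∀ i j, g x i j = g x j i) (hdet : ∀ x ∈ s, (g x).det ≠ 0)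
    {f f' : Coord n → ℝ} (hf : HessianEq g μ s f) (hf' : HessianEq g μ s f')
    {x y : Coord n} (hx : x ∈ s) (hy : y ∈ s) :
    coInner g x (grad f x) (grad f' x) + μ * (f x * f' x) =
      coInner g y (grad f y) (grad f' y) + μ * (f y * f' y) := by
  have he : ∀ x, coInner g x (grad f x) (grad f' x) =
      ∑ k, pd f k x * ∑ l, (g x)⁻¹ k l * pd f' l x := by
    intro x
    simp only [coInner, innerAt, grad, Finset.mul_sum]
    refine Finset.sum_congr rfl fun k _ => Finset.sum_congr rfl fun l _ => by ring
  simp only [he]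
  have hpf : ∀ k, ContDiffOn ℝ ∞ (pd f k) s := fun k => contDiffOn_pd hs hf.1 k
  have hpf' : ∀ k, ContDiffOn ℝ ∞ (pd f' k) s := fun k => contDiffOn_pd hs hf'.1 k
  have hQ : ContDiffOn ℝ ∞ (fun x => ∑ k, pd f k x * ∑ l, (g x)⁻¹ k l * pd f' l x) s :=
    ContDiffOn.sum fun k _ => (hpf k).mul (ContDiffOn.sum fun l _ =>
      (contDiffOn_inv_apply hg hdet k l).mul (hpf' l))
  have hP : ContDiffOn ℝ ∞ (fun x => μ * (f x * f' x)) s :=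
    contDiffOn_const.mul (hf.1.mul hf'.1)
  refine eq_of_pd_eq_zero (f := fun x => ∑ k, pd f k x * ∑ l, (g x)⁻¹ k l * pd f' l x
    + μ * (f x * f' x)) hs hc ((hQ.add hP).differentiableOn (by simp)) ?_ hx hy
  intro x hx i
  have df := differentiableAt_of_contDiffOn hs hf.1 hx
  have df' := differentiableAt_of_contDiffOn hs hf'.1 hx
  rw [pd_add (differentiableAt_of_contDiffOn hs hQ hx) (differentiableAt_of_contDiffOn hs hP hx),
    pd_const_mul _ (df.fun_mul df'), pd_mul df df']
  set ζ : Fin n → ℝ := fun k => ∑ l, (g x)⁻¹ k l * pd f l x with hζ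
  set ζ' : Fin n → ℝ := fun k => ∑ l, (g x)⁻¹ k l * pd f' l x with hζ'
  rw [pd_sum_mul_inv_mul hs hx hg hsymm hdet hpf hpf' (ζ := ζ) (ζ' := ζ') (fun _ => rfl)
    (fun _ => rfl)]
  have hfk : ∀ k, pd f k x = ∑ l, g x k l * ζ l := fun k =>
    (sum_mul_inv_mul (hdet x hx) (fun l => pd f l x) k).symm
  have hfk' : ∀ k, pd f' k x = ∑ l, g x k l * ζ' l := fun k =>
    (sum_mul_inv_mul (hdet x hx) (fun l => pd f' l x) k).symm
  have hΓ : ∀ (η : Fin n → ℝ) j, ∑ k, christoffel g k i j x * ∑ l, g x k l * η l =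
      ∑ l, christoffelLow g l i j x * η l := by
    intro η j
    simp only [Finset.mul_sum]
    rw [Finset.sum_comm]
    refine Finset.sum_congr rfl fun l _ => ?_
    rw [← sum_mul_christoffel (hdet x hx), Finset.sum_mul]
    refine Finset.sum_congr rfl fun k _ => ?_
    rw [hsymm x hx k l]; ring
  have a1 : ∑ k, pd (pd f k) i x * ζ' k =
      ∑ k, ∑ l, christoffelLow g l i k x * ζ l * ζ' k - μ * f x * pd f' i x := by
    rw [hfk' i, Finset.mul_sum, ← Finset.sum_sub_distrib]
    refine Finset.sum_congr rfl fun k _ => ?_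
    rw [hf.2 x hx i k]
    simp only [hfk]
    rw [hΓ, sub_mul, Finset.sum_mul]; ring
  have a2 : ∑ k, ζ k * pd (pd f' k) i x =
      ∑ k, ∑ l, christoffelLow g l i k x * ζ' l * ζ k - μ * f' x * pd f i x := by
    rw [hfk i, Finset.mul_sum, ← Finset.sum_sub_distrib]
    refine Finset.sum_congr rfl fun k _ => ?_
    rw [hf'.2 x hx i k]
    simp only [hfk']
    rw [hΓ, mul_sub, mul_comm (ζ k), Finset.sum_mul]; ring
  have a3 : ∑ k, ∑ l, pd (fun z => g z k l) i x * ζ k * ζ' l =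
      ∑ k, ∑ l, christoffelLow g l i k x * ζ l * ζ' k
        + ∑ k, ∑ l, christoffelLow g l i k x * ζ' l * ζ k := by
    rw [Finset.sum_comm (f := fun k l => christoffelLow g l i k x * ζ l * ζ' k)]
    simp only [← Finset.sum_add_distrib]
    refine Finset.sum_congr rfl fun k _ => Finset.sum_congr rfl fun l _ => ?_
    rw [pd_metric hs hx hsymm]; ring
  rw [a1, a2, a3]; ring

lemma eq_zero_of_basisVec {E : Type*} [AddCommGroup E] [Module ℝ E] {f : Coord n → E}
    (hadd : ∀ u v, f (u + v) = f u + f v) (hsmul : ∀ (t : ℝ) u, f (t • u) = t • f u)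
    (h : ∀ i, f (basisVec i) = 0) (u : Coord n) : f u = 0 := by
  set L : Coord n →ₗ[ℝ] E := ⟨⟨f, hadd⟩, hsmul⟩
  change L u = 0
  rw [eq_sum_basisVec u, map_sum]
  refine Finset.sum_eq_zero fun i _ => ?_
  rw [map_smul]
  change u i • f (basisVec i) = 0
  rw [h, smul_zero]

/-- The coefficients of the linear system for `(f, df)` equivalent to `∇²f = -μ f g`. -/
noncomputable def hessianSystem (g : Coord n → Matrix (Fin n) (Fin n) ℝ) (μ : ℝ) (x : Coord n) :
    Coord n →L[ℝ] (ℝ × Coord n) →L[ℝ] (ℝ × Coord n) :=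
  (∑ i, (EuclideanSpace.proj i : Coord n →L[ℝ] ℝ).smulRight
      (((EuclideanSpace.proj i : Coord n →L[ℝ] ℝ).comp
        (ContinuousLinearMap.snd ℝ ℝ (Coord n))).smulRight ((1, 0) : ℝ × Coord n)))
  + ((∑ i, ∑ j, ∑ k, christoffel g k i j x • (EuclideanSpace.proj i : Coord n →L[ℝ] ℝ).smulRight
      (((EuclideanSpace.proj k : Coord n →L[ℝ] ℝ).comp
        (ContinuousLinearMap.snd ℝ ℝ (Coord n))).smulRight ((0, basisVec j) : ℝ × Coord n)))
  + ∑ i, ∑ j, (-μ * g x i j) • (EuclideanSpace.proj i : Coord n →L[ℝ] ℝ).smulRight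
      ((ContinuousLinearMap.fst ℝ ℝ (Coord n)).smulRight ((0, basisVec j) : ℝ × Coord n)))

lemma hessianSystem_fst (μ : ℝ) (x : Coord n) (i : Fin n) (y : ℝ × Coord n) :
    (hessianSystem g μ x (basisVec i) y).1 = y.2 i := by
  simp [hessianSystem, Prod.fst_sum, Finset.sum_ite_eq']

lemma hessianSystem_snd (μ : ℝ) (x : Coord n) (i j : Fin n) (y : ℝ × Coord n) :
    (hessianSystem g μ x (basisVec i) y).2 j =
      ∑ k, christoffel g k i j x * y.2 k - μ * y.1 * g x i j := by
  simp [hessianSystem, Prod.snd_sum, Finset.sum_ite_eq', Pi.single_apply]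
  ring

set_option maxSynthPendingDepth 3 in
lemma contDiffOn_hessianSystem (μ : ℝ) (hs : IsOpen s)
    (hg : ∀ i j, ContDiffOn ℝ ∞ (fun x => g x i j) s) (hdet : ∀ x ∈ s, (g x).det ≠ 0) :
    ContDiffOn ℝ ∞ (hessianSystem g μ) s := by
  refine contDiffOn_const.add (ContDiffOn.add ?_ ?_)
  · exact ContDiffOn.sum fun i _ => ContDiffOn.sum fun j _ => ContDiffOn.sum fun k _ =>
      (contDiffOn_christoffel hs hg hdet k i j).smul contDiffOn_const
  · exact ContDiffOn.sum fun i _ => ContDiffOn.sum fun j _ =>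
      (contDiffOn_const.mul (hg i j)).smul contDiffOn_const

lemma christoffel_symm (hs : IsOpen s) (hx : x ∈ s)
    (hsymm : ∀ x ∈ s, ∀ i j, g x i j = g x j i) (l i j : Fin n) :
    christoffel g l i j x = christoffel g l j i x := by
  simp only [christoffel_eq, christoffelLow_symm hs hx hsymm _ i j]

/-- The system for `(f, df)` is flat because `g` has constant curvature `μ`. -/
lemma hessianSystem_flat {μ : ℝ} (hs : IsOpen s)
    (hg : ∀ i j, ContDiffOn ℝ ∞ (fun x => g x i j) s)
    (hsymm : ∀ x ∈ s, ∀ i j, g x i j = g x j i) (hdet : ∀ x ∈ s, (g x).det ≠ 0)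
    (hμ : ∀ x ∈ s, ∀ l k i j, curvature g l k i j x
      = μ * ((if l = i then g x k j else 0) - if l = j then g x k i else 0))
    (hx : x ∈ s) (u v : Coord n) (y : ℝ × Coord n) :
    fderiv ℝ (hessianSystem g μ) x u v y - fderiv ℝ (hessianSystem g μ) x v u y
      + hessianSystem g μ x v (hessianSystem g μ x u y)
      - hessianSystem g μ x u (hessianSystem g μ x v y) = 0 := by
  have hA := differentiableAt_of_contDiffOn hs (contDiffOn_hessianSystem μ hs hg hdet) hx
  have hd : ∀ u v, fderiv ℝ (hessianSystem g μ) x u v y =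
      fderiv ℝ (fun z => hessianSystem g μ z v y) x u := by
    intro u v
    have h1 := (hA.hasFDerivAt.clm_apply (hasFDerivAt_const v x)).clm_apply (hasFDerivAt_const y x)
    rw [h1.fderiv]
    simp
  have hAd : ∀ v, DifferentiableAt ℝ (fun z => hessianSystem g μ z v y) x := fun v =>
    (hA.clm_apply (differentiableAt_const v)).clm_apply (differentiableAt_const y)
  refine eq_zero_of_basisVec (f := fun u => fderiv ℝ (hessianSystem g μ) x u v y
      - fderiv ℝ (hessianSystem g μ) x v u y
      + hessianSystem g μ x v (hessianSystem g μ x u y)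
      - hessianSystem g μ x u (hessianSystem g μ x v y)) ?_ ?_ (fun l => ?_) u
  · intro a b; simp only [map_add, add_apply]; abel
  · intro t a; simp only [map_smul, smul_apply, smul_sub, smul_add]
  refine eq_zero_of_basisVec (f := fun v => fderiv ℝ (hessianSystem g μ) x (basisVec l) v y
      - fderiv ℝ (hessianSystem g μ) x v (basisVec l) y
      + hessianSystem g μ x v (hessianSystem g μ x (basisVec l) y)
      - hessianSystem g μ x (basisVec l) (hessianSystem g μ x v y)) ?_ ?_ (fun i => ?_) v
  · intro a b; simp only [map_add, add_apply]; abel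
  · intro t a; simp only [map_smul, smul_apply, smul_sub, smul_add]
  have hφ : ∀ (φ : ℝ × Coord n →L[ℝ] ℝ) (l i : Fin n),
      φ (fderiv ℝ (hessianSystem g μ) x (basisVec l) (basisVec i) y) =
        pd (fun z => φ (hessianSystem g μ z (basisVec i) y)) l x := by
    intro φ l i
    rw [hd, pd]
    have := (φ.hasFDerivAt.comp x (hAd (basisVec i)).hasFDerivAt).fderiv
    simp only [Function.comp_def] at this
    rw [this]; rfl
  have hfst : ∀ l i, (fderiv ℝ (hessianSystem g μ) x (basisVec l) (basisVec i) y).1 = 0 := by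
    intro l i
    have := hφ (ContinuousLinearMap.fst ℝ ℝ (Coord n)) l i
    simp only [ContinuousLinearMap.coe_fst', hessianSystem_fst, pd_const] at this
    exact this
  have hsnd : ∀ l i j, (fderiv ℝ (hessianSystem g μ) x (basisVec l) (basisVec i) y).2 j =
      ∑ k, pd (christoffel g k i j) l x * y.2 k - μ * y.1 * pd (fun z => g z i j) l x := by
    intro l i j
    have dΓ : ∀ k, DifferentiableAt ℝ (christoffel g k i j) x := fun k =>
      differentiableAt_of_contDiffOn hs (contDiffOn_christoffel hs hg hdet k i j) hx
    have dg : DifferentiableAt ℝ (fun z => g z i j) x :=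
      differentiableAt_of_contDiffOn hs (hg i j) hx
    have h1 := hφ ((EuclideanSpace.proj j : Coord n →L[ℝ] ℝ).comp
      (ContinuousLinearMap.snd ℝ ℝ (Coord n))) l i
    have h2 : ∀ w : ℝ × Coord n, ((EuclideanSpace.proj j : Coord n →L[ℝ] ℝ).comp
      (ContinuousLinearMap.snd ℝ ℝ (Coord n))) w = w.2 j := fun w => rfl
    simp only [h2, hessianSystem_snd] at h1
    have dk : ∀ k ∈ Finset.univ, DifferentiableAt ℝ (fun z => christoffel g k i j z * y.2 k) x :=
      fun k _ => (dΓ k).mul_const _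
    rw [h1, pd_sub (DifferentiableAt.fun_sum dk) (dg.const_mul _), pd_sum dk,
      pd_const_mul _ dg]
    congr 1
    refine Finset.sum_congr rfl fun k _ => ?_
    rw [pd_mul (dΓ k) (differentiableAt_const _), pd_const]; ring
  refine Prod.ext ?_ ?_
  · simp only [Prod.fst_sub, Prod.fst_add, hfst, hessianSystem_fst, hessianSystem_snd,
      Prod.fst_zero]
    rw [hsymm x hx i l]
    simp only [christoffel_symm hs hx hsymm _ i l]
    ring
  · ext j
    simp only [Prod.snd_sub, Prod.snd_add, hsnd, hessianSystem_snd, hessianSystem_fst,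
      PiLp.sub_apply, PiLp.add_apply, Prod.snd_zero, PiLp.zero_apply]
    have hc : ∀ k, pd (christoffel g k i j) l x - pd (christoffel g k l j) i x
        + (∑ m, christoffel g m i j x * christoffel g k l m x
          - ∑ m, christoffel g m l j x * christoffel g k i m x)
        = μ * ((if k = l then g x j i else 0) - if k = i then g x j l else 0) := by
      intro k
      rw [← hμ x hx k j l i, curvature, Finset.sum_sub_distrib]
      congr 2 <;> exact Finset.sum_congr rfl fun m _ => by ring
    have hq : ∀ l i, ∑ k, christoffel g k i j x *
        (∑ m, christoffel g m l k x * y.2 m - μ * y.1 * g x l k) =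
        ∑ m, (∑ k, christoffel g k i j x * christoffel g m l k x) * y.2 m
          - μ * y.1 * christoffelLow g l i j x := by
      intro l i
      simp only [mul_sub, Finset.sum_sub_distrib, Finset.mul_sum, Finset.sum_mul,
        ← sum_mul_christoffel (hdet x hx) l i j]
      rw [Finset.sum_comm]
      congr 1
      · exact Finset.sum_congr rfl fun _ _ => Finset.sum_congr rfl fun _ _ => by ring
      · exact Finset.sum_congr rfl fun _ _ => by ring
    have hsum : ∑ k, (pd (christoffel g k i j) l x - pd (christoffel g k l j) i x
        + (∑ m, christoffel g m i j x * christoffel g k l m x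
          - ∑ m, christoffel g m l j x * christoffel g k i m x)) * y.2 k
        = μ * (g x j i * y.2 l - g x j l * y.2 i) := by
      simp only [hc]
      simp [mul_sub, sub_mul, Finset.sum_sub_distrib, mul_assoc, ite_mul]
    simp only [add_mul, sub_mul, Finset.sum_add_distrib, Finset.sum_sub_distrib] at hsum
    rw [hq, hq, pd_metric hs hx hsymm l i j, pd_metric hs hx hsymm i l j,
      christoffelLow_symm hs hx hsymm j i l, hsymm x hx i j, hsymm x hx l j]
    linear_combination hsum

/-- Near every point the equation `∇²f = -μ f g` has solutions with arbitrary `f` and `df` at that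
point. -/
theorem exists_hessianEq {μ : ℝ} (hs : IsOpen s)
    (hg : ∀ i j, ContDiffOn ℝ ∞ (fun x => g x i j) s)
    (hsymm : ∀ x ∈ s, ∀ i j, g x i j = g x j i) (hdet : ∀ x ∈ s, (g x).det ≠ 0)
    (hμ : ∀ x ∈ s, ∀ l k i j, curvature g l k i j x
      = μ * ((if l = i then g x k j else 0) - if l = j then g x k i else 0))
    (hx : x ∈ s) :
    ∃ r > 0, ball x r ⊆ s ∧ ∀ (c : ℝ) (q : Coord n), ∃ f : Coord n → ℝ,
      HessianEq g μ (ball x r) f ∧ f x = c ∧ grad f x = q := by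
  have hA := contDiffOn_hessianSystem μ hs hg hdet
  obtain ⟨r, hr, hrs, hsol⟩ := exists_solution_of_flat (hs.mem_nhds hx)
    (hA.contDiffAt (hs.mem_nhds hx))
    (fun z hz u v y => hessianSystem_flat hs hg hsymm hdet hμ hz u v y)
  refine ⟨r, hr, hrs, fun c q => ?_⟩
  obtain ⟨Y, hY0, hY⟩ := hsol (c, q)
  have hYs := contDiffOn_of_hasFDerivAt_flip isOpen_ball (hA.mono hrs) hY
  have hpd : ∀ z ∈ ball x r, ∀ (φ : ℝ × Coord n →L[ℝ] ℝ) i,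
      pd (fun z => φ (Y z)) i z = φ (hessianSystem g μ z (basisVec i) (Y z)) := by
    intro z hz φ i
    have := (φ.hasFDerivAt.comp z (hY z hz)).fderiv
    simp only [Function.comp_def] at this
    rw [pd, this]; rfl
  have h1 : ∀ z ∈ ball x r, ∀ i, pd (fun z => (Y z).1) i z = (Y z).2 i := by
    intro z hz i
    have := hpd z hz (ContinuousLinearMap.fst ℝ ℝ (Coord n)) i
    simp only [ContinuousLinearMap.coe_fst', hessianSystem_fst] at this
    exact this
  refine ⟨fun z => (Y z).1, ⟨contDiff_fst.comp_contDiffOn hYs, fun z hz i j => ?_⟩, by simp [hY0],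
    ?_⟩
  · rw [pd_congr_of_mem (g := fun z => (Y z).2 j) isOpen_ball hz fun y hy => h1 y hy j]
    have := hpd z hz ((EuclideanSpace.proj j : Coord n →L[ℝ] ℝ).comp
      (ContinuousLinearMap.snd ℝ ℝ (Coord n))) i
    have h2 : ∀ w : ℝ × Coord n, ((EuclideanSpace.proj j : Coord n →L[ℝ] ℝ).comp
      (ContinuousLinearMap.snd ℝ ℝ (Coord n))) w = w.2 j := fun w => rfl
    simp only [h2, hessianSystem_snd] at this
    rw [this]
    simp only [h1 z hz]
  · ext i
    simp [grad, h1 x (mem_ball_self hr), hY0]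

/-- A positive definite matrix has an orthonormal coframe. -/
lemma exists_orthonormal_coframe {G : Matrix (Fin n) (Fin n) ℝ} (hG : G.PosDef) :
    ∃ B : Matrix (Fin n) (Fin n) ℝ, B * G⁻¹ * Bᵀ = 1 := by
  obtain ⟨B, hB⟩ : ∃ B : Matrix (Fin n) (Fin n) ℝ, G = Bᵀ * B := by
    open scoped MatrixOrder in
    obtain ⟨B, hB⟩ := CStarAlgebra.nonneg_iff_eq_star_mul_self.mp hG.posSemidef.nonneg
    exact ⟨B, by rw [hB, Matrix.star_eq_conjTranspose,
      Matrix.conjTranspose_eq_transpose_of_trivial]⟩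
  have hdet : IsUnit G.det := hG.det_pos.ne'.isUnit
  have hBdet : IsUnit B.det := by
    rw [hB, Matrix.det_mul] at hdet
    exact isUnit_of_mul_isUnit_right hdet
  have hBt : IsUnit (Bᵀ).det := by rwa [Matrix.det_transpose]
  refine ⟨B, ?_⟩
  rw [hB, Matrix.mul_inv_rev, ← mul_assoc, Matrix.mul_nonsing_inv _ hBdet, one_mul,
    Matrix.nonsing_inv_mul _ hBt]

lemma pd_div {f h : Coord n → ℝ} (hf : DifferentiableAt ℝ f x) (hh : DifferentiableAt ℝ h x)
    (h0 : h x ≠ 0) (i : Fin n) :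
    pd (fun z => f z / h z) i x = (h x)⁻¹ * pd f i x + (-(f x / h x ^ 2)) * pd h i x := by
  have hq : DifferentiableAt ℝ (fun z => f z / h z) x := by
    simp only [div_eq_mul_inv]; exact hf.mul (hh.inv h0)
  have h1 : pd (fun z => f z / h z * h z) i x = pd f i x := by
    have he : (fun z => f z / h z * h z) =ᶠ[𝓝 x] f := by
      filter_upwards [hh.continuousAt.eventually_ne h0] with z hz
      exact div_mul_cancel₀ _ hz
    rw [pd, he.fderiv_eq, pd]
  rw [pd_mul hq hh] at h1
  field_simp at h1 ⊢
  linarith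

lemma grad_div {f h : Coord n → ℝ} (hf : DifferentiableAt ℝ f x) (hh : DifferentiableAt ℝ h x)
    (h0 : h x ≠ 0) :
    grad (fun z => f z / h z) x = (h x)⁻¹ • grad f x + (-(f x / h x ^ 2)) • grad h x := by
  ext i
  simp [grad, pd_div hf hh h0]

lemma coInner_eq_dotProduct (a b : Coord n) :
    coInner g x a b = a.ofLp ⬝ᵥ ((g x)⁻¹ *ᵥ b.ofLp) := by
  simp only [coInner, innerAt, dotProduct, Matrix.mulVec, Finset.mul_sum]
  exact Finset.sum_congr rfl fun _ _ => Finset.sum_congr rfl fun _ _ => by ring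

/-- If the rows of `u J` are an orthonormal coframe for `G`, then `G = u² Jᵀ J`. -/
lemma eq_transpose_mul_of_coframe {G J : Matrix (Fin n) (Fin n) ℝ} {u : ℝ} (hG : IsUnit G.det)
    (hJ : u ^ 2 • (J * G⁻¹ * Jᵀ) = 1) : G = u ^ 2 • (Jᵀ * J) := by
  have h1 : (u ^ 2 • (J * G⁻¹)) * Jᵀ = 1 := by rw [Matrix.smul_mul, hJ]
  have h2 : Jᵀ * (u ^ 2 • (J * G⁻¹)) = 1 := mul_eq_one_comm.1 h1
  calc G = Jᵀ * (u ^ 2 • (J * G⁻¹)) * G := by rw [h2, one_mul]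
    _ = u ^ 2 • (Jᵀ * J) := by
      rw [Matrix.mul_smul, Matrix.smul_mul, ← mul_assoc, mul_assoc _ G⁻¹ G,
        Matrix.nonsing_inv_mul _ hG, mul_one]

/-- A metric of constant sectional curvature `μ` is locally isometric to the model
`2 |y| / (1 + μ |x|²)`. The isometry is given by the stereographic coordinates
`f_i / (1 + f_0)`, where `f_0, …, f_n` are solutions of `∇²f = -μ f g`. -/
theorem exists_local_isometry {μ : ℝ} (hs : IsOpen s)
    (hg : ∀ i j, ContDiffOn ℝ ∞ (fun x => g x i j) s)
    (hpos : ∀ x ∈ s, (g x).PosDef)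
    (hμ : ∀ x ∈ s, ∀ a b : Coord n, LinearIndependent ℝ ![a, b] →
      sectionalCurvature g x a b = μ) {x₀ : Coord n} (hx₀ : x₀ ∈ s) :
    ∃ r > 0, ball x₀ r ⊆ s ∧ ∃ Φ : Coord n → Coord n, ContDiffOn ℝ ∞ Φ (ball x₀ r) ∧
      ∀ x ∈ ball x₀ r, 0 < 1 + μ * ‖Φ x‖ ^ 2 ∧
        ∀ y, innerAt g x y y = (2 / (1 + μ * ‖Φ x‖ ^ 2)) ^ 2 * ‖fderiv ℝ Φ x y‖ ^ 2 := by
  have hsymm : ∀ x ∈ s, ∀ i j, g x i j = g x j i := fun x hx i j => by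
    have := (hpos x hx).1.apply i j
    simpa using this.symm
  have hdet : ∀ x ∈ s, (g x).det ≠ 0 := fun x hx => (hpos x hx).det_pos.ne'
  have hpos' : ∀ x ∈ s, ∀ a : Coord n, a ≠ 0 → 0 < innerAt g x a a := fun x hx a ha => by
    have h1 := (hpos x hx).dotProduct_mulVec_pos (x := a.ofLp) (by simpa using ha)
    have h2 : innerAt g x a a = a.ofLp ⬝ᵥ (g x *ᵥ a.ofLp) := by
      simp only [innerAt, dotProduct, Matrix.mulVec, Finset.mul_sum]
      exact Finset.sum_congr rfl fun _ _ => Finset.sum_congr rfl fun _ _ => by ring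
    rwa [star_trivial, ← h2] at h1
  have hcurv : ∀ x ∈ s, ∀ l k i j, curvature g l k i j x
      = μ * ((if l = i then g x k j else 0) - if l = j then g x k i else 0) := fun x hx l k i j =>
    curvature_eq_of_sectionalCurvature_eq hs hg hsymm hpos' hμ hx l k i j
  obtain ⟨r₁, hr₁, hrs, hsol⟩ := exists_hessianEq hs hg hsymm hdet hcurv hx₀
  obtain ⟨B, hB⟩ := exists_orthonormal_coframe (hpos x₀ hx₀)
  -- for `μ = 0` the constant solution is taken, as `hconf` below needs `f₀ = 1` then
  obtain ⟨f₀, hf₀, hf₀x, hf₀g, hf₀1⟩ : ∃ f, HessianEq g μ (ball x₀ r₁) f ∧ f x₀ = 1 ∧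
      grad f x₀ = 0 ∧ (μ = 0 → ∀ x, f x = 1) := by
    by_cases h0 : μ = 0
    · have hc : ∀ j, pd (fun _ : Coord n => (1 : ℝ)) j = fun _ => 0 := fun j => by
        ext; rw [pd_const]
      refine ⟨fun _ => 1, ⟨contDiffOn_const, fun x _ i j => ?_⟩, rfl, ?_, fun _ _ => rfl⟩
      · simp only [hc, h0]; simp [pd_const]
      · ext i; simp [grad, hc]
    · obtain ⟨f, hf, h1, h2⟩ := hsol 1 0
      exact ⟨f, hf, h1, h2, fun h => absurd h h0⟩
  choose f hf hfx hfg using fun i => hsol 0 (WithLp.toLp 2 (B i))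
  obtain ⟨r, hr, hr1, hu⟩ : ∃ r > 0, ball x₀ r ⊆ ball x₀ r₁ ∧ ∀ x ∈ ball x₀ r, 0 < 1 + f₀ x := by
    have hcont : ContinuousAt f₀ x₀ :=
      hf₀.1.continuousOn.continuousAt (isOpen_ball.mem_nhds (mem_ball_self hr₁))
    have h1 : ∀ᶠ x in 𝓝 x₀, x ∈ ball x₀ r₁ ∧ 0 < 1 + f₀ x := by
      refine Filter.Eventually.and (isOpen_ball.mem_nhds (mem_ball_self hr₁)) ?_
      have h2 : ∀ᶠ x in 𝓝 x₀, 0 < f₀ x := hcont.eventually_const_lt (by rw [hf₀x]; norm_num)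
      filter_upwards [h2] with x hx using by linarith
    obtain ⟨r, hr, h⟩ := Metric.mem_nhds_iff.1 h1
    exact ⟨r, hr, fun x hx => (h hx).1, fun x hx => (h hx).2⟩
  have hr0 : x₀ ∈ ball x₀ r₁ := mem_ball_self hr₁
  have hi : ∀ {f f' : Coord n → ℝ}, HessianEq g μ (ball x₀ r₁) f → HessianEq g μ (ball x₀ r₁) f' →
      ∀ x ∈ ball x₀ r₁, coInner g x (grad f x) (grad f' x) + μ * (f x * f' x) =
        coInner g x₀ (grad f x₀) (grad f' x₀) + μ * (f x₀ * f' x₀) := fun h h' x hx =>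
    h.first_integral isOpen_ball (convex_ball _ _).isPreconnected (fun i j => (hg i j).mono hrs)
      (fun x hx => hsymm x (hrs hx)) (fun x hx => hdet x (hrs hx)) h' hx hr0
  -- the first integrals take their initial values: `(f₀, …, f_n)` behaves like the coordinates of
  -- the model quadric
  have c00 : ∀ x ∈ ball x₀ r₁, coInner g x (grad f₀ x) (grad f₀ x) = μ - μ * f₀ x ^ 2 := by
    intro x hx
    have := hi hf₀ hf₀ x hx
    rw [hf₀g, hf₀x] at this
    simp [coInner, innerAt] at this ⊢
    linarith
  have c0i : ∀ x ∈ ball x₀ r₁, ∀ i,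
      coInner g x (grad f₀ x) (grad (f i) x) = - μ * f₀ x * f i x := by
    intro x hx i
    have := hi hf₀ (hf i) x hx
    rw [hf₀g, hf₀x, hfx] at this
    simp [coInner, innerAt] at this ⊢
    linarith
  have cij : ∀ x ∈ ball x₀ r₁, ∀ i j, coInner g x (grad (f i) x) (grad (f j) x) =
      (1 : Matrix (Fin n) (Fin n) ℝ) i j - μ * f i x * f j x := by
    intro x hx i j
    have := hi (hf i) (hf j) x hx
    rw [hfx, hfx, hfg, hfg] at this
    have h2 : coInner g x₀ (WithLp.toLp 2 (B i)) (WithLp.toLp 2 (B j)) =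
        (1 : Matrix (Fin n) (Fin n) ℝ) i j := by
      rw [← hB, coInner_eq_dotProduct, Matrix.mul_assoc, Matrix.mul_apply_eq_vecMul]
      simp [dotProduct, Matrix.mulVec, Matrix.mul_apply, Matrix.vecMul]
    rw [h2] at this
    linarith
  have hdiff : ∀ {f : Coord n → ℝ}, HessianEq g μ (ball x₀ r₁) f → ∀ x ∈ ball x₀ r₁,
      DifferentiableAt ℝ f x := fun h x hx => differentiableAt_of_contDiffOn isOpen_ball h.1 hx
  set Φ : Coord n → Coord n := fun x => WithLp.toLp 2 fun i => f i x / (1 + f₀ x) with hΦ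
  have hΦs : ContDiffOn ℝ ∞ Φ (ball x₀ r) := by
    rw [contDiffOn_coord_iff]
    intro i
    exact ((hf i).1.mono hr1).div (contDiffOn_const.add (hf₀.1.mono hr1)) fun x hx => (hu x hx).ne'
  refine ⟨r, hr, hr1.trans hrs, Φ, hΦs, fun x hx => ?_⟩
  have hx1 := hr1 hx
  have hxs := hrs hx1
  have hux := hu x hx
  set u := 1 + f₀ x with hu_def
  have hu0 : u ≠ 0 := hux.ne'
  have hf₀u : f₀ x = u - 1 := by rw [hu_def]; ring
  set a := grad f₀ x with ha
  have hgr : ∀ i, grad (fun z => Φ z i) x = u⁻¹ • grad (f i) x + (-(f i x / u ^ 2)) • a := by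
    intro i
    have h1 := grad_div (h := fun z => 1 + f₀ z) (hdiff (hf i) x hx1)
      ((hdiff hf₀ x hx1).const_add 1) hux.ne'
    have h2 : grad (fun z => 1 + f₀ z) x = a := by
      ext k
      have := pd_add (i := k) (differentiableAt_const (1 : ℝ)) (hdiff hf₀ x hx1)
      simp only [grad, ha, this, pd_const, zero_add]
    rw [h2] at h1
    exact h1
  have hsi : ∀ i j, (fun x => (g x)⁻¹) x i j = (fun x => (g x)⁻¹) x j i := fun i j =>
    inv_symm (hsymm x hxs) i j
  have caP : ∀ j, coInner g x a (grad (fun z => Φ z j) x) = - μ * Φ x j := by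
    intro j
    rw [hgr j, coInner, innerAt_add_right, innerAt_smul_right, innerAt_smul_right]
    change u⁻¹ * coInner g x a (grad (f j) x) + (-(f j x / u ^ 2)) * coInner g x a a = _
    rw [c0i x hx1, c00 x hx1]
    rw [hf₀u]
    change _ = -μ * (f j x / u)
    field_simp
    ring
  have hcomm : ∀ i, coInner g x (grad (f i) x) a = -μ * f₀ x * f i x := fun i =>
    (innerAt_comm hsi _ _).trans (c0i x hx1 i)
  -- the covectors `u dΦ_i` form an orthonormal coframe
  have cPP : ∀ i j, u ^ 2 * coInner g x (grad (fun z => Φ z i) x) (grad (fun z => Φ z j) x) =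
      (1 : Matrix (Fin n) (Fin n) ℝ) i j := by
    intro i j
    nth_rewrite 1 [hgr i]
    rw [coInner, innerAt_add_left, innerAt_smul_left, innerAt_smul_left]
    change u ^ 2 * (u⁻¹ * coInner g x (grad (f i) x) (grad (fun z => Φ z j) x)
      + (-(f i x / u ^ 2)) * coInner g x a (grad (fun z => Φ z j) x)) = _
    rw [caP, hgr j, coInner, innerAt_add_right, innerAt_smul_right, innerAt_smul_right]
    change u ^ 2 * (u⁻¹ * (u⁻¹ * coInner g x (grad (f i) x) (grad (f j) x)
      + (-(f j x / u ^ 2)) * coInner g x (grad (f i) x) a)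
      + (-(f i x / u ^ 2)) * _) = _
    rw [hcomm, cij x hx1, hf₀u]
    change u ^ 2 * (u⁻¹ * _ + (-(f i x / u ^ 2)) * (-μ * (f j x / u))) = _
    field_simp
    ring
  set J : Matrix (Fin n) (Fin n) ℝ := Matrix.of fun i k => pd (fun z => Φ z i) k x with hJ
  have hJJ : u ^ 2 • (J * (g x)⁻¹ * Jᵀ) = 1 := by
    ext i j
    rw [← cPP i j, coInner_eq_dotProduct]
    simp [Matrix.mul_assoc, dotProduct, Matrix.mulVec, Matrix.mul_apply, grad, hJ]
  have hG := eq_transpose_mul_of_coframe (hdet x hxs).isUnit hJJ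
  have hnorm : ∀ y, u ^ 2 * ‖fderiv ℝ Φ x y‖ ^ 2 = innerAt g x y y := by
    intro y
    have h1 : ∀ i, fderiv ℝ Φ x y i = ∑ k, J i k * y k := by
      intro i
      rw [fderiv_apply_coord (differentiableAt_of_contDiffOn isOpen_ball hΦs hx)]
      exact Finset.sum_congr rfl fun k _ => by rw [hJ]; simp [mul_comm]
    rw [innerAt, hG, normSq_eq_sum]
    simp only [h1, Matrix.smul_apply, Matrix.mul_apply, Matrix.transpose_apply, smul_eq_mul, sq,
      Finset.sum_mul, Finset.mul_sum]
    rw [Finset.sum_comm]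
    refine Finset.sum_congr rfl fun k _ => ?_
    rw [Finset.sum_comm]
    refine Finset.sum_congr rfl fun l _ => Finset.sum_congr rfl fun m _ => by ring
  -- `|df₀|²` is known from the first integral and can be computed in the coframe `u dΦ_i`
  have hconf : u * (1 + μ * ‖Φ x‖ ^ 2) = 2 := by
    by_cases h0 : μ = 0
    · rw [hu_def, hf₀1 h0, h0]; norm_num
    · have h1 : coInner g x a a = u ^ 2 * ∑ j, (-μ * Φ x j) ^ 2 := by
        simp only [← caP]
        have h2 : (g x)⁻¹ = (g x)⁻¹ * (u ^ 2 • (Jᵀ * J)) * (g x)⁻¹ := by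
          rw [← hG, Matrix.nonsing_inv_mul _ (hdet x hxs).isUnit, one_mul]
        have h3 : ∀ j, coInner g x a (grad (fun z => Φ z j) x) = (J *ᵥ ((g x)⁻¹ *ᵥ a.ofLp)) j := by
          intro j
          rw [show coInner g x a (grad (fun z => Φ z j) x) = _ from innerAt_comm hsi _ _]
          exact coInner_eq_dotProduct _ _
        have h4 : (g x)⁻¹ᵀ = (g x)⁻¹ := by ext i j; exact hsi j i
        rw [coInner_eq_dotProduct, h2, ← Matrix.mulVec_mulVec, ← Matrix.mulVec_mulVec,
          Matrix.dotProduct_mulVec, ← Matrix.mulVec_transpose, h4, Matrix.smul_mulVec,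
          dotProduct_smul, ← Matrix.mulVec_mulVec, Matrix.dotProduct_mulVec,
          Matrix.vecMul_transpose, smul_eq_mul]
        simp only [h3]
        simp [dotProduct, sq]
      have h2 : ∑ j, (-μ * Φ x j) ^ 2 = μ ^ 2 * ‖Φ x‖ ^ 2 := by
        rw [normSq_eq_sum, Finset.mul_sum]
        exact Finset.sum_congr rfl fun _ _ => by ring
      rw [h2, c00 x hx1] at h1
      rw [hf₀u] at h1
      have h3 : μ * u * (u * (1 + μ * ‖Φ x‖ ^ 2) - 2) = 0 := by linear_combination -h1
      have := (mul_eq_zero.1 h3).resolve_left (mul_ne_zero h0 hux.ne')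
      linarith
  have hp : 0 < 1 + μ * ‖Φ x‖ ^ 2 := by
    by_contra hneg
    push Not at hneg
    nlinarith
  refine ⟨hp, fun y => ?_⟩
  rw [← hnorm, ← hconf, mul_div_cancel_right₀ _ hp.ne']

end LocalIsometry

/-! ### Conformal vector fields of Euclidean space -/

section EuclideanConformal

variable {n : ℕ}

lemma inner_basisVec (z : Coord n) (i : Fin n) : ⟪z, basisVec i⟫_ℝ = z i := by
  rw [inner_eq_sum]; simp

/-- The general conformal vector field `-2 (l + ⟨d, x⟩) x + |x|² d + P x + e` of `ℝⁿ`, `n ≥ 3`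
(`P` skew-symmetric). -/
noncomputable def confField (l : ℝ) (d : Coord n) (P : Matrix (Fin n) (Fin n) ℝ) (e x : Coord n) :
    Coord n :=
  (-2 * (l + ⟪d, x⟫_ℝ)) • x + ‖x‖ ^ 2 • d + P.toEuclideanLin x + e

variable (l : ℝ) (d : Coord n) (P : Matrix (Fin n) (Fin n) ℝ) (e x : Coord n)

lemma contDiff_confField {k : WithTop ℕ∞} : ContDiff ℝ k (confField l d P e) := by
  have h : ContDiff ℝ k fun x : Coord n => P.toEuclideanLin x :=
    (LinearMap.toContinuousLinearMap P.toEuclideanLin).contDiff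
  unfold confField
  exact (((contDiff_const.mul (contDiff_const.add (contDiff_const.inner ℝ contDiff_id))).smul
    contDiff_id).add ((contDiff_norm_sq ℝ).smul contDiff_const)).add h |>.add contDiff_const

lemma fderiv_confField (v : Coord n) : fderiv ℝ (confField l d P e) x v =
    (-2 * ⟪d, v⟫_ℝ) • x + (-2 * (l + ⟪d, x⟫_ℝ)) • v + (2 * ⟪x, v⟫_ℝ) • d + P.toEuclideanLin v := by
  have h1 : HasFDerivAt (fun x : Coord n => -2 * (l + ⟪d, x⟫_ℝ)) ((-2 : ℝ) • innerSL ℝ d) x :=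
    ((innerSL ℝ d).hasFDerivAt.const_add l).const_mul (-2)
  have h2 := (hasStrictFDerivAt_norm_sq x).hasFDerivAt.smul_const d
  have h3 : HasFDerivAt (fun x : Coord n => P.toEuclideanLin x)
      (LinearMap.toContinuousLinearMap P.toEuclideanLin) x :=
    (LinearMap.toContinuousLinearMap P.toEuclideanLin).hasFDerivAt
  have h4 : HasFDerivAt (confField l d P e) _ x :=
    (((h1.smul (hasFDerivAt_id x)).add h2).add h3).add_const e
  rw [h4.fderiv]
  simp [add_comm, two_mul]

lemma pd_confField (i j : Fin n) : pd (fun z => confField l d P e z i) j x =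
    -2 * d j * x i - 2 * (l + ⟪d, x⟫_ℝ) * (if i = j then 1 else 0) + 2 * x j * d i + P i j := by
  have h := (contDiff_confField l d P e (k := 1)).differentiable (by simp) x
  have h1 := fderiv_apply_coord h (basisVec j) (i := i)
  have h2 : ∑ k, (basisVec j : Coord n) k * pd (fun z => confField l d P e z i) k x =
      pd (fun z => confField l d P e z i) j x := by
    simp
  rw [← h2, ← h1, fderiv_confField]
  simp only [inner_basisVec, PiLp.add_apply, PiLp.smul_apply, smul_eq_mul,
    toEuclideanLin_apply_apply]
  have h3 : ∑ k, P i k * (basisVec j : Coord n) k = P i j := by simp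
  have h4 : (basisVec j : Coord n) i = if i = j then 1 else 0 := by
    simp
  rw [h3, h4]; ring

variable {l d P e}

/-- Second derivatives of a Euclidean conformal vector field in terms of the conformal factor. -/
lemma pd_pd_of_conformal {U : Set (Coord n)} (hU : IsOpen U) {ξ : Coord n → Coord n}
    (hξ : ContDiffOn ℝ ∞ ξ U) {σ : Coord n → ℝ} (hσ : ContDiffOn ℝ ∞ σ U)
    (h : ∀ x ∈ U, ∀ i j, pd (fun z => ξ z i) j x + pd (fun z => ξ z j) i x
      = 2 * σ x * if i = j then 1 else 0) (hx : x ∈ U) (i j k : Fin n) :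
    pd (pd (fun z => ξ z i) j) k x = pd σ k x * (if i = j then 1 else 0)
      + pd σ j x * (if i = k then 1 else 0) - pd σ i x * if j = k then 1 else 0 := by
  have hξi : ∀ i, ContDiffOn ℝ ∞ (fun z => ξ z i) U := contDiffOn_coord_iff.1 hξ
  have hd : ∀ i j, DifferentiableAt ℝ (pd (fun z => ξ z i) j) x := fun i j =>
    differentiableAt_of_contDiffOn hU (contDiffOn_pd hU (hξi i) j) hx
  have hdσ := differentiableAt_of_contDiffOn hU hσ hx
  have h1 : ∀ i j k, pd (pd (fun z => ξ z i) j) k x + pd (pd (fun z => ξ z j) i) k x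
      = 2 * pd σ k x * if i = j then 1 else 0 := by
    intro i j k
    rw [← pd_add (hd i j) (hd j i), pd_congr_of_mem hU hx fun z hz => h z hz i j,
      pd_mul (hdσ.const_mul 2) (differentiableAt_const _), pd_const_mul _ hdσ, pd_const]
    ring
  have hc : ∀ i j k, pd (pd (fun z => ξ z i) j) k x = pd (pd (fun z => ξ z i) k) j x :=
    fun i j k => pd_comm hU (hξi i) hx j k
  have e1 := h1 i j k
  have e2 := h1 j k i
  have e3 := h1 i k j
  rw [hc j k i] at e2
  rw [hc i k j, hc k i j] at e3
  linear_combination (e1 + e3 - e2) / 2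

/-- The conformal factor of a Euclidean conformal vector field is affine when `n ≥ 3`. -/
lemma pd_pd_factor_eq_zero (hn : 3 ≤ n) {U : Set (Coord n)} (hU : IsOpen U)
    {ξ : Coord n → Coord n} (hξ : ContDiffOn ℝ ∞ ξ U) {σ : Coord n → ℝ}
    (hσ : ContDiffOn ℝ ∞ σ U)
    (h : ∀ x ∈ U, ∀ i j, pd (fun z => ξ z i) j x + pd (fun z => ξ z j) i x
      = 2 * σ x * if i = j then 1 else 0) (hx : x ∈ U) (j l : Fin n) : pd (pd σ j) l x = 0 := by
  have hξi : ∀ i, ContDiffOn ℝ ∞ (fun z => ξ z i) U := contDiffOn_coord_iff.1 hξ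
  have hdσ : ∀ k, DifferentiableAt ℝ (pd σ k) x := fun k =>
    differentiableAt_of_contDiffOn hU (contDiffOn_pd hU hσ k) hx
  have h1 : ∀ i j k l, pd (pd (pd (fun z => ξ z i) j) k) l x =
      pd (pd σ k) l x * (if i = j then 1 else 0) + pd (pd σ j) l x * (if i = k then 1 else 0)
        - pd (pd σ i) l x * if j = k then 1 else 0 := by
    intro i j k l
    rw [pd_congr_of_mem hU hx fun z hz => pd_pd_of_conformal z hU hξ hσ h hz i j k,
      pd_sub (((hdσ k).mul_const _).fun_add ((hdσ j).mul_const _)) ((hdσ i).mul_const _),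
      pd_add ((hdσ k).mul_const _) ((hdσ j).mul_const _),
      pd_mul (hdσ k) (differentiableAt_const _), pd_mul (hdσ j) (differentiableAt_const _),
      pd_mul (hdσ i) (differentiableAt_const _)]
    simp only [pd_const]; ring
  -- equality of the mixed derivatives `∂_l ∂_i ∂_j ξ_i = ∂_i ∂_l ∂_j ξ_i`
  have h2 : ∀ i j l, i ≠ j → i ≠ l →
      pd (pd σ j) l x = -pd (pd σ i) i x * if j = l then 1 else 0 := by
    intro i j l hij hil
    have e := pd_comm hU (contDiffOn_pd hU (hξi i) j) hx i l
    rw [h1, h1, pd_comm hU hσ hx l i] at e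
    simp only [hij, hil, hij.symm, if_true, if_false] at e
    linarith
  -- this needs `n ≥ 3`
  have hex : ∀ a b : Fin n, ∃ c, c ≠ a ∧ c ≠ b := by
    intro a b
    have : ({a, b} : Finset (Fin n)).card < (Finset.univ : Finset (Fin n)).card := by
      refine lt_of_le_of_lt Finset.card_le_two ?_
      rw [Finset.card_fin]; omega
    obtain ⟨c, -, hc⟩ := Finset.exists_mem_notMem_of_card_lt_card this
    simp only [Finset.mem_insert, Finset.mem_singleton, not_or] at hc
    exact ⟨c, hc⟩
  by_cases hjl : j = l
  · subst hjl
    obtain ⟨a, ha, -⟩ := hex j j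
    obtain ⟨b, hb1, hb2⟩ := hex j a
    have e1 := h2 a j j ha ha
    have e2 := h2 b a a hb2 hb2
    have e3 := h2 b j j hb1 hb1
    simp only [if_true, mul_one] at e1 e2 e3
    linarith
  · obtain ⟨c, hc1, hc2⟩ := hex j l
    rw [h2 c j l hc1 hc2, if_neg hjl, mul_zero]

/-- **Liouville's theorem for vector fields**: in dimension at least three the conformal vector
fields of a connected open subset of `ℝⁿ` are the fields `confField`. -/
theorem exists_eq_confField (hn : 3 ≤ n) {U : Set (Coord n)} (hU : IsOpen U)
    (hc : IsPreconnected U) {ξ : Coord n → Coord n} (hξ : ContDiffOn ℝ ∞ ξ U) {σ : Coord n → ℝ}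
    (h : ∀ x ∈ U, ∀ i j, pd (fun z => ξ z i) j x + pd (fun z => ξ z j) i x
      = 2 * σ x * if i = j then 1 else 0) :
    ∃ (l : ℝ) (d e : Coord n) (P : Matrix (Fin n) (Fin n) ℝ), Pᵀ = -P ∧
      ∀ x ∈ U, ξ x = confField l d P e x := by
  rcases U.eq_empty_or_nonempty with rfl | ⟨x₀, hx₀⟩
  · exact ⟨0, 0, 0, 0, by simp, by simp⟩
  have hξi : ∀ i, ContDiffOn ℝ ∞ (fun z => ξ z i) U := contDiffOn_coord_iff.1 hξ
  have hσ : ContDiffOn ℝ ∞ σ U := by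
    have i : Fin n := ⟨0, by omega⟩
    refine (contDiffOn_pd hU (hξi i) i).congr fun x hx => ?_
    have := h x hx i i
    simp only [if_true] at this
    linarith
  have hdσ : ∀ x ∈ U, DifferentiableAt ℝ σ x := fun x hx => differentiableAt_of_contDiffOn hU hσ hx
  have hconst : ∀ x ∈ U, ∀ k, pd σ k x = pd σ k x₀ := fun x hx k =>
    eq_of_pd_eq_zero hU hc ((contDiffOn_pd hU hσ k).differentiableOn (by simp))
      (fun x hx i => pd_pd_factor_eq_zero x hn hU hξ hσ h hx k i) hx hx₀
  set d : Coord n := WithLp.toLp 2 fun k => -(pd σ k x₀) / 2 with hd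
  have hdk : ∀ x ∈ U, ∀ k, pd σ k x = -2 * d k := by
    intro x hx k
    rw [hconst x hx k]
    have : d k = -(pd σ k x₀) / 2 := rfl
    rw [this]; ring
  set l : ℝ := -(σ x₀) / 2 - ⟪d, x₀⟫_ℝ with hl
  have hinner : ∀ x, DifferentiableAt ℝ (fun z : Coord n => ⟪d, z⟫_ℝ) x := fun x =>
    (innerSL ℝ d).differentiableAt
  have hpi : ∀ x k, pd (fun z : Coord n => ⟪d, z⟫_ℝ) k x = d k := by
    intro x k
    have : HasFDerivAt (fun z : Coord n => ⟪d, z⟫_ℝ) (innerSL ℝ d) x := (innerSL ℝ d).hasFDerivAt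
    rw [pd, this.fderiv]; exact inner_basisVec d k
  have hσl : ∀ x ∈ U, σ x = -2 * (l + ⟪d, x⟫_ℝ) := by
    intro x hx
    have e := eq_of_pd_eq_zero (f := fun z => σ z + 2 * ⟪d, z⟫_ℝ) hU hc
      (fun z hz => ((hdσ z hz).add ((hinner z).const_mul 2)).differentiableWithinAt)
      (fun z hz i => by
        rw [pd_add (hdσ z hz) ((hinner z).const_mul 2), pd_const_mul _ (hinner z), hpi, hdk z hz]
        ring) hx hx₀
    rw [hl]; linarith
  have hcd : ∀ (P : Matrix (Fin n) (Fin n) ℝ) (e : Coord n) i,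
      ContDiffOn ℝ ∞ (fun z => confField l d P e z i) U := fun P e i =>
    contDiffOn_coord_iff.1 (contDiff_confField l d P e).contDiffOn i
  set P : Matrix (Fin n) (Fin n) ℝ := Matrix.of fun i j =>
    pd (fun z => ξ z i) j x₀ - pd (fun z => confField l d 0 0 z i) j x₀ with hP
  -- `ξ` and its model have the same second derivatives
  have hPx : ∀ x ∈ U, ∀ i j,
      pd (fun z => ξ z i) j x - pd (fun z => confField l d 0 0 z i) j x = P i j := by
    intro x hx i j
    have hsm := (contDiffOn_pd hU (hξi i) j).sub (contDiffOn_pd hU (hcd 0 0 i) j)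
    refine eq_of_pd_eq_zero (f := fun x =>
      pd (fun z => ξ z i) j x - pd (fun z => confField l d 0 0 z i) j x) hU hc
      (hsm.differentiableOn (by simp)) (fun x hx k => ?_) hx hx₀
    rw [pd_sub (differentiableAt_of_contDiffOn hU (contDiffOn_pd hU (hξi i) j) hx)
      (differentiableAt_of_contDiffOn hU (contDiffOn_pd hU (hcd 0 0 i) j) hx),
      pd_pd_of_conformal x hU hξ hσ h hx, hdk x hx, hdk x hx, hdk x hx]
    have hpc : pd (fun z => confField l d 0 0 z i) j = fun x => (-2 * d j) * x i
        + (-2 * (if i = j then 1 else 0)) * (l + ⟪d, x⟫_ℝ) + (2 * d i) * x j := by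
      ext x; rw [pd_confField, Matrix.zero_apply]; ring
    have hco : ∀ k, DifferentiableAt ℝ (fun z : Coord n => z k) x := fun k =>
      (EuclideanSpace.proj (𝕜 := ℝ) k : Coord n →L[ℝ] ℝ).differentiableAt
    have hin := (hinner x).const_add l
    rw [hpc, pd_add (((hco i).const_mul _).fun_add (hin.const_mul _)) ((hco j).const_mul _),
      pd_add ((hco i).const_mul _) (hin.const_mul _), pd_const_mul _ (hco i), pd_const_mul _ hin,
      pd_const_mul _ (hco j), pd_add (differentiableAt_const l) (hinner x), pd_const, hpi,
      pd_coord, pd_coord]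
    simp only [eq_comm (a := k)]
    ring
  have hPs : Pᵀ = -P := by
    ext i j
    rw [Matrix.transpose_apply, Matrix.neg_apply, ← hPx x₀ hx₀ i j, ← hPx x₀ hx₀ j i]
    have := h x₀ hx₀ i j
    rw [hσl x₀ hx₀] at this
    simp only [pd_confField, Matrix.zero_apply, eq_comm (a := j) (b := i)] at this ⊢
    linarith
  refine ⟨l, d, ξ x₀ - confField l d P 0 x₀, P, hPs, fun x hx => ?_⟩
  have hdiff : ∀ e x, confField l d P e x = confField l d P 0 x + e := by
    intro e x; simp [confField]
  rw [hdiff]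
  ext i
  have e := eq_of_pd_eq_zero (f := fun x => ξ x i - confField l d P 0 x i) hU hc
    (((hξi i).sub (hcd P 0 i)).differentiableOn (by simp)) (fun x hx j => by
      rw [pd_sub (differentiableAt_of_contDiffOn hU (hξi i) hx)
        (differentiableAt_of_contDiffOn hU (hcd P 0 i) hx)]
      have := hPx x hx i j
      rw [pd_confField, Matrix.zero_apply] at this
      rw [pd_confField]; linarith) hx hx₀
  simp only at e
  simp only [PiLp.add_apply, PiLp.sub_apply]
  linarith

end EuclideanConformal

/-! ### Brackets of Euclidean conformal vector fields -/

section Bracket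

variable {n : ℕ} {l τ μ : ℝ} {d e η γ : Coord n} {P Q : Matrix (Fin n) (Fin n) ℝ}

lemma inner_toEuclideanLin_of_skew (hP : Pᵀ = -P) (x y : Coord n) :
    ⟪P.toEuclideanLin x, y⟫_ℝ = -⟪x, P.toEuclideanLin y⟫_ℝ := by
  simp only [inner_eq_sum, toEuclideanLin_apply_apply, Finset.sum_mul, Finset.mul_sum]
  rw [Finset.sum_comm, ← Finset.sum_neg_distrib]
  refine Finset.sum_congr rfl fun i _ => ?_
  rw [← Finset.sum_neg_distrib]
  refine Finset.sum_congr rfl fun j _ => ?_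
  have : P j i = -P i j := congrFun (congrFun hP i) j
  rw [this]; ring

lemma inner_self_toEuclideanLin_of_skew (hP : Pᵀ = -P) (x : Coord n) :
    ⟪x, P.toEuclideanLin x⟫_ℝ = 0 := by
  have := inner_toEuclideanLin_of_skew hP x x
  rw [real_inner_comm] at this
  linarith

lemma eq_zero_of_forall_inner_mul_inner (hn : 2 ≤ n) {a b : Coord n} {f : ℝ}
    (h : ∀ y, ⟪a, y⟫_ℝ * ⟪b, y⟫_ℝ = f * ‖y‖ ^ 2) : a = 0 ∨ b = 0 := by
  have hker : LinearMap.ker (innerₛₗ ℝ a : Coord n →ₗ[ℝ] ℝ) ≠ ⊥ := by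
    refine LinearMap.ker_ne_bot_of_finrank_lt ?_
    simp only [Module.finrank_self, finrank_euclideanSpace, Fintype.card_fin]
    omega
  obtain ⟨w, hw, hw0⟩ := Submodule.exists_mem_ne_zero_of_ne_bot hker
  have hw' : ⟪a, w⟫_ℝ = 0 := hw
  have hf : f = 0 := by
    have := h w
    rw [hw', zero_mul, eq_comm, mul_eq_zero] at this
    exact this.resolve_right (pow_ne_zero 2 (norm_ne_zero_iff.2 hw0))
  simp only [hf, zero_mul] at h
  by_contra! hab
  have h1 : ⟪a, a⟫_ℝ ≠ 0 := inner_self_ne_zero.2 hab.1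
  have h2 : ⟪b, b⟫_ℝ ≠ 0 := inner_self_ne_zero.2 hab.2
  have h3 : ⟪b, a⟫_ℝ = 0 := (mul_eq_zero.1 (h a)).resolve_left h1
  have h4 := h (a + b)
  rw [inner_add_right, inner_add_right, h3, real_inner_comm b a, h3, add_zero, zero_add] at h4
  exact (mul_ne_zero h1 h2) h4

/-- The matrix of the linear part of the bracket of two conformal vector fields. -/
def bracketMatrix (d e : Coord n) (P : Matrix (Fin n) (Fin n) ℝ) (η γ : Coord n)
    (Q : Matrix (Fin n) (Fin n) ℝ) : Matrix (Fin n) (Fin n) ℝ :=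
  P * Q - Q * P + (2 : ℝ) • Matrix.of fun i j => d i * γ j - γ i * d j + e i * η j - η i * e j

lemma bracketMatrix_apply (x : Coord n) : (bracketMatrix d e P η γ Q).toEuclideanLin x =
    P.toEuclideanLin (Q.toEuclideanLin x) - Q.toEuclideanLin (P.toEuclideanLin x)
      + (2 * ⟪γ, x⟫_ℝ) • d - (2 * ⟪d, x⟫_ℝ) • γ + (2 * ⟪η, x⟫_ℝ) • e - (2 * ⟪e, x⟫_ℝ) • η := by
  ext i
  simp only [toEuclideanLin_apply_apply, bracketMatrix, PiLp.add_apply, PiLp.sub_apply,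
    PiLp.smul_apply, smul_eq_mul, inner_eq_sum, Matrix.add_apply, Matrix.sub_apply,
    Matrix.smul_apply, Matrix.of_apply, Matrix.mul_apply, add_mul, sub_mul, mul_add, mul_sub,
    Finset.sum_add_distrib, Finset.sum_sub_distrib, Finset.sum_mul, Finset.mul_sum]
  rw [Finset.sum_comm (f := fun j k => P i k * Q k j * x j),
    Finset.sum_comm (f := fun j k => Q i k * P k j * x j)]
  simp only [← mul_assoc, mul_right_comm _ (x _)]
  simp only [mul_assoc, mul_comm, mul_left_comm]
  ring

lemma bracketMatrix_skew (hP : Pᵀ = -P) (hQ : Qᵀ = -Q) :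
    (bracketMatrix d e P η γ Q)ᵀ = -bracketMatrix d e P η γ Q := by
  unfold bracketMatrix
  rw [Matrix.transpose_add, Matrix.transpose_sub, Matrix.transpose_mul, Matrix.transpose_mul, hP,
    hQ, neg_add]
  congr 1
  · simp only [neg_mul_neg]; abel
  · ext i j
    simp only [Matrix.transpose_apply, Matrix.smul_apply, Matrix.of_apply, Matrix.neg_apply,
      smul_eq_mul]
    ring

/-- The bracket of two conformal vector fields is a conformal vector field. -/
lemma bracket_confField (hP : Pᵀ = -P) (hQ : Qᵀ = -Q) (x : Coord n) :
    fderiv ℝ (confField l d P e) x (confField τ η Q γ x)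
      - fderiv ℝ (confField τ η Q γ) x (confField l d P e x) =
    confField (⟪d, γ⟫_ℝ - ⟪η, e⟫_ℝ)
      ((-2 * τ) • d - Q.toEuclideanLin d + (2 * l) • η + P.toEuclideanLin η)
      (bracketMatrix d e P η γ Q)
      ((-2 * l) • γ + P.toEuclideanLin γ + (2 * τ) • e - Q.toEuclideanLin e) x := by
  have hn : ‖x‖ ^ 2 = ⟪x, x⟫_ℝ := (real_inner_self_eq_norm_sq x).symm
  rw [fderiv_confField, fderiv_confField]
  simp only [confField, bracketMatrix_apply, hn, map_add, map_smul, inner_add_right,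
    inner_add_left, inner_sub_left, inner_smul_left, inner_smul_right,
    inner_self_toEuclideanLin_of_skew hP, inner_self_toEuclideanLin_of_skew hQ,
    inner_toEuclideanLin_of_skew hP, inner_toEuclideanLin_of_skew hQ, conj_trivial]
  simp only [real_inner_comm x d, real_inner_comm x e, real_inner_comm x η, real_inner_comm x γ,
    real_inner_comm η d]
  module

lemma inner_fderiv_confField (hP : Pᵀ = -P) (x y : Coord n) :
    ⟪y, fderiv ℝ (confField l d P e) x y⟫_ℝ = -2 * (l + ⟪d, x⟫_ℝ) * ‖y‖ ^ 2 := by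
  rw [fderiv_confField]
  simp only [inner_add_right, inner_smul_right, inner_self_toEuclideanLin_of_skew hP,
    real_inner_self_eq_norm_sq]
  rw [real_inner_comm d y, real_inner_comm x y]
  ring

lemma inner_confField (hP : Pᵀ = -P) (x : Coord n) :
    ⟪x, confField l d P e x⟫_ℝ = -(2 * l + ⟪d, x⟫_ℝ) * ‖x‖ ^ 2 + ⟪e, x⟫_ℝ := by
  simp only [confField, inner_add_right, inner_smul_right, inner_self_toEuclideanLin_of_skew hP,
    real_inner_self_eq_norm_sq]
  rw [real_inner_comm d x, real_inner_comm e x]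
  ring

lemma eq_of_eqOn_open {f g : Coord n → Coord n} (hf : ContDiff ℝ ω f) (hg : ContDiff ℝ ω g)
    {U : Set (Coord n)} (hU : IsOpen U) (hne : U.Nonempty) (h : ∀ x ∈ U, f x = g x) : f = g := by
  obtain ⟨x, hx⟩ := hne
  exact (contDiff_omega_iff_analyticOnNhd.1 hf).eq_of_eventuallyEq
    (contDiff_omega_iff_analyticOnNhd.1 hg) (Filter.eventuallyEq_of_mem (hU.mem_nhds hx) h)

lemma confField_sub (l l' : ℝ) (d d' e e' : Coord n) (P P' : Matrix (Fin n) (Fin n) ℝ)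
    (x : Coord n) : confField (l - l') (d - d') (P - P') (e - e') x =
      confField l d P e x - confField l' d' P' e' x := by
  simp only [confField, inner_sub_left, map_sub, LinearMap.sub_apply]
  module

/-- The coefficients of a conformal vector field are determined by the field. -/
lemma confField_eq_zero (hn : 1 ≤ n) (hP : Pᵀ = -P) (h : ∀ x, confField l d P e x = 0) :
    l = 0 ∧ d = 0 ∧ P = 0 ∧ e = 0 := by
  have he : e = 0 := by simpa [confField] using h 0
  have h1 : ∀ x, (-2 * l) • x + P.toEuclideanLin x = 0 := by
    intro x
    have e1 := h x
    have e2 := h (-x)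
    simp only [confField, he, add_zero, map_neg, inner_neg_right, norm_neg] at e1 e2
    have : (2 : ℝ) • ((-2 * l) • x + P.toEuclideanLin x) = 0 := by
      rw [← sub_zero (0 : Coord n)]
      nth_rewrite 1 [← e1]
      rw [← e2]
      module
    exact (smul_eq_zero.1 this).resolve_left two_ne_zero
  have hl : l = 0 := by
    have h2 := congrArg (fun z => ⟪basisVec (⟨0, hn⟩ : Fin n), z⟫_ℝ) (h1 (basisVec ⟨0, hn⟩))
    simp only [inner_add_right, inner_smul_right, inner_self_toEuclideanLin_of_skew hP,
      inner_zero_right, inner_basisVec] at h2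
    simpa using h2
  have hP0 : P = 0 := by
    have : P.toEuclideanLin = 0 := by
      ext1 x; have := h1 x; rw [hl] at this; simpa using this
    simpa using this
  refine ⟨hl, ?_, hP0, he⟩
  have h3 := h d
  simp only [confField, hl, hP0, he, real_inner_self_eq_norm_sq, map_zero, LinearMap.zero_apply,
    add_zero, zero_add] at h3
  have h4 : (-(‖d‖ ^ 2)) • d = 0 := by rw [← h3]; module
  rcases smul_eq_zero.1 h4 with h | h
  · simpa using h
  · exact h

set_option maxHeartbeats 600000 in
/-- Two Euclidean conformal vector fields `V` and `ξ` such that `V` is conformal with factor `c`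
for `2 |y| / (1 + μ |x|²)` and `[V, ξ] = 2 c ξ` with `ξ ≠ 0`: the factor `c` is constant and the
coefficients of `V` and `ξ` are related. -/
theorem confField_relations (hn : 2 ≤ n) {U : Set (Coord n)} (hU : IsOpen U)
    (hpos : ∀ x ∈ U, 0 < 1 + μ * ‖x‖ ^ 2) (hP : Pᵀ = -P) (hQ : Qᵀ = -Q)
    (hξ : ∃ x ∈ U, confField l d P e x ≠ 0) {c : Coord n → ℝ}
    (hV : ∀ x ∈ U, ∀ y, ⟪y, fderiv ℝ (confField τ η Q γ) x y⟫_ℝ =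
      (-2 * c x + 2 * μ * ⟪x, confField τ η Q γ x⟫_ℝ / (1 + μ * ‖x‖ ^ 2)) * ‖y‖ ^ 2)
    (hb : ∀ x ∈ U, fderiv ℝ (confField l d P e) x (confField τ η Q γ x)
      - fderiv ℝ (confField τ η Q γ) x (confField l d P e x) = (2 * c x) • confField l d P e x) :
    η = -(μ • γ) ∧ μ * τ = 0 ∧ (∀ x ∈ U, c x = τ) ∧
      ⟪d, γ⟫_ℝ - ⟪η, e⟫_ℝ = 2 * τ * l ∧
      (-2 * τ) • d - Q.toEuclideanLin d + (2 * l) • η + P.toEuclideanLin η = (2 * τ) • d ∧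
      bracketMatrix d e P η γ Q = (2 * τ) • P ∧
      Q.toEuclideanLin e = (-2 * l) • γ + P.toEuclideanLin γ := by
  set κ := η + μ • γ with hκ
  set N : Coord n → ℝ := fun x => τ * (1 - μ * ‖x‖ ^ 2) + ⟪κ, x⟫_ℝ with hN
  -- `c` is a quotient of polynomials
  have hc : ∀ x ∈ U, (1 + μ * ‖x‖ ^ 2) * c x = N x := by
    intro x hx
    have h1 := hV x hx (basisVec ⟨0, by omega⟩)
    have hp := hpos x hx
    rw [inner_fderiv_confField hQ, inner_confField hQ] at h1
    simp only [hN, hκ, inner_add_left, inner_smul_left, conj_trivial]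
    simp only [PiLp.norm_single, norm_one, one_pow, mul_one] at h1
    field_simp at h1
    linarith
  set ζ : Coord n → Coord n := confField (⟪d, γ⟫_ℝ - ⟪η, e⟫_ℝ)
      ((-2 * τ) • d - Q.toEuclideanLin d + (2 * l) • η + P.toEuclideanLin η)
      (bracketMatrix d e P η γ Q)
      ((-2 * l) • γ + P.toEuclideanLin γ + (2 * τ) • e - Q.toEuclideanLin e) with hζ
  have hζb : ∀ x ∈ U, ζ x = (2 * c x) • confField l d P e x := fun x hx => by
    rw [← hb x hx, bracket_confField hP hQ]
  have hζN : ∀ x ∈ U, (1 + μ * ‖x‖ ^ 2) • ζ x = (2 * N x) • confField l d P e x := fun x hx => by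
    rw [hζb x hx, smul_smul, ← hc x hx]; ring_nf
  -- In the symmetric part of the derivative of `hζN`, all terms but the symmetric product of `ξ`
  -- with the vector in question are multiples of the identity; hence so is this product, and one
  -- factor vanishes.
  have hprod : ∀ x ∈ U, confField l d P e x ≠ 0 →
      (1 + μ * ‖x‖ ^ 2) • ((-2 * μ * τ) • x + κ) - (2 * μ * N x) • x = 0 := by
    intro x hx hξx
    have hp := hpos x hx
    have hn1 : HasFDerivAt (fun x : Coord n => 1 + μ * ‖x‖ ^ 2) (μ • (2 : ℕ) • innerSL ℝ x) x :=
      ((hasStrictFDerivAt_norm_sq x).hasFDerivAt.const_mul μ).const_add 1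
    have hn2 : HasFDerivAt (fun x => 2 * N x)
        ((2 : ℝ) • (τ • (-(μ • (2 : ℕ) • innerSL ℝ x)) + innerSL ℝ κ)) x :=
      (((((hasStrictFDerivAt_norm_sq x).hasFDerivAt.const_mul μ).const_sub 1).const_mul τ).add
        (innerSL ℝ κ).hasFDerivAt).const_mul 2
    have hf1 := hn1.smul ((contDiff_confField (k := 1) (⟪d, γ⟫_ℝ - ⟪η, e⟫_ℝ)
      ((-2 * τ) • d - Q.toEuclideanLin d + (2 * l) • η + P.toEuclideanLin η)
      (bracketMatrix d e P η γ Q) ((-2 * l) • γ + P.toEuclideanLin γ + (2 * τ) • e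
        - Q.toEuclideanLin e)).differentiable (by simp) x).hasFDerivAt
    have hf2 := hn2.smul
      ((contDiff_confField (k := 1) l d P e).differentiable (by simp) x).hasFDerivAt
    have heq := hf1.unique (hf2.congr_of_eventuallyEq
      (Filter.eventuallyEq_of_mem (hU.mem_nhds hx) hζN))
    refine (eq_zero_of_forall_inner_mul_inner hn (b := confField l d P e x)
      (f := (1 + μ * ‖x‖ ^ 2) * ((1 + μ * ‖x‖ ^ 2) * (-((⟪d, γ⟫_ℝ - ⟪η, e⟫_ℝ)
        + ⟪(-2 * τ) • d - Q.toEuclideanLin d + (2 * l) • η + P.toEuclideanLin η, x⟫_ℝ))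
        + 2 * N x * (l + ⟪d, x⟫_ℝ))) fun y => ?_).resolve_right hξx
    have h1 := congrArg (fun L => ⟪y, L y⟫_ℝ) heq
    simp only [add_apply, smul_apply, ContinuousLinearMap.smulRight_apply, inner_add_right,
      inner_smul_right, neg_apply, innerSL_apply_apply,
      inner_fderiv_confField (bracketMatrix_skew hP hQ), inner_fderiv_confField hP] at h1
    have h2 := congrArg (fun z => ⟪y, z⟫_ℝ) (hζN x hx)
    simp only [inner_smul_right] at h2
    simp only [smul_eq_mul, nsmul_eq_mul, Nat.cast_ofNat] at h1
    change _ + (μ * (2 * ⟪x, y⟫_ℝ)) * ⟪y, ζ x⟫_ℝ = _ at h1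
    simp only [inner_sub_left, inner_smul_left, inner_add_left, conj_trivial,
      real_inner_comm y (confField l d P e x)] at h1 ⊢
    linear_combination (-(1 + μ * ‖x‖ ^ 2) / 2) * h1 + μ * ⟪x, y⟫_ℝ * h2
  set U' : Set (Coord n) := U ∩ {x | confField l d P e x ≠ 0} with hU'
  have hU'o : IsOpen U' := hU.inter
    (isOpen_ne_fun (contDiff_confField (k := 1) l d P e).continuous continuous_const)
  have hU'n : U'.Nonempty := by obtain ⟨x, hx, hx'⟩ := hξ; exact ⟨x, hx, hx'⟩
  -- polynomial identities extend from open sets to `ℝⁿ`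
  have hall : (fun x : Coord n => (1 + μ * ‖x‖ ^ 2) • ((-2 * μ * τ) • x + κ)
      - (2 * μ * N x) • x) = fun _ => 0 := by
    have hns : ContDiff ℝ ω fun x : Coord n => ‖x‖ ^ 2 := contDiff_norm_sq ℝ
    have hin : ContDiff ℝ ω fun x : Coord n => ⟪κ, x⟫_ℝ := contDiff_const.inner ℝ contDiff_id
    have hNs : ContDiff ℝ ω N :=
      (contDiff_const.mul (contDiff_const.sub (contDiff_const.mul hns))).add hin
    refine eq_of_eqOn_open ?_ contDiff_const hU'o hU'n fun x hx => hprod x hx.1 hx.2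
    have hs1 : ContDiff ℝ ω fun x : Coord n => 1 + μ * ‖x‖ ^ 2 :=
      contDiff_const.add (contDiff_const.mul hns)
    have hs2 : ContDiff ℝ ω fun x : Coord n => (-2 * μ * τ) • x + κ :=
      (contDiff_id.const_smul (-2 * μ * τ)).add contDiff_const
    have hs3 : ContDiff ℝ ω fun x : Coord n => 2 * μ * N x := contDiff_const.mul hNs
    exact (hs1.smul hs2).sub (hs3.smul contDiff_id)
  have hκ0 : κ = 0 := by simpa using congrFun hall 0
  have hη : η = -(μ • γ) := eq_neg_of_add_eq_zero_left hκ0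
  have hμτ : μ * τ = 0 := by
    have h1 := congrFun hall (basisVec ⟨0, by omega⟩)
    simp only [hN, hκ0, inner_zero_left, PiLp.norm_single, norm_one, one_pow,
      add_zero, mul_one, smul_smul, ← sub_smul] at h1
    have h2 : (basisVec (⟨0, by omega⟩ : Fin n) : Coord n) ≠ 0 := by simp
    have h3 := (smul_eq_zero.1 h1).resolve_right h2
    linear_combination -h3 / 4
  have hcτ : ∀ x ∈ U, c x = τ := by
    intro x hx
    have h1 := hc x hx
    simp only [hN, hκ0, inner_zero_left, add_zero] at h1
    have h2 : (1 + μ * ‖x‖ ^ 2) * (c x - τ) = 0 := by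
      linear_combination h1 - 2 * ‖x‖ ^ 2 * hμτ
    have := (mul_eq_zero.1 h2).resolve_left (hpos x hx).ne'
    linarith
  have hsmul : ∀ x, (2 * τ) • confField l d P e x =
      confField (2 * τ * l) ((2 * τ) • d) ((2 * τ) • P) ((2 * τ) • e) x := by
    intro x
    simp only [confField, inner_smul_left, conj_trivial, map_smul, LinearMap.smul_apply]
    module
  have hζall : ζ = confField (2 * τ * l) ((2 * τ) • d) ((2 * τ) • P) ((2 * τ) • e) := by
    refine eq_of_eqOn_open (contDiff_confField _ _ _ _) (contDiff_confField _ _ _ _) hU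
      (hU'n.mono Set.inter_subset_left) fun x hx => ?_
    rw [hζb x hx, hcτ x hx, hsmul]
  obtain ⟨r1, r2, r3, r4⟩ := confField_eq_zero (by omega)
    (P := bracketMatrix d e P η γ Q - (2 * τ) • P) (by
      rw [Matrix.transpose_sub, bracketMatrix_skew hP hQ, Matrix.transpose_smul, hP]; simp; abel)
    (fun x => (confField_sub _ _ _ _ _ _ _ _ x).trans (sub_eq_zero.2 (congrFun hζall x)))
  refine ⟨hη, hμτ, hcτ, sub_eq_zero.1 r1, sub_eq_zero.1 r2, sub_eq_zero.1 r3, ?_⟩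
  rw [← sub_eq_zero, ← neg_eq_zero, ← r4]
  abel

end Bracket

/-! ### The covariant derivative `V_{0|0}` as a Lie derivative -/

section FinslerLieDerivative

variable {n : ℕ} {x y : Coord n}

lemma sum_mul_pd_of_homogeneous {f : Coord n → ℝ} {k : ℕ} (hf : DifferentiableAt ℝ f y)
    (h : ∀ t : ℝ, 0 < t → f (t • y) = t ^ k * f y) : ∑ i, y i * pd f i y = k * f y := by
  rw [← fderiv_eq_sum_pd]
  have h1 : HasDerivAt (fun t : ℝ => f (t • y)) (fderiv ℝ f y y) 1 := by
    have h2 : HasDerivAt (fun t : ℝ => t • y) ((1 : ℝ) • y) 1 := (hasDerivAt_id 1).smul_const y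
    have h3 : HasFDerivAt f (fderiv ℝ f y) ((1 : ℝ) • y) := by
      rw [one_smul]; exact hf.hasFDerivAt
    simpa only [one_smul, Function.comp_def] using h3.comp_hasDerivAt 1 h2
  have h4 : HasDerivAt (fun t : ℝ => t ^ k * f y) (k * f y) 1 := by
    simpa using (hasDerivAt_pow k (1 : ℝ)).mul_const (f y)
  refine h1.unique (h4.congr_of_eventuallyEq ?_)
  filter_upwards [lt_mem_nhds (zero_lt_one : (0 : ℝ) < 1)] with t ht using h t ht

lemma pd_of_homogeneous {f : Coord n → ℝ} {k : ℕ}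
    (h : ∀ t : ℝ, 0 < t → ∀ z, f (t • z) = t ^ (k + 1) * f z) (t : ℝ) (ht : 0 < t)
    (y : Coord n) (i : Fin n) : pd f i (t • y) = t ^ k * pd f i y := by
  have h1 : pd (fun z => f (t • z)) i y = t * pd f i (t • y) := by
    rw [pd, fderiv_comp_smul (f := f) t]; simp [pd]
  have h2 : pd (fun z => f (t • z)) i y = t ^ (k + 1) * pd f i y := by
    have : (fun z => f (t • z)) = t ^ (k + 1) • f := by
      ext z; rw [h t ht]; simp
    rw [this, pd, fderiv_const_smul_field]; simp [pd]
  rw [h1, pow_succ'] at h2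
  exact mul_left_cancel₀ ht.ne' (h2.trans (mul_assoc _ _ _))

/-- Joint smoothness of functions of position and direction, away from the zero section. -/
def SmoothOffZero (s : Set (Coord n)) (f : Coord n → Coord n → ℝ) : Prop :=
  ContDiffOn ℝ ∞ (fun p : Coord n × Coord n => f p.1 p.2) (s ×ˢ {0}ᶜ)

variable {s : Set (Coord n)} {f F : Coord n → Coord n → ℝ}

lemma isOpen_prod_compl_zero (hs : IsOpen s) : IsOpen (s ×ˢ ({0}ᶜ : Set (Coord n))) :=
  hs.prod isOpen_compl_singleton

lemma SmoothOffZero.differentiableAt (hs : IsOpen s) (hf : SmoothOffZero s f) (hx : x ∈ s)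
    (hy : y ≠ 0) : DifferentiableAt ℝ (fun p : Coord n × Coord n => f p.1 p.2) (x, y) :=
  differentiableAt_of_contDiffOn (isOpen_prod_compl_zero hs) hf ⟨hx, hy⟩

lemma SmoothOffZero.hasFDerivAt_snd (hs : IsOpen s) (hf : SmoothOffZero s f) (hx : x ∈ s)
    (hy : y ≠ 0) : HasFDerivAt (f x) ((fderiv ℝ (fun p : Coord n × Coord n => f p.1 p.2)
      (x, y)).comp (ContinuousLinearMap.inr ℝ _ _)) y :=
  (hf.differentiableAt hs hx hy).hasFDerivAt.comp y (hasFDerivAt_prodMk_right x y)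

lemma SmoothOffZero.hasFDerivAt_fst (hs : IsOpen s) (hf : SmoothOffZero s f) (hx : x ∈ s)
    (hy : y ≠ 0) : HasFDerivAt (fun z => f z y) ((fderiv ℝ (fun p : Coord n × Coord n => f p.1 p.2)
      (x, y)).comp (ContinuousLinearMap.inl ℝ _ _)) x :=
  HasFDerivAt.comp (g := fun p : Coord n × Coord n => f p.1 p.2) (f := fun z => (z, y)) x
    (hf.differentiableAt hs hx hy).hasFDerivAt (hasFDerivAt_prodMk_left x y)

lemma SmoothOffZero.pdY (hs : IsOpen s) (hf : SmoothOffZero s f) (i : Fin n) :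
    SmoothOffZero s (pdY f i) := by
  have h1 := (hf.fderiv_of_isOpen (isOpen_prod_compl_zero hs) (m := ∞) (by simp)).clm_apply
    (contDiffOn_const (c := ((0, basisVec i) : Coord n × Coord n)))
  refine h1.congr fun p hp => ?_
  simp only [FinslerConformal.pdY, pd]
  rw [(hf.hasFDerivAt_snd hs hp.1 hp.2).fderiv]
  simp

lemma SmoothOffZero.const_mul (hf : SmoothOffZero s f) (c : ℝ) :
    SmoothOffZero s (fun x y => c * f x y) := contDiffOn_const.mul hf

lemma SmoothOffZero.slice (hf : SmoothOffZero s f) (hx : x ∈ s) :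
    ContDiffOn ℝ ∞ (f x) {0}ᶜ :=
  hf.comp (contDiff_prodMk_right x).contDiffOn fun _ hy => ⟨hx, hy⟩

/-- The total derivative of `f(x, y)` in terms of partial derivatives. -/
lemma SmoothOffZero.fderiv_apply (hs : IsOpen s) (hf : SmoothOffZero s f) (hx : x ∈ s)
    (hy : y ≠ 0) (a b : Coord n) :
    fderiv ℝ (fun p : Coord n × Coord n => f p.1 p.2) (x, y) (a, b) =
      ∑ i, a i * pdX f i x y + ∑ i, b i * FinslerConformal.pdY f i x y := by
  simp only [pdX, FinslerConformal.pdY]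
  rw [← fderiv_eq_sum_pd, ← fderiv_eq_sum_pd, (hf.hasFDerivAt_snd hs hx hy).fderiv,
    (hf.hasFDerivAt_fst hs hx hy).fderiv]
  simp only [ContinuousLinearMap.comp_apply, ContinuousLinearMap.inl_apply,
    ContinuousLinearMap.inr_apply, ← map_add, Prod.mk_add_mk, add_zero, zero_add]

section Tensor

variable (hs : IsOpen s) (hF : SmoothOffZero s F)
include hs hF

lemma smoothOffZero_fundamentalTensor (i j : Fin n) :
    SmoothOffZero s (fun z w => fundamentalTensor F z w i j) := by
  have h2 : SmoothOffZero s (fun z w => F z w ^ 2) := ContDiffOn.pow hF 2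
  exact ((h2.pdY hs j).pdY hs i).const_mul (1 / 2)

omit hs in
lemma fundamentalTensor_symm (hx : x ∈ s) (hy : y ≠ 0) (i j : Fin n) :
    fundamentalTensor F x y i j = fundamentalTensor F x y j i := by
  have h2 : SmoothOffZero s (fun z w => F z w ^ 2) := ContDiffOn.pow hF 2
  have := pd_comm isOpen_compl_singleton (h2.slice hx) (x := y) hy j i
  simp only [fundamentalTensor, Matrix.of_apply, pdY] at this ⊢
  exact congrArg _ this

variable (hom : ∀ x ∈ s, ∀ y, ∀ t : ℝ, 0 < t → F x (t • y) = t * F x y)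
include hom

lemma sum_mul_fundamentalTensor (hx : x ∈ s) (hy : y ≠ 0) (j : Fin n) :
    ∑ i, y i * fundamentalTensor F x y i j = 1 / 2 * pdY (fun z w => F z w ^ 2) j x y := by
  have h2 : SmoothOffZero s (fun z w => F z w ^ 2) := ContDiffOn.pow hF 2
  have h3 := sum_mul_pd_of_homogeneous (k := 1) (f := pdY (fun z w => F z w ^ 2) j x) (y := y)
    ((h2.pdY hs j).hasFDerivAt_snd hs hx hy).differentiableAt
    (fun t ht => pd_of_homogeneous (f := fun w => F x w ^ 2) (k := 1)
      (fun t ht z => by rw [hom x hx z t ht]; ring) t ht y j)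
  rw [Nat.cast_one, one_mul] at h3
  rw [← h3, Finset.mul_sum]
  refine Finset.sum_congr rfl fun i _ => ?_
  simp only [fundamentalTensor, Matrix.of_apply, pdY]
  ring

lemma sum_sum_mul_fundamentalTensor (hx : x ∈ s) (hy : y ≠ 0) :
    ∑ i, ∑ j, fundamentalTensor F x y i j * y i * y j = F x y ^ 2 := by
  have h2 : SmoothOffZero s (fun z w => F z w ^ 2) := ContDiffOn.pow hF 2
  have h3 := sum_mul_pd_of_homogeneous (k := 2) (f := fun w => F x w ^ 2) (y := y)
    (h2.hasFDerivAt_snd hs hx hy).differentiableAt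
    (fun t ht => by rw [hom x hx y t ht]; ring)
  rw [Finset.sum_comm]
  have h4 : ∀ j, ∑ i, fundamentalTensor F x y i j * y i * y j =
      1 / 2 * (y j * pd (fun w => F x w ^ 2) j y) := by
    intro j
    have := sum_mul_fundamentalTensor hs hF hom hx hy j
    rw [← Finset.sum_mul]
    simp only [mul_comm (fundamentalTensor F x y _ j)]
    rw [this, pdY]; ring
  simp only [h4, ← Finset.mul_sum, h3]
  push_cast; ring

lemma sum_mul_pdY_fundamentalTensor (hx : x ∈ s) (hy : y ≠ 0) (j m : Fin n) :
    ∑ i, y i * pdY (fun z w => fundamentalTensor F z w i j) m x y = 0 := by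
  have h2 : SmoothOffZero s (fun z w => F z w ^ 2) := ContDiffOn.pow hF 2
  have hg : ∀ i, DifferentiableAt ℝ (fun w => fundamentalTensor F x w i j) y := fun i =>
    ((smoothOffZero_fundamentalTensor hs hF i j).hasFDerivAt_snd hs hx hy).differentiableAt
  have hc : ∀ i, DifferentiableAt ℝ (fun w : Coord n => w i) y := fun i =>
    (EuclideanSpace.proj (𝕜 := ℝ) i : Coord n →L[ℝ] ℝ).differentiableAt
  have h3 : pd (fun w => ∑ i, w i * fundamentalTensor F x w i j) m y =
      pd (fun w => 1 / 2 * pdY (fun z w => F z w ^ 2) j x w) m y :=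
    pd_congr_of_mem isOpen_compl_singleton hy fun w hw =>
      sum_mul_fundamentalTensor hs hF hom hx hw j
  rw [pd_sum (fun i _ => (hc i).fun_mul (hg i)), pd_const_mul _
    ((h2.pdY hs j).hasFDerivAt_snd hs hx hy).differentiableAt] at h3
  simp only [pd_mul (hc _) (hg _), pd_coord, Finset.sum_add_distrib, ite_mul, one_mul, zero_mul,
    Finset.sum_ite_eq, Finset.mem_univ, if_true] at h3
  have h4 : fundamentalTensor F x y m j = 1 / 2 * pd (pdY (fun z w => F z w ^ 2) j x) m y := by
    simp only [fundamentalTensor, Matrix.of_apply, pdY]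
  rw [h4] at h3
  simpa [pdY] using h3

lemma sum_hDeriv_fundamentalTensor (hx : x ∈ s) (hy : y ≠ 0) (l : Fin n) :
    ∑ i, ∑ j, hDeriv F (fun z w => fundamentalTensor F z w i j) l x y * y i * y j =
      pdX (fun z w => F z w ^ 2) l x y := by
  have hg : ∀ i j, DifferentiableAt ℝ (fun z => fundamentalTensor F z y i j) x := fun i j =>
    ((smoothOffZero_fundamentalTensor hs hF i j).hasFDerivAt_fst hs hx hy).differentiableAt
  have h1 : pdX (fun z w => F z w ^ 2) l x y =
      ∑ i, ∑ j, pdX (fun z w => fundamentalTensor F z w i j) l x y * y i * y j := by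
    have h2 : pdX (fun z w => F z w ^ 2) l x y =
        pd (fun z => ∑ i, ∑ j, fundamentalTensor F z y i j * y i * y j) l x :=
      pd_congr_of_mem hs hx fun z hz => (sum_sum_mul_fundamentalTensor hs hF hom hz hy).symm
    have h3 : ∀ i j, DifferentiableAt ℝ (fun z => fundamentalTensor F z y i j * y i * y j) x :=
      fun i j => ((hg i j).mul_const _).mul_const _
    rw [h2, pd_sum fun i _ => DifferentiableAt.fun_sum fun j _ => h3 i j]
    refine Finset.sum_congr rfl fun i _ => ?_
    rw [pd_sum fun j _ => h3 i j]
    refine Finset.sum_congr rfl fun j _ => ?_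
    have : (fun z => fundamentalTensor F z y i j * y i * y j) =
        fun z => (y i * y j) * fundamentalTensor F z y i j := by ext; ring
    rw [this, pd_const_mul _ (hg i j), pdX]; ring
  have h5 : ∑ i, ∑ j, (∑ m, nonlinearConn F m l x y *
      pdY (fun z w => fundamentalTensor F z w i j) m x y) * y i * y j = 0 := by
    rw [Finset.sum_comm]
    refine Finset.sum_eq_zero fun j _ => ?_
    simp only [Finset.sum_mul]
    rw [Finset.sum_comm]
    refine Finset.sum_eq_zero fun m _ => ?_
    have := sum_mul_pdY_fundamentalTensor hs hF hom hx hy j m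
    calc _ = nonlinearConn F m l x y * y j *
        ∑ i, y i * pdY (fun z w => fundamentalTensor F z w i j) m x y := by
          rw [Finset.mul_sum]; exact Finset.sum_congr rfl fun _ _ => by ring
      _ = 0 := by rw [this, mul_zero]
  rw [h1]
  simp only [hDeriv, sub_mul, Finset.sum_sub_distrib]
  rw [h5, sub_zero]

/-- For a vector field `V` the function `V_{0|0}` is half of the derivative of `F²` along the
complete lift of `V` to the tangent bundle. In particular the Chern connection drops out. -/
theorem hCovDeriv00_eq (hpos : ∀ x ∈ s, ∀ y : Coord n, y ≠ 0 → (fundamentalTensor F x y).det ≠ 0)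
    {V : Coord n → Coord n} (hx : x ∈ s) (hV : DifferentiableAt ℝ V x) (hy : y ≠ 0) :
    hCovDeriv00 F V x y = 1 / 2 *
      fderiv ℝ (fun p : Coord n × Coord n => F p.1 p.2 ^ 2) (x, y) (V x, fderiv ℝ V x y) := by
  have h2 : SmoothOffZero s (fun z w => F z w ^ 2) := ContDiffOn.pow hF 2
  have hVc : ∀ m, DifferentiableAt ℝ (fun z => V z m) x := fun m =>
    (EuclideanSpace.proj (𝕜 := ℝ) m : Coord n →L[ℝ] ℝ).differentiableAt.comp x hV
  have hgx : ∀ i j, DifferentiableAt ℝ (fun z => fundamentalTensor F z y i j) x := fun i j =>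
    ((smoothOffZero_fundamentalTensor hs hF i j).hasFDerivAt_fst hs hx hy).differentiableAt
  have hgy : ∀ i j, DifferentiableAt ℝ (fun w => fundamentalTensor F x w i j) y := fun i j =>
    ((smoothOffZero_fundamentalTensor hs hF i j).hasFDerivAt_snd hs hx hy).differentiableAt
  set D : Fin n → Fin n → Fin n → ℝ := fun l i j =>
    hDeriv F (fun z w => fundamentalTensor F z w i j) l x y with hD
  set G := fundamentalTensor F x y with hG
  set W : Fin n → Fin n → ℝ := fun j m => pd (fun z => V z m) j x with hW
  have hsymm : ∀ i j, G i j = G j i := fundamentalTensor_symm hF hx hy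
  have hDsymm : ∀ l i j, D l i j = D l j i := by
    intro l i j
    have e1 : pdX (fun z w => fundamentalTensor F z w i j) l x y =
        pdX (fun z w => fundamentalTensor F z w j i) l x y :=
      pd_congr_of_mem hs hx fun z hz => fundamentalTensor_symm hF hz hy i j
    have e2 : ∀ m, pdY (fun z w => fundamentalTensor F z w i j) m x y =
        pdY (fun z w => fundamentalTensor F z w j i) m x y := fun m =>
      pd_congr_of_mem isOpen_compl_singleton hy fun w hw =>
        fundamentalTensor_symm hF hx hw i j
    simp only [hD, hDeriv, e1, e2]
  have hlow : ∀ i j, hDeriv F (lowerIndex F V i) j x y =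
      ∑ m, D j i m * V x m + ∑ m, G i m * W j m := by
    intro i j
    have e1 : pdX (lowerIndex F V i) j x y =
        ∑ m, pdX (fun z w => fundamentalTensor F z w i m) j x y * V x m + ∑ m, G i m * W j m := by
      simp only [pdX, lowerIndex]
      rw [pd_sum fun m _ => (hgx i m).fun_mul (hVc m), ← Finset.sum_add_distrib]
      exact Finset.sum_congr rfl fun m _ => pd_mul (hgx i m) (hVc m)
    have e2 : ∀ k, pdY (lowerIndex F V i) k x y =
        ∑ m, pdY (fun z w => fundamentalTensor F z w i m) k x y * V x m := by
      intro k
      simp only [pdY]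
      have : lowerIndex F V i x = fun w => ∑ m, fundamentalTensor F x w i m * V x m := rfl
      rw [this, pd_sum fun m _ => (hgy i m).mul_const _]
      refine Finset.sum_congr rfl fun m _ => ?_
      rw [pd_mul (hgy i m) (differentiableAt_const _), pd_const]; ring
    simp only [hDeriv, e1, e2, hD, sub_mul, Finset.sum_sub_distrib, Finset.mul_sum, Finset.sum_mul]
    rw [Finset.sum_comm (f := fun k m => nonlinearConn F k j x y * _)]
    simp only [mul_assoc]
    ring
  have hinv : ∀ l, ∑ k, G⁻¹ k l * lowerIndex F V k x y = V x l := by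
    intro l
    have hGs : G⁻¹ᵀ = G⁻¹ := by
      rw [Matrix.transpose_nonsing_inv]; congr 1; ext i j; exact hsymm j i
    have e : (G⁻¹ᵀ *ᵥ (G *ᵥ (V x).ofLp)) l = V x l := by
      rw [hGs, Matrix.mulVec_mulVec, Matrix.nonsing_inv_mul _ (hpos x hx y hy).isUnit,
        Matrix.one_mulVec]
    rw [← e]
    simp only [Matrix.mulVec, dotProduct, Matrix.transpose_apply, lowerIndex, hG]
  -- lowering the upper index of the Chern coefficients leaves the Christoffel combination of `D`
  have hchern : ∀ i j, ∑ k, chernCoeff F k i j x y * lowerIndex F V k x y =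
      1 / 2 * ∑ l, (D i l j + D j i l - D l i j) * V x l := by
    intro i j
    simp only [chernCoeff, ← hinv, Finset.mul_sum, Finset.sum_mul]
    rw [Finset.sum_comm]
    exact Finset.sum_congr rfl fun _ _ => Finset.sum_congr rfl fun _ _ => by ring
  -- in `D l i j y i y j` the nonlinear connection drops out by homogeneity
  have hquad : ∀ l, ∑ i, ∑ j, D l i j * y i * y j = pdX (fun z w => F z w ^ 2) l x y := fun l =>
    sum_hDeriv_fundamentalTensor hs hF hom hx hy l
  have hfst : ∀ m, ∑ i, y i * G i m = 1 / 2 * pdY (fun z w => F z w ^ 2) m x y := fun m =>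
    sum_mul_fundamentalTensor hs hF hom hx hy m
  have hDV : ∀ m, fderiv ℝ V x y m = ∑ j, y j * W j m := fun m => fderiv_apply_coord hV y
  rw [SmoothOffZero.fderiv_apply hs h2 hx hy]
  have t1 : ∑ i, ∑ j, (∑ m, G i m * W j m) * y i * y j =
      1 / 2 * ∑ m, fderiv ℝ V x y m * pdY (fun z w => F z w ^ 2) m x y := by
    calc ∑ i, ∑ j, (∑ m, G i m * W j m) * y i * y j
        = ∑ i, ∑ j, ∑ m, (y j * W j m) * (y i * G i m) := by
          simp only [Finset.sum_mul]
          exact Finset.sum_congr rfl fun _ _ => Finset.sum_congr rfl fun _ _ =>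
            Finset.sum_congr rfl fun _ _ => by ring
      _ = ∑ m, (∑ j, y j * W j m) * ∑ i, y i * G i m := by
          simp only [Finset.sum_mul_sum]
          rw [Finset.sum_comm]
          rw [Finset.sum_congr rfl fun j _ => Finset.sum_comm, Finset.sum_comm]
      _ = _ := by
          simp only [← hDV, hfst, Finset.mul_sum]
          exact Finset.sum_congr rfl fun _ _ => by ring
  have t2 : ∑ i, ∑ j, (1 / 2 * ∑ l, D l i j * V x l) * y i * y j =
      1 / 2 * ∑ l, V x l * pdX (fun z w => F z w ^ 2) l x y := by
    calc ∑ i, ∑ j, (1 / 2 * ∑ l, D l i j * V x l) * y i * y j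
        = ∑ i, ∑ j, ∑ l, 1 / 2 * (V x l * (D l i j * y i * y j)) := by
          simp only [Finset.sum_mul, Finset.mul_sum]
          exact Finset.sum_congr rfl fun _ _ => Finset.sum_congr rfl fun _ _ =>
            Finset.sum_congr rfl fun _ _ => by ring
      _ = ∑ l, 1 / 2 * (V x l * ∑ i, ∑ j, D l i j * y i * y j) := by
          simp only [Finset.mul_sum]
          rw [Finset.sum_congr rfl fun j _ => Finset.sum_comm, Finset.sum_comm]
      _ = _ := by simp only [hquad, Finset.mul_sum]
  have t3 : ∑ i, ∑ j, (∑ l, D j i l * V x l) * y i * y j =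
      ∑ i, ∑ j, (∑ l, D i l j * V x l) * y i * y j := by
    rw [Finset.sum_comm]
    refine Finset.sum_congr rfl fun i _ => Finset.sum_congr rfl fun j _ => ?_
    simp only [hDsymm i _ j]; ring
  have hsplit : ∀ i j, hCovDeriv F V i j x y * y i * y j =
      (∑ m, G i m * W j m) * y i * y j + (1 / 2 * ∑ l, D l i j * V x l) * y i * y j
      + 1 / 2 * ((∑ l, D j i l * V x l) * y i * y j)
      - 1 / 2 * ((∑ l, D i l j * V x l) * y i * y j) := by
    intro i j
    rw [hCovDeriv, hlow, hchern]
    simp only [add_mul, sub_mul, Finset.sum_add_distrib, Finset.sum_sub_distrib]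
    ring
  simp only [hCovDeriv00, hsplit, Finset.sum_add_distrib, Finset.sum_sub_distrib]
  simp only [← Finset.mul_sum] at t2 t3 ⊢
  rw [t1, t2, t3]
  ring

end Tensor
end FinslerLieDerivative

/-! ### The algebraic alternative for `(α, β)`-metrics -/

section Alternative

/-- A positive function `ψ` with `ψ(0) = 1` that satisfies
`p s (ψ - s ψ' / 2) + q ψ' = 0` with `(p, q) ≠ (0, 0)` is of the form `1 + k s²`. -/
lemma exists_eq_one_add_mul_sq {ψ : ℝ → ℝ} {S : Set ℝ} (hS : IsOpen S) (hψ : ContDiffOn ℝ ∞ ψ S)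
    {b : ℝ} (hb : 0 < b) (hbS : Set.Icc (-b) b ⊆ S) (h0 : ψ 0 = 1)
    (hpos : ∀ s ∈ Set.Icc (-b) b, 0 < ψ s) {p q : ℝ} (hpq : p ≠ 0 ∨ q ≠ 0)
    (heq : ∀ s ∈ Set.Ioo (-b) b, s ≠ 0 → p * s * (ψ s - s * deriv ψ s / 2) + q * deriv ψ s = 0) :
    ∃ k : ℝ, ∀ s ∈ Set.Icc (-b) b, ψ s = 1 + k * s ^ 2 := by
  have hsub : Set.Ioo (-b) b ⊆ S := Set.Ioo_subset_Icc_self.trans hbS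
  have hI0 : (0 : ℝ) ∈ Set.Ioo (-b) b := ⟨by linarith, hb⟩
  have hcψ : ContinuousAt ψ 0 := hψ.continuousOn.continuousAt (hS.mem_nhds (hsub hI0))
  have hcd : ContinuousAt (deriv ψ) 0 :=
    (hψ.continuousOn_deriv_of_isOpen hS (by norm_cast)).continuousAt (hS.mem_nhds (hsub hI0))
  -- an identity between continuous functions that holds off `0` near `0` holds at `0`
  have hext : ∀ f : ℝ → ℝ, ContinuousAt f 0 → (∀ s ∈ Set.Ioo (-b) b, s ≠ 0 → f s = 0) →
      f 0 = 0 := by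
    intro f hf h
    refine tendsto_nhds_unique (hf.tendsto.mono_left nhdsWithin_le_nhds) ?_
      (l := 𝓝[≠] (0 : ℝ))
    refine (tendsto_const_nhds (x := (0 : ℝ))).congr' ?_
    filter_upwards [self_mem_nhdsWithin, nhdsWithin_le_nhds (isOpen_Ioo.mem_nhds hI0)] with s hs hs'
    exact (h s hs' hs).symm
  have hq : q ≠ 0 := by
    rintro rfl
    have hp : p ≠ 0 := by simpa using hpq
    have := hext (fun s => ψ s - s * deriv ψ s / 2)
      (hcψ.sub ((continuousAt_id.mul hcd).div_const 2)) (fun s hs hs0 => by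
        have := heq s hs hs0
        rw [zero_mul, add_zero] at this
        exact (mul_eq_zero.1 this).resolve_left (mul_ne_zero hp hs0))
    simp only [zero_mul, zero_div, sub_zero, h0] at this
    exact one_ne_zero this
  have hd0 : q * deriv ψ 0 = 0 := by
    have := hext (fun s => p * s * (ψ s - s * deriv ψ s / 2) + q * deriv ψ s)
      (((continuousAt_const.mul continuousAt_id).mul
        (hcψ.sub ((continuousAt_id.mul hcd).div_const 2))).add (continuousAt_const.mul hcd)) heq
    simpa using this
  set k : ℝ := -p / (2 * q) with hk
  have hode : ∀ s ∈ Set.Ioo (-b) b, deriv ψ s * (1 + k * s ^ 2) = 2 * k * s * ψ s := by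
    intro s hs
    have h1 : p * s * (ψ s - s * deriv ψ s / 2) + q * deriv ψ s = 0 := by
      by_cases hs0 : s = 0
      · subst hs0; simpa using hd0
      · exact heq s hs hs0
    rw [hk]
    field_simp
    linear_combination 2 * h1
  have hdiff : ∀ s ∈ Set.Icc (-b) b, DifferentiableAt ℝ ψ s := fun s hs =>
    (hψ.contDiffAt (hS.mem_nhds (hbS hs))).differentiableAt (by simp)
  -- the derivative of `(1 + k s²) / ψ` vanishes
  have hconst : ∀ s ∈ Set.Ioo (-b) b, (1 + k * s ^ 2) / ψ s = (1 + k * 0 ^ 2) / ψ 0 := by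
    intro s hs
    have hpsi : ∀ s ∈ Set.Ioo (-b) b,
        HasDerivAt (fun s => (1 + k * s ^ 2) / ψ s) 0 s := by
      intro s hs
      have hs' := Set.Ioo_subset_Icc_self hs
      have h1 : HasDerivAt (fun s : ℝ => 1 + k * s ^ 2) (k * (2 * s)) s := by
        simpa using ((hasDerivAt_pow 2 s).const_mul k).const_add 1
      have h2 := h1.div (hdiff s hs').hasDerivAt (hpos s hs').ne'
      have h3 : (k * (2 * s) * ψ s - (1 + k * s ^ 2) * deriv ψ s) / ψ s ^ 2 = 0 := by
        rw [div_eq_zero_iff]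
        left
        linear_combination -hode s hs
      rw [h3] at h2
      exact h2
    refine isOpen_Ioo.is_const_of_deriv_eq_zero (convex_Ioo _ _).isPreconnected
      (fun s hs => (hpsi s hs).differentiableAt.differentiableWithinAt)
      (fun s hs => (hpsi s hs).deriv) hs hI0
  refine ⟨k, fun s hs => ?_⟩
  have hcl : s ∈ closure (Set.Ioo (-b) b) := by
    rw [closure_Ioo (by linarith)]; exact hs
  have hon : Set.EqOn ψ (fun s => 1 + k * s ^ 2) (Set.Ioo (-b) b) := by
    intro s hs
    have h1 := hconst s hs
    have h2 := (hpos s (Set.Ioo_subset_Icc_self hs)).ne'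
    rw [h0] at h1
    field_simp at h1
    simp only
    linarith
  have hc1 : ContinuousWithinAt ψ (Set.Ioo (-b) b) s := (hdiff s hs).continuousAt.continuousWithinAt
  have hc2 : Continuous fun s : ℝ => 1 + k * s ^ 2 := by fun_prop
  have : (𝓝[Set.Ioo (-b) b] s).NeBot := mem_closure_iff_nhdsWithin_neBot.1 hcl
  refine tendsto_nhds_unique hc1 ?_
  exact (hc2.continuousWithinAt (s := Set.Ioo (-b) b) (x := s)).tendsto.congr'
    (Filter.eventuallyEq_of_mem self_mem_nhdsWithin fun t ht => (hon ht).symm)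

variable {n : ℕ} {g : Coord n → Matrix (Fin n) (Fin n) ℝ} {x : Coord n}

lemma exists_unit_orthogonal (hn : 2 ≤ n) (hpos : ∀ y : Coord n, y ≠ 0 → 0 < innerAt g x y y)
    (ζ : Coord n) : ∃ w : Coord n, innerAt g x w w = 1 ∧ innerAt g x ζ w = 0 := by
  let L : Coord n →ₗ[ℝ] ℝ :=
    ⟨⟨innerAt g x ζ, innerAt_add_right ζ⟩, fun t => innerAt_smul_right t ζ⟩
  have hker : LinearMap.ker L ≠ ⊥ := by
    refine LinearMap.ker_ne_bot_of_finrank_lt ?_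
    simp only [Module.finrank_self, finrank_euclideanSpace, Fintype.card_fin]
    omega
  obtain ⟨w, hw, hw0⟩ := Submodule.exists_mem_ne_zero_of_ne_bot hker
  have hp := hpos w hw0
  refine ⟨(√(innerAt g x w w))⁻¹ • w, ?_, ?_⟩
  · rw [innerAt_smul_left, innerAt_smul_right, ← mul_assoc, ← mul_inv, Real.mul_self_sqrt hp.le,
      inv_mul_cancel₀ hp.ne']
  · rw [innerAt_smul_right]
    have : innerAt g x ζ w = 0 := hw
    rw [this, mul_zero]

/-- If a quadratic form `T`, with polarization `X`, and a linear form `B` satisfy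
`T (ψ - s ψ' / 2) + α ψ' B = 0` with `s = β / α`, then they vanish, or `ψ = 1 + k s²` for all
values of `s`. The vector `ζ` is dual to `β`. -/
theorem eq_zero_or_exists_eq_one_add_mul_sq (hn : 2 ≤ n)
    (hsymm : ∀ i j, g x i j = g x j i) (hpos : ∀ y : Coord n, y ≠ 0 → 0 < innerAt g x y y)
    {ζ : Coord n} (hζ : ζ ≠ 0) {ψ : ℝ → ℝ} {S : Set ℝ} (hS : IsOpen S)
    (hψ : ContDiffOn ℝ ∞ ψ S) (hbS : ∀ s, s ^ 2 ≤ innerAt g x ζ ζ → s ∈ S)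
    (h0 : ψ 0 = 1) (hψpos : ∀ s, s ^ 2 ≤ innerAt g x ζ ζ → 0 < ψ s)
    {T B : Coord n → ℝ} {X : Coord n → Coord n → ℝ}
    (hT : ∀ (s t : ℝ) y z, T (s • y + t • z) = s ^ 2 * T y + s * t * X y z + t ^ 2 * T z)
    (hB : ∀ (s t : ℝ) y z, B (s • y + t • z) = s * B y + t * B z)
    (heq : ∀ y : Coord n, innerAt g x y y = 1 → ∀ s, s = innerAt g x ζ y →
      T y * (ψ s - s * deriv ψ s / 2) + deriv ψ s * B y = 0) :
    (∀ y, T y = 0 ∧ B y = 0) ∨ ∃ k : ℝ, ∀ s, s ^ 2 ≤ innerAt g x ζ ζ → ψ s = 1 + k * s ^ 2 := by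
  have hb2 := hpos ζ hζ
  set b2 := innerAt g x ζ ζ with hb2_def
  set b := √b2 with hb_def
  have hb : 0 < b := Real.sqrt_pos.2 hb2
  have hbb : b ^ 2 = b2 := Real.sq_sqrt hb2.le
  have hIcc : ∀ s, s ^ 2 ≤ b2 ↔ s ∈ Set.Icc (-b) b := fun s => by
    rw [← hbb, Set.mem_Icc, ← abs_le, sq_le_sq, abs_of_pos hb]
  -- the even and the odd part of the relation along `(s / b²) ζ ± r w`
  have hrel : ∀ w, innerAt g x w w = 1 → innerAt g x ζ w = 0 → ∀ s ∈ Set.Icc (-b) b, ∀ r : ℝ,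
      r ^ 2 = 1 - s ^ 2 / b2 →
      ((s / b2) ^ 2 * T ζ + r ^ 2 * T w) * (ψ s - s * deriv ψ s / 2)
        + deriv ψ s * (s / b2 * B ζ) = 0 ∧
      r * (s / b2 * X ζ w * (ψ s - s * deriv ψ s / 2) + deriv ψ s * B w) = 0 := by
    intro w hw hζw s hs r hr
    have hwζ : innerAt g x w ζ = 0 := by rw [innerAt_comm hsymm, hζw]
    have key : ∀ r : ℝ, r ^ 2 = 1 - s ^ 2 / b2 →
        T ((s / b2) • ζ + r • w) * (ψ s - s * deriv ψ s / 2)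
          + deriv ψ s * B ((s / b2) • ζ + r • w) = 0 := by
      intro r hr
      refine heq _ ?_ s ?_
      · rw [innerAt_add_left, innerAt_add_right, innerAt_add_right]
        simp only [innerAt_smul_left, innerAt_smul_right, hw, hζw, hwζ, ← hb2_def]
        have : s / b2 * (s / b2 * b2) = s ^ 2 / b2 := by field_simp
        linear_combination this + hr
      · rw [innerAt_add_right, innerAt_smul_right, innerAt_smul_right, hζw, ← hb2_def]
        field_simp
        ring
    have k1 := key r hr
    have k2 := key (-r) (by rw [neg_sq, hr])
    rw [hT, hB] at k1 k2
    constructor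
    · linear_combination (k1 + k2) / 2
    · linear_combination (k1 - k2) / 2
  -- the case `s = 0`, `r = 1`
  have hTw : ∀ w, innerAt g x w w = 1 → innerAt g x ζ w = 0 → T w = 0 := by
    intro w hw hζw
    have := (hrel w hw hζw 0 ⟨by linarith, hb.le⟩ 1 (by simp)).1
    simpa [h0] using this
  by_cases hall : (T ζ = 0 ∧ B ζ = 0) ∧
      ∀ w, innerAt g x w w = 1 → innerAt g x ζ w = 0 → X ζ w = 0 ∧ B w = 0
  · left
    intro y
    obtain ⟨⟨hTζ, hBζ⟩, hw⟩ := hall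
    set v : Coord n := y - (innerAt g x ζ y / b2) • ζ with hv
    have hy : y = (innerAt g x ζ y / b2) • ζ + (1 : ℝ) • v := by rw [hv]; simp
    have hζv : innerAt g x ζ v = 0 := by
      have := congrArg (innerAt g x ζ) hy
      rw [innerAt_add_right, innerAt_smul_right, innerAt_smul_right, ← hb2_def] at this
      field_simp at this
      linarith
    by_cases hv0 : v = 0
    · rw [hy, hv0, smul_zero, ← smul_zero (0 : ℝ)]
      rw [hT, hB, hTζ, hBζ]; simp
    · have hvv := hpos v hv0
      set N := √(innerAt g x v v) with hN
      have hNp : 0 < N := Real.sqrt_pos.2 hvv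
      have hNN : N * N = innerAt g x v v := Real.mul_self_sqrt hvv.le
      set w := N⁻¹ • v with hw_def
      have h1 : innerAt g x w w = 1 := by
        rw [hw_def, innerAt_smul_left, innerAt_smul_right, ← hNN]; field_simp
      have h2 : innerAt g x ζ w = 0 := by rw [hw_def, innerAt_smul_right, hζv, mul_zero]
      have hy' : y = (innerAt g x ζ y / b2) • ζ + N • w := by
        rw [hw_def, smul_smul, mul_inv_cancel₀ hNp.ne']; exact hy
      obtain ⟨h3, h4⟩ := hw w h1 h2
      rw [hy', hT, hB, hTζ, hBζ, h3, h4, hTw w h1 h2]; simp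
  · right
    -- one of the two relations is a nontrivial differential equation for `ψ`
    have hfin : ∀ p q : ℝ, (p ≠ 0 ∨ q ≠ 0) → (∀ s ∈ Set.Ioo (-b) b, s ≠ 0 →
        p * s * (ψ s - s * deriv ψ s / 2) + q * deriv ψ s = 0) →
        ∃ k : ℝ, ∀ s, s ^ 2 ≤ b2 → ψ s = 1 + k * s ^ 2 := by
      intro p q hpq hode
      obtain ⟨k, hk⟩ := exists_eq_one_add_mul_sq hS hψ hb
        (fun s hs => hbS s ((hIcc s).2 hs)) h0 (fun s hs => hψpos s ((hIcc s).2 hs)) hpq hode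
      exact ⟨k, fun s hs => hk s ((hIcc s).1 hs)⟩
    have hr : ∀ s ∈ Set.Ioo (-b) b, ∃ r : ℝ, r ≠ 0 ∧ r ^ 2 = 1 - s ^ 2 / b2 := by
      intro s hs
      have h1 : s ^ 2 < b2 := by
        rw [← hbb, sq_lt_sq, abs_of_pos hb, abs_lt]; exact hs
      have h2 : 0 < 1 - s ^ 2 / b2 := by
        rw [sub_pos, div_lt_one hb2]; exact h1
      exact ⟨√(1 - s ^ 2 / b2), (Real.sqrt_pos.2 h2).ne', Real.sq_sqrt h2.le⟩
    rw [not_and_or] at hall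
    rcases hall with h | h
    · obtain ⟨w, hw, hζw⟩ := exists_unit_orthogonal hn hpos ζ
      refine hfin (T ζ / b2) (B ζ) ?_ fun s hs hs0 => ?_
      · rcases not_and_or.1 h with h | h
        · exact Or.inl (div_ne_zero h hb2.ne')
        · exact Or.inr h
      · obtain ⟨r, -, hr⟩ := hr s hs
        have := (hrel w hw hζw s (Set.Ioo_subset_Icc_self hs) r hr).1
        rw [hTw w hw hζw, mul_zero, add_zero] at this
        refine mul_left_cancel₀ (div_ne_zero hs0 hb2.ne') ?_
        rw [mul_zero, ← this]; ring
    · push Not at h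
      obtain ⟨w, hw, hζw, h⟩ := h
      refine hfin (X ζ w / b2) (B w) ?_ fun s hs hs0 => ?_
      · by_cases hX : X ζ w = 0
        · exact Or.inr (h hX)
        · exact Or.inl (div_ne_zero hX hb2.ne')
      · obtain ⟨r, hr0, hr⟩ := hr s hs
        have := (mul_eq_zero.1
          (hrel w hw hζw s (Set.Ioo_subset_Icc_self hs) r hr).2).resolve_left hr0
        rw [← this]; ring

end Alternative

/-! ### Lie derivatives of metrics and forms -/

section LieDerivative

variable {n : ℕ} {g a : Coord n → Matrix (Fin n) (Fin n) ℝ} {p : Coord n → Fin n → ℝ}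
  {x v : Coord n} {W : Coord n →L[ℝ] Coord n}

/-- The Lie derivative `(L_V g)(y, z)` at `x` of the metric `g` along a vector field `V` with
value `v` and derivative `W` at `x`. -/
noncomputable def lieMetric (g : Coord n → Matrix (Fin n) (Fin n) ℝ) (x v : Coord n)
    (W : Coord n →L[ℝ] Coord n) (y z : Coord n) : ℝ :=
  innerAt (fun _ => Matrix.of fun i j => fderiv ℝ (fun z => g z i j) x v) x y z
    + innerAt g x (W y) z + innerAt g x y (W z)

/-- The Lie derivative `(L_V p)(y)` at `x` of the 1-form `p` along a vector field `V` with value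
`v` and derivative `W` at `x`. -/
noncomputable def lieForm (p : Coord n → Fin n → ℝ) (x v : Coord n)
    (W : Coord n →L[ℝ] Coord n) (y : Coord n) : ℝ :=
  ∑ i, (fderiv ℝ (fun z => p z i) x v * y i + p x i * W y i)

lemma lieMetric_quadratic (s t : ℝ) (y z : Coord n) :
    lieMetric g x v W (s • y + t • z) (s • y + t • z) = s ^ 2 * lieMetric g x v W y y
      + s * t * (lieMetric g x v W y z + lieMetric g x v W z y)
      + t ^ 2 * lieMetric g x v W z z := by
  simp only [lieMetric, map_add, map_smul, innerAt_add_left, innerAt_add_right, innerAt_smul_left,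
    innerAt_smul_right]
  ring

lemma lieForm_linear (s t : ℝ) (y z : Coord n) :
    lieForm p x v W (s • y + t • z) = s * lieForm p x v W y + t * lieForm p x v W z := by
  simp only [lieForm, map_add, map_smul, PiLp.add_apply, PiLp.smul_apply, smul_eq_mul,
    Finset.mul_sum, ← Finset.sum_add_distrib]
  exact Finset.sum_congr rfl fun _ _ => by ring

lemma hasDerivAt_comp_line {f : Coord n → ℝ} (hf : DifferentiableAt ℝ f x) :
    HasDerivAt (fun t : ℝ => f (x + t • v)) (fderiv ℝ f x v) 0 := by
  have h1 : HasDerivAt (fun t : ℝ => x + t • v) v 0 := by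
    simpa using ((hasDerivAt_id (0 : ℝ)).smul_const v).const_add x
  have h2 : HasFDerivAt f (fderiv ℝ f x) (x + (0 : ℝ) • v) := by simpa using hf.hasFDerivAt
  exact h2.comp_hasDerivAt (0 : ℝ) h1

lemma hasDerivAt_coord_line (y w : Coord n) (i : Fin n) :
    HasDerivAt (fun t : ℝ => (y + t • w) i) (w i) 0 := by
  simpa using ((hasDerivAt_id (0 : ℝ)).mul_const (w i)).const_add (y i)

/-- The derivative of `g(y, y)` along the complete lift of a vector field. -/
lemma hasDerivAt_innerAt (hg : ∀ i j, DifferentiableAt ℝ (fun z => g z i j) x) (y : Coord n) :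
    HasDerivAt (fun t : ℝ => innerAt g (x + t • v) (y + t • W y) (y + t • W y))
      (lieMetric g x v W y y) 0 := by
  have h := HasDerivAt.fun_sum (u := Finset.univ) fun i _ =>
    HasDerivAt.fun_sum (u := Finset.univ) fun j _ =>
    ((hasDerivAt_comp_line (v := v) (hg i j)).fun_mul (hasDerivAt_coord_line y (W y) i)).fun_mul
      (hasDerivAt_coord_line y (W y) j)
  refine h.congr_deriv ?_
  simp only [lieMetric, innerAt, ← Finset.sum_add_distrib, zero_smul, add_zero, Matrix.of_apply]
  exact Finset.sum_congr rfl fun _ _ => Finset.sum_congr rfl fun _ _ => by ring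

/-- The derivative of `p(y)` along the complete lift of a vector field. -/
lemma hasDerivAt_form (hp : ∀ i, DifferentiableAt ℝ (fun z => p z i) x) (y : Coord n) :
    HasDerivAt (fun t : ℝ => ∑ i, p (x + t • v) i * (y + t • W y) i) (lieForm p x v W y) 0 := by
  have h := HasDerivAt.fun_sum (u := Finset.univ) fun i _ =>
    (hasDerivAt_comp_line (v := v) (hp i)).fun_mul (hasDerivAt_coord_line y (W y) i)
  refine h.congr_deriv ?_
  simp only [lieForm, zero_smul, add_zero]

lemma tendsto_line (hs : Set (Coord n)) (hso : IsOpen hs) (hx : x ∈ hs) :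
    ∀ᶠ t : ℝ in 𝓝 0, x + t • v ∈ hs := by
  have hc : Continuous fun t : ℝ => x + t • v := by fun_prop
  exact hc.continuousAt.eventually_mem (hso.mem_nhds (by simpa using hx))

variable {s : Set (Coord n)}

/-- If `L_V α² = -4 c α²` and `L_V β = -2 c β`, then `V(b²) = 0`. -/
lemma fderiv_normSq_eq_zero (hs : IsOpen s) (hx : x ∈ s)
    (ha : ∀ i j, ContDiffOn ℝ ∞ (fun x => a x i j) s)
    (hsymm : ∀ x ∈ s, ∀ i j, a x i j = a x j i) (hdet : ∀ x ∈ s, (a x).det ≠ 0)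
    {b : Coord n → Fin n → ℝ} (hb : ∀ k, ContDiffOn ℝ ∞ (fun z => b z k) s) {c : ℝ}
    (hLa : ∀ y, lieMetric a x v W y y = -4 * c * innerAt a x y y)
    (hLb : ∀ y, lieForm b x v W y = -2 * c * ∑ i, b x i * y i) :
    fderiv ℝ (fun z => ∑ k, b z k * ∑ l, (a z)⁻¹ k l * b z l) x v = 0 := by
  set ζ : Coord n := WithLp.toLp 2 fun k => ∑ l, (a x)⁻¹ k l * b x l with hζ
  have hζk : ∀ k, ζ k = ∑ l, (a x)⁻¹ k l * b x l := fun k => rfl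
  have hbx : ∀ k, b x k = ∑ l, a x k l * ζ l := fun k =>
    (sum_mul_inv_mul (hdet x hx) (fun l => b x l) k).symm
  have hbζ : ∀ y : Coord n, ∑ i, b x i * y i = innerAt a x ζ y := by
    intro y
    simp only [hbx, innerAt, Finset.sum_mul]
    rw [Finset.sum_comm]
    refine Finset.sum_congr rfl fun i _ => Finset.sum_congr rfl fun j _ => ?_
    rw [hsymm x hx j i]
  have h1 := hLa ζ
  have h2 := hLb ζ
  rw [hbζ] at h2
  have hsplit : lieForm b x v W ζ =
      ∑ k, fderiv ℝ (fun z => b z k) x v * ζ k + ∑ i, b x i * W ζ i := by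
    rw [lieForm, Finset.sum_add_distrib]
  rw [hsplit, hbζ] at h2
  rw [lieMetric, innerAt_comm (hsymm x hx) (W ζ) ζ] at h1
  simp only [innerAt, Matrix.of_apply] at h1
  change _ + innerAt a x ζ (W ζ) + innerAt a x ζ (W ζ) = -4 * c * innerAt a x ζ ζ at h1
  rw [fderiv_eq_sum_pd]
  simp only [pd_sum_mul_inv_mul hs hx ha hsymm hdet hb hb hζk hζk]
  have e1 : ∀ k, fderiv ℝ (fun z => b z k) x v = ∑ i, v i * pd (fun z => b z k) i x := fun k =>
    fderiv_eq_sum_pd _ _ _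
  have e2 : ∀ k l, fderiv ℝ (fun z => a z k l) x v = ∑ i, v i * pd (fun z => a z k l) i x :=
    fun k l => fderiv_eq_sum_pd _ _ _
  have e3 : ∑ i, v i * (∑ k, pd (fun z => b z k) i x * ζ k + ∑ k, ζ k * pd (fun z => b z k) i x
      - ∑ k, ∑ l, pd (fun z => a z k l) i x * ζ k * ζ l) =
      2 * ∑ k, fderiv ℝ (fun z => b z k) x v * ζ k
        - ∑ k, ∑ l, fderiv ℝ (fun z => a z k l) x v * ζ k * ζ l := by
    simp only [e1, e2, mul_sub, mul_add, Finset.sum_sub_distrib, Finset.sum_add_distrib,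
      Finset.mul_sum, Finset.sum_mul]
    rw [Finset.sum_comm (f := fun i k => v i * (pd (fun z => b z k) i x * ζ k)),
      Finset.sum_comm (f := fun i k => v i * (ζ k * pd (fun z => b z k) i x)),
      ← Finset.sum_add_distrib]
    congr 1
    · refine Finset.sum_congr rfl fun k _ => ?_
      rw [← Finset.sum_add_distrib]
      exact Finset.sum_congr rfl fun i _ => by ring
    · rw [Finset.sum_comm]
      refine Finset.sum_congr rfl fun k _ => ?_
      rw [Finset.sum_comm]
      exact Finset.sum_congr rfl fun l _ => Finset.sum_congr rfl fun i _ => by ring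
  rw [e3]
  linarith

/-- At a point, an infinitesimal conformal transformation of `F = α φ(β/α)` acts on `α` and `β` by
the same scaling, or `φ² = 1 + k s²` for all values of `s` at that point. -/
theorem lie_alternative (hn : 2 ≤ n) (hs : IsOpen s) (hx : x ∈ s)
    (ha : ∀ i j, ContDiffOn ℝ ∞ (fun x => a x i j) s)
    (hsymm : ∀ x ∈ s, ∀ i j, a x i j = a x j i)
    (hpos : ∀ x ∈ s, ∀ y : Coord n, y ≠ 0 → 0 < innerAt a x y y)
    {b : Coord n → Fin n → ℝ} (hb : ∀ k, ContDiffOn ℝ ∞ (fun z => b z k) s)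
    {φ : ℝ → ℝ} {S : Set ℝ} (hS : IsOpen S) (hφ : ContDiffOn ℝ ∞ φ S) (hφ0 : φ 0 = 1)
    (hbS : ∀ y : Coord n, y ≠ 0 → (∑ i, b x i * y i) / √(innerAt a x y y) ∈ S)
    {F : Coord n → Coord n → ℝ} (hF : SmoothOffZero s F)
    (hFpos : ∀ y : Coord n, y ≠ 0 → 0 < F x y)
    (hom : ∀ x ∈ s, ∀ y, ∀ t : ℝ, 0 < t → F x (t • y) = t * F x y)
    (hdetF : ∀ x ∈ s, ∀ y : Coord n, y ≠ 0 → (fundamentalTensor F x y).det ≠ 0)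
    (hFeq : ∀ x ∈ s, ∀ y, F x y = √(innerAt a x y y) *
      φ ((∑ i, b x i * y i) / √(innerAt a x y y)))
    {ζ : Coord n} (hζ0 : ζ ≠ 0) (hζ : ∀ y, ∑ i, b x i * y i = innerAt a x ζ y)
    {V : Coord n → Coord n} (hV : DifferentiableAt ℝ V x) {c : ℝ}
    (hc : ∀ y : Coord n, y ≠ 0 → hCovDeriv00 F V x y = -2 * c * F x y ^ 2) :
    (∀ y, lieMetric a x (V x) (fderiv ℝ V x) y y = -4 * c * innerAt a x y y ∧
      lieForm b x (V x) (fderiv ℝ V x) y = -2 * c * ∑ i, b x i * y i) ∨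
    ∃ k : ℝ, ∀ s, s ^ 2 ≤ innerAt a x ζ ζ → φ s ^ 2 = 1 + k * s ^ 2 := by
  have hpx := hpos x hx
  -- the values of `β/α` fill the interval `[-b, b]`
  have hval : ∀ r : ℝ, r ^ 2 ≤ innerAt a x ζ ζ →
      ∃ y : Coord n, innerAt a x y y = 1 ∧ r = innerAt a x ζ y := by
    intro r hr
    obtain ⟨w, hw, hζw⟩ := exists_unit_orthogonal hn hpx ζ
    have hwζ : innerAt a x w ζ = 0 := by rw [innerAt_comm (hsymm x hx), hζw]
    have hb2 := hpx ζ hζ0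
    set b2 := innerAt a x ζ ζ with hb2_def
    have hq : 0 ≤ 1 - r ^ 2 / b2 := by rw [sub_nonneg, div_le_one hb2]; exact hr
    refine ⟨(r / b2) • ζ + √(1 - r ^ 2 / b2) • w, ?_, ?_⟩
    · rw [innerAt_add_left, innerAt_add_right, innerAt_add_right]
      simp only [innerAt_smul_left, innerAt_smul_right, hw, hζw, hwζ, ← hb2_def]
      have e1 : r / b2 * (r / b2 * b2) = r ^ 2 / b2 := by field_simp
      have e2 := Real.mul_self_sqrt hq
      linear_combination e1 + e2
    · rw [innerAt_add_right, innerAt_smul_right, innerAt_smul_right, hζw, ← hb2_def]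
      field_simp
      ring
  have hunit : ∀ y : Coord n, innerAt a x y y = 1 → y ≠ 0 := by
    rintro y hy rfl
    simp [innerAt] at hy
  have hrS : ∀ r : ℝ, r ^ 2 ≤ innerAt a x ζ ζ → r ∈ S := by
    intro r hr
    obtain ⟨y, hy, rfl⟩ := hval r hr
    have := hbS y (hunit y hy)
    rwa [hy, Real.sqrt_one, div_one, hζ] at this
  have hφpos : ∀ r : ℝ, r ^ 2 ≤ innerAt a x ζ ζ → 0 < φ r ^ 2 := by
    intro r hr
    obtain ⟨y, hy, rfl⟩ := hval r hr
    have := hFpos y (hunit y hy)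
    rw [hFeq x hx, hy, Real.sqrt_one, div_one, one_mul, hζ] at this
    positivity
  have hψ : ContDiffOn ℝ ∞ (fun s => φ s ^ 2) S := hφ.pow 2
  have halt := eq_zero_or_exists_eq_one_add_mul_sq (g := a) (x := x) hn (hsymm x hx) hpx hζ0 hS hψ
    hrS (by simp [hφ0]) hφpos
    (T := fun y => lieMetric a x (V x) (fderiv ℝ V x) y y + 4 * c * innerAt a x y y)
    (B := fun y => lieForm b x (V x) (fderiv ℝ V x) y + 2 * c * ∑ i, b x i * y i)
    (X := fun y z => lieMetric a x (V x) (fderiv ℝ V x) y z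
      + lieMetric a x (V x) (fderiv ℝ V x) z y + 8 * c * innerAt a x y z)
    (by
      intro s t y z
      simp only [lieMetric_quadratic, innerAt_add_left, innerAt_add_right, innerAt_smul_left,
        innerAt_smul_right, innerAt_comm (hsymm x hx) z y]
      ring)
    (by
      intro s t y z
      simp only [lieForm_linear, hζ, innerAt_add_right, innerAt_smul_right]
      ring)
    (by
      intro y hy r hr
      have hy0 := hunit y hy
      set v := V x with hv
      set W := fderiv ℝ V x with hW
      have hmain := hc y hy0
      rw [hCovDeriv00_eq hs hF hom hdetF hx hV hy0] at hmain
      -- `F² = α² φ(β/α)²` is differentiated along the complete lift in two ways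
      have hd1 : HasDerivAt (fun t : ℝ => F (x + t • v) (y + t • W y) ^ 2)
          (fderiv ℝ (fun p : Coord n × Coord n => F p.1 p.2 ^ 2) (x, y) (v, W y)) 0 := by
        have h2 : SmoothOffZero s (fun z w => F z w ^ 2) := ContDiffOn.pow hF 2
        have hl : HasDerivAt (fun t : ℝ => (x + t • v, y + t • W y)) (v, W y) 0 := by
          have e1 : HasDerivAt (fun t : ℝ => x + t • v) v 0 := by
            simpa using ((hasDerivAt_id (0 : ℝ)).smul_const v).const_add x
          have e2 : HasDerivAt (fun t : ℝ => y + t • W y) (W y) 0 := by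
            simpa using ((hasDerivAt_id (0 : ℝ)).smul_const (W y)).const_add y
          exact e1.prodMk e2
        have h3 : HasFDerivAt (fun p : Coord n × Coord n => F p.1 p.2 ^ 2)
            (fderiv ℝ (fun p : Coord n × Coord n => F p.1 p.2 ^ 2) (x, y))
            (x + (0 : ℝ) • v, y + (0 : ℝ) • W y) := by
          simpa using (h2.differentiableAt hs hx hy0).hasFDerivAt
        exact h3.comp_hasDerivAt (0 : ℝ) hl
      have hA := hasDerivAt_innerAt (v := v) (W := W)
        (fun i j => differentiableAt_of_contDiffOn hs (ha i j) hx) y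
      have hβ := hasDerivAt_form (v := v) (W := W)
        (fun i => differentiableAt_of_contDiffOn hs (hb i) hx) y
      have hA0 : innerAt a (x + (0 : ℝ) • v) (y + (0 : ℝ) • W y) (y + (0 : ℝ) • W y) = 1 := by
        simpa using hy
      have hβ0 : ∑ i, b (x + (0 : ℝ) • v) i * (y + (0 : ℝ) • W y) i = r := by
        simp only [zero_smul, add_zero, hζ, hr]
      have hsq := hA.sqrt (by rw [hA0]; exact one_ne_zero)
      have hquot := hβ.fun_div hsq (by simp only [hA0, Real.sqrt_one]; exact one_ne_zero)
      have hrr : r ^ 2 ≤ innerAt a x ζ ζ := by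
        have h1 : 0 ≤ innerAt a x (ζ - r • y) (ζ - r • y) := by
          by_cases h0 : ζ - r • y = 0
          · rw [h0]; simp [innerAt]
          · exact (hpx _ h0).le
        have h2 : ζ - r • y = (1 : ℝ) • ζ + (-r) • y := by simp [sub_eq_add_neg]
        rw [h2] at h1
        simp only [innerAt_add_left, innerAt_add_right, innerAt_smul_left, innerAt_smul_right,
          innerAt_comm (hsymm x hx) y ζ, ← hr, hy] at h1
        linarith
      have hψd : HasDerivAt (fun s => φ s ^ 2) (deriv (fun s => φ s ^ 2) r)
          ((∑ i, b (x + (0 : ℝ) • v) i * (y + (0 : ℝ) • W y) i) /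
            √(innerAt a (x + (0 : ℝ) • v) (y + (0 : ℝ) • W y) (y + (0 : ℝ) • W y))) := by
        rw [hA0, hβ0, Real.sqrt_one, div_one]
        exact ((hψ.contDiffAt (hS.mem_nhds (hrS r hrr))).differentiableAt (by simp)).hasDerivAt
      have hd2 := hA.fun_mul (hψd.comp (0 : ℝ) hquot)
      have heq : (fun t : ℝ => F (x + t • v) (y + t • W y) ^ 2) =ᶠ[𝓝 0] fun t : ℝ =>
          innerAt a (x + t • v) (y + t • W y) (y + t • W y) *
          ((fun s => φ s ^ 2) ∘ fun t : ℝ => (∑ i, b (x + t • v) i * (y + t • W y) i) /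
            √(innerAt a (x + t • v) (y + t • W y) (y + t • W y))) t := by
        filter_upwards [tendsto_line (v := v) s hs hx] with t ht
        have h0 : 0 ≤ innerAt a (x + t • v) (y + t • W y) (y + t • W y) := by
          by_cases h0 : y + t • W y = 0
          · rw [h0]; simp [innerAt]
          · exact (hpos _ ht _ h0).le
        rw [hFeq _ ht, mul_pow, Real.sq_sqrt h0]
        rfl
      have hder := hd1.unique (hd2.congr_of_eventuallyEq heq)
      simp only [Function.comp_apply, hA0, hβ0, Real.sqrt_one, div_one, one_pow, mul_one,
        one_mul] at hder
      have hFx : F x y ^ 2 = φ r ^ 2 := by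
        rw [hFeq x hx, hy, Real.sqrt_one, div_one, one_mul, hζ, hr]
      rw [hder, hFx] at hmain
      simp only [hy, hζ, ← hr]
      linear_combination 2 * hmain)
  refine halt.imp (fun h y => ⟨?_, ?_⟩) id
  · have := (h y).1; linarith
  · have := (h y).2; linarith

end LieDerivative

/-! ### The model metric `2 |y| / (1 + μ |x|²)` -/

section Model

variable {n : ℕ} {H a : Coord n → Matrix (Fin n) (Fin n) ℝ} {p : Coord n → Fin n → ℝ}
  {x v : Coord n} {W : Coord n →L[ℝ] Coord n} {s : Set (Coord n)} {μ c : ℝ}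

/-- The conformal factor of the model metric. -/
noncomputable def modelFactor (μ : ℝ) (x : Coord n) : ℝ := (2 / (1 + μ * ‖x‖ ^ 2)) ^ 2

lemma hasDerivAt_modelFactor (hx : 1 + μ * ‖x‖ ^ 2 ≠ 0) :
    HasDerivAt (fun t : ℝ => modelFactor μ (x + t • v))
      (-(4 * μ * ⟪x, v⟫_ℝ / (1 + μ * ‖x‖ ^ 2)) * modelFactor μ x) 0 := by
  have h1 : HasDerivAt (fun t : ℝ => x + t • v) v 0 := by
    simpa using ((hasDerivAt_id (0 : ℝ)).smul_const v).const_add x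
  have h2 : HasDerivAt (fun t : ℝ => 1 + μ * ‖x + t • v‖ ^ 2) (μ * (2 * ⟪x, v⟫_ℝ)) 0 := by
    simpa using (h1.norm_sq.const_mul μ).const_add 1
  have h3 := ((hasDerivAt_const (0 : ℝ) (2 : ℝ)).fun_div h2 (by simpa using hx)).fun_pow 2
  refine h3.congr_deriv ?_
  simp only [modelFactor, zero_smul, add_zero]
  generalize 1 + μ * ‖x‖ ^ 2 = D at hx
  norm_num
  field_simp
  ring

lemma modelFactor_pos (hx : 0 < 1 + μ * ‖x‖ ^ 2) : 0 < modelFactor μ x := by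
  unfold modelFactor; positivity

lemma contDiffOn_modelFactor (hs : ∀ x ∈ s, 1 + μ * ‖x‖ ^ 2 ≠ 0) :
    ContDiffOn ℝ ∞ (modelFactor μ : Coord n → ℝ) s := by
  have h : ContDiffOn ℝ ∞ (fun x : Coord n => 1 + μ * ‖x‖ ^ 2) s :=
    (contDiff_const.add (contDiff_const.mul (contDiff_norm_sq ℝ))).contDiffOn
  exact (contDiffOn_const.div h hs).pow 2

/-- A vector field that rescales the model metric is conformal for the Euclidean metric. -/
lemma inner_apply_of_lieMetric_model (hs : IsOpen s) (hx : x ∈ s)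
    (hpos : ∀ x ∈ s, 0 < 1 + μ * ‖x‖ ^ 2)
    (hH : ∀ i j, DifferentiableAt ℝ (fun z => H z i j) x)
    (hmodel : ∀ x ∈ s, ∀ y, innerAt H x y y = modelFactor μ x * ‖y‖ ^ 2)
    (hL : ∀ y, lieMetric H x v W y y = -4 * c * innerAt H x y y) (y : Coord n) :
    ⟪y, W y⟫_ℝ = (-2 * c + 2 * μ * ⟪x, v⟫_ℝ / (1 + μ * ‖x‖ ^ 2)) * ‖y‖ ^ 2 := by
  have h1 := hasDerivAt_innerAt (v := v) (W := W) hH y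
  have hy : HasDerivAt (fun t : ℝ => y + t • W y) (W y) 0 := by
    simpa using ((hasDerivAt_id (0 : ℝ)).smul_const (W y)).const_add y
  have h2 := (hasDerivAt_modelFactor (v := v) (hpos x hx).ne').fun_mul hy.norm_sq
  have h3 := h1.unique (h2.congr_of_eventuallyEq (by
    filter_upwards [tendsto_line (v := v) s hs hx] with t ht using hmodel _ ht _))
  rw [hL, hmodel x hx] at h3
  simp only [zero_smul, add_zero] at h3
  have hE := modelFactor_pos (hpos x hx)
  refine mul_left_cancel₀ hE.ne' ?_
  linear_combination -h3 / 2

/-- The bracket relation satisfied by a vector field that rescales the model metric and a form. -/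
lemma bracket_eq_of_lieForm_model (hs : IsOpen s) (hx : x ∈ s)
    (hpos : ∀ x ∈ s, 0 < 1 + μ * ‖x‖ ^ 2)
    (hp : ∀ i, DifferentiableAt ℝ (fun z => p z i) x) {ξ : Coord n → Coord n}
    (hξ : DifferentiableAt ℝ ξ x)
    (hmodel : ∀ x ∈ s, ∀ y, ∑ i, p x i * y i = modelFactor μ x * ⟪ξ x, y⟫_ℝ)
    (hW : ∀ y, ⟪y, W y⟫_ℝ = (-2 * c + 2 * μ * ⟪x, v⟫_ℝ / (1 + μ * ‖x‖ ^ 2)) * ‖y‖ ^ 2)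
    (hL : ∀ y, lieForm p x v W y = -2 * c * ∑ i, p x i * y i) :
    fderiv ℝ ξ x v - W (ξ x) = (2 * c) • ξ x := by
  have hpol : ∀ y, ⟪ξ x, W y⟫_ℝ + ⟪W (ξ x), y⟫_ℝ =
      2 * (-2 * c + 2 * μ * ⟪x, v⟫_ℝ / (1 + μ * ‖x‖ ^ 2)) * ⟪ξ x, y⟫_ℝ := by
    intro y
    have e := hW (ξ x + y)
    rw [map_add, inner_add_left, inner_add_right, inner_add_right, norm_add_sq_real, hW, hW,
      real_inner_comm (W (ξ x)) y] at e
    linear_combination e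
  refine ext_inner_right ℝ fun y => ?_
  have h1 := hasDerivAt_form (v := v) (W := W) hp y
  have hl : HasDerivAt (fun t : ℝ => x + t • v) v 0 := by
    simpa using ((hasDerivAt_id (0 : ℝ)).smul_const v).const_add x
  have hξl : HasDerivAt (fun t : ℝ => ξ (x + t • v)) (fderiv ℝ ξ x v) 0 := by
    have h2 : HasFDerivAt ξ (fderiv ℝ ξ x) (x + (0 : ℝ) • v) := by simpa using hξ.hasFDerivAt
    exact h2.comp_hasDerivAt (0 : ℝ) hl
  have hy : HasDerivAt (fun t : ℝ => y + t • W y) (W y) 0 := by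
    simpa using ((hasDerivAt_id (0 : ℝ)).smul_const (W y)).const_add y
  have h2 := (hasDerivAt_modelFactor (v := v) (hpos x hx).ne').fun_mul (hξl.inner ℝ hy)
  have h3 := h1.unique (h2.congr_of_eventuallyEq (by
    filter_upwards [tendsto_line (v := v) s hs hx] with t ht using hmodel _ ht _))
  rw [hL, hmodel x hx] at h3
  simp only [zero_smul, add_zero] at h3
  have hE := modelFactor_pos (hpos x hx)
  refine mul_left_cancel₀ hE.ne' ?_
  rw [inner_sub_left, real_inner_smul_left]
  linear_combination -h3 - modelFactor μ x * hpol y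

/-- The scaling of `α` and `β` is inherited by `h = √(u(b²) α² + v(b²) β²)`. -/
lemma lieMetric_of_lieMetric_add {b : Coord n → Fin n → ℝ} {B : Coord n → ℝ} {u w : ℝ → ℝ}
    {S : Set ℝ} (hS : IsOpen S) (hu : ContDiffOn ℝ ∞ u S) (hw : ContDiffOn ℝ ∞ w S)
    (hs : IsOpen s) (hx : x ∈ s) (hBS : B x ∈ S) (hB : DifferentiableAt ℝ B x)
    (hB0 : fderiv ℝ B x v = 0)
    (ha : ∀ i j, DifferentiableAt ℝ (fun z => a z i j) x)
    (hb : ∀ i, DifferentiableAt ℝ (fun z => b z i) x)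
    (hH : ∀ i j, DifferentiableAt ℝ (fun z => H z i j) x)
    (heq : ∀ x ∈ s, ∀ y, innerAt H x y y =
      u (B x) * innerAt a x y y + w (B x) * (∑ i, b x i * y i) ^ 2)
    (hLa : ∀ y, lieMetric a x v W y y = -4 * c * innerAt a x y y)
    (hLb : ∀ y, lieForm b x v W y = -2 * c * ∑ i, b x i * y i) (y : Coord n) :
    lieMetric H x v W y y = -4 * c * innerAt H x y y := by
  have hcomp : ∀ u : ℝ → ℝ, ContDiffOn ℝ ∞ u S →
      HasDerivAt (fun t : ℝ => u (B (x + t • v))) 0 0 := by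
    intro u hu
    have h1 := hasDerivAt_comp_line (v := v) hB
    rw [hB0] at h1
    have h2 : HasDerivAt u (deriv u (B x)) (B (x + (0 : ℝ) • v)) := by
      simpa using ((hu.contDiffAt (hS.mem_nhds hBS)).differentiableAt (by simp)).hasDerivAt
    have h3 := h2.comp (0 : ℝ) h1
    rw [mul_zero] at h3
    exact h3
  have h1 := hasDerivAt_innerAt (v := v) (W := W) hH y
  have h2 := ((hcomp u hu).fun_mul (hasDerivAt_innerAt (v := v) (W := W) ha y)).fun_add
    ((hcomp w hw).fun_mul ((hasDerivAt_form (v := v) (W := W) hb y).fun_pow 2))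
  have h3 := h1.unique (h2.congr_of_eventuallyEq (by
    filter_upwards [tendsto_line (v := v) s hs hx] with t ht using heq _ ht _))
  rw [h3, heq x hx, hLa, hLb]
  simp only [zero_smul, add_zero]
  push_cast
  ring

/-- The scaling of `β` is inherited by `ρ = w(b²) β`. -/
lemma lieForm_of_lieForm_mul {b : Coord n → Fin n → ℝ} {B : Coord n → ℝ} {w : ℝ → ℝ}
    {S : Set ℝ} (hS : IsOpen S) (hw : ContDiffOn ℝ ∞ w S)
    (hs : IsOpen s) (hx : x ∈ s) (hBS : B x ∈ S) (hB : DifferentiableAt ℝ B x)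
    (hB0 : fderiv ℝ B x v = 0)
    (hb : ∀ i, DifferentiableAt ℝ (fun z => b z i) x)
    (hp : ∀ i, DifferentiableAt ℝ (fun z => p z i) x)
    (heq : ∀ x ∈ s, ∀ y : Coord n, ∑ i, p x i * y i = w (B x) * ∑ i, b x i * y i)
    (hLb : ∀ y, lieForm b x v W y = -2 * c * ∑ i, b x i * y i) (y : Coord n) :
    lieForm p x v W y = -2 * c * ∑ i, p x i * y i := by
  have hcomp : HasDerivAt (fun t : ℝ => w (B (x + t • v))) 0 0 := by
    have h1 := hasDerivAt_comp_line (v := v) hB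
    rw [hB0] at h1
    have h2 : HasDerivAt w (deriv w (B x)) (B (x + (0 : ℝ) • v)) := by
      simpa using ((hw.contDiffAt (hS.mem_nhds hBS)).differentiableAt (by simp)).hasDerivAt
    have h3 := h2.comp (0 : ℝ) h1
    rw [mul_zero] at h3
    exact h3
  have h1 := hasDerivAt_form (v := v) (W := W) hp y
  have h2 := hcomp.fun_mul (hasDerivAt_form (v := v) (W := W) hb y)
  have h3 := h1.unique (h2.congr_of_eventuallyEq (by
    filter_upwards [tendsto_line (v := v) s hs hx] with t ht using heq _ ht _))
  rw [h3, heq x hx, hLb]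
  simp only [zero_smul, add_zero]
  ring

/-- The symmetrized covariant derivative of a 1-form `p` with respect to the model metric, in terms
of the Euclidean dual `ξ` of `p / modelFactor`. Consequently `p` is conformal for the model metric
when `ξ` is a conformal vector field of Euclidean space, and conversely. -/
lemma formCovDeriv_add_model (hs : IsOpen s) (hx : x ∈ s) (hpos : ∀ x ∈ s, 0 < 1 + μ * ‖x‖ ^ 2)
    (hmodel : ∀ x ∈ s, ∀ i j, H x i j = modelFactor μ x * if i = j then 1 else 0)
    {ξ : Coord n → Coord n} (hξ : DifferentiableAt ℝ ξ x)
    (hp : ∀ x ∈ s, ∀ i, p x i = modelFactor μ x * ξ x i) (i j : Fin n) :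
    formCovDeriv H p i j x + formCovDeriv H p j i x =
      modelFactor μ x * (pd (fun z => ξ z i) j x + pd (fun z => ξ z j) i x)
        + (if i = j then 1 else 0) * ∑ k, pd (modelFactor μ) k x * ξ x k := by
  have hE0 := (modelFactor_pos (hpos x hx)).ne'
  have hE : DifferentiableAt ℝ (modelFactor μ : Coord n → ℝ) x :=
    differentiableAt_of_contDiffOn hs (contDiffOn_modelFactor fun x hx => (hpos x hx).ne') hx
  have hξi : ∀ i, DifferentiableAt ℝ (fun z => ξ z i) x := fun i =>
    (EuclideanSpace.proj (𝕜 := ℝ) i : Coord n →L[ℝ] ℝ).differentiableAt.comp x hξ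
  have hpdH : ∀ i j k, pd (fun z => H z i j) k x =
      pd (modelFactor μ) k x * if i = j then 1 else 0 := by
    intro i j k
    rw [pd_congr_of_mem hs hx fun z hz => hmodel z hz i j, pd_mul hE (differentiableAt_const _),
      pd_const]
    ring
  have hinv : (H x)⁻¹ = (modelFactor μ x)⁻¹ • (1 : Matrix (Fin n) (Fin n) ℝ) := by
    have : H x = modelFactor μ x • (1 : Matrix (Fin n) (Fin n) ℝ) := by
      ext i j; rw [hmodel x hx, Matrix.smul_apply, Matrix.one_apply, smul_eq_mul]
    rw [this]
    refine Matrix.inv_eq_right_inv ?_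
    rw [Matrix.smul_mul, Matrix.mul_smul, smul_smul, mul_one, mul_inv_cancel₀ hE0, one_smul]
  have hΓ : ∀ i j, ∑ k, christoffel H k i j x * p x k = 1 / 2 * (pd (modelFactor μ) i x * ξ x j
      + pd (modelFactor μ) j x * ξ x i
      - (if i = j then 1 else 0) * ∑ k, pd (modelFactor μ) k x * ξ x k) := by
    intro i j
    have h1 : ∀ k, christoffel H k i j x * p x k = 1 / 2 * ((pd (modelFactor μ) i x *
        (if k = j then 1 else 0) + pd (modelFactor μ) j x * (if i = k then 1 else 0)
        - pd (modelFactor μ) k x * if i = j then 1 else 0) * ξ x k) := by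
      intro k
      simp only [christoffel, hinv, hpdH, Matrix.smul_apply, Matrix.one_apply, smul_eq_mul,
        mul_ite, mul_one, mul_zero, ite_mul, zero_mul, Finset.sum_ite_eq, Finset.mem_univ, if_true]
      rw [hp x hx k]
      field_simp
    simp only [h1, ← Finset.mul_sum]
    congr 1
    simp only [add_mul, sub_mul, Finset.sum_add_distrib, Finset.sum_sub_distrib, mul_ite, mul_one,
      mul_zero, ite_mul, zero_mul, Finset.sum_ite_eq, Finset.sum_ite_eq', Finset.mem_univ, if_true,
      one_mul]
    split_ifs <;> simp
  have hpd : ∀ i j, pd (fun z => p z i) j x =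
      pd (modelFactor μ) j x * ξ x i + modelFactor μ x * pd (fun z => ξ z i) j x := by
    intro i j
    rw [pd_congr_of_mem hs hx fun z hz => hp z hz i, pd_mul hE (hξi i)]
  simp only [formCovDeriv, hΓ, hpd, eq_comm (a := j) (b := i)]
  ring

end Model

/-! ### Metrics and forms in charts -/

section Charts
open Metric Set

variable {n : ℕ} {M : Type*} [TopologicalSpace M] [ChartedSpace (Coord n) M]
  [IsManifold 𝓘(ℝ, Coord n) ∞ M] {κ : OpenPartialHomeomorph M (Coord n)} {h : RiemMetric n M}
  {β ρ : ∀ x : M, TangentSpace 𝓘(ℝ, Coord n) x →L[ℝ] ℝ} {x : Coord n} {μ : ℝ}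

lemma metricInChart_symm (h : RiemMetric n M) (κ : OpenPartialHomeomorph M (Coord n))
    (x : Coord n) (i j : Fin n) : metricInChart h κ x i j = metricInChart h κ x j i :=
  h.symm _ _ _

lemma innerAt_metricInChart_pos (hκ : κ ∈ charts n M) (hx : x ∈ κ.target) (h : RiemMetric n M)
    {y : Coord n} (hy : y ≠ 0) : 0 < innerAt (metricInChart h κ) x y y := by
  rw [← inner_tangentOf]
  exact h.pos _ _ fun h0 => hy ((tangentOf_eq_zero_iff hκ hx y).1 h0)

lemma innerAt_metricInChart_nonneg (hκ : κ ∈ charts n M) (hx : x ∈ κ.target) (h : RiemMetric n M)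
    (y : Coord n) : 0 ≤ innerAt (metricInChart h κ) x y y := by
  by_cases hy : y = 0
  · rw [hy]; simp [innerAt]
  · exact (innerAt_metricInChart_pos hκ hx h hy).le

lemma metricInChart_posDef (hκ : κ ∈ charts n M) (hx : x ∈ κ.target) (h : RiemMetric n M) :
    (metricInChart h κ x).PosDef := by
  refine Matrix.PosDef.of_dotProduct_mulVec_pos ?_ fun y hy => ?_
  · ext i j; simpa using metricInChart_symm h κ x j i
  · have h1 := innerAt_metricInChart_pos hκ hx h (y := WithLp.toLp 2 y) (by simpa using hy)
    have h2 : innerAt (metricInChart h κ) x (WithLp.toLp 2 y) (WithLp.toLp 2 y) =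
        y ⬝ᵥ (metricInChart h κ x *ᵥ y) := by
      simp only [innerAt, dotProduct, Matrix.mulVec, Finset.mul_sum]
      exact Finset.sum_congr rfl fun _ _ => Finset.sum_congr rfl fun _ _ => by ring
    rwa [star_trivial, ← h2]

lemma metricInChart_det_ne_zero (hκ : κ ∈ charts n M) (hx : x ∈ κ.target) (h : RiemMetric n M) :
    (metricInChart h κ x).det ≠ 0 := (metricInChart_posDef hκ hx h).det_pos.ne'

/-- The vector dual to a 1-form with respect to a metric, in a chart. -/
noncomputable def dualInChart (h : RiemMetric n M)
    (β : ∀ x : M, TangentSpace 𝓘(ℝ, Coord n) x →L[ℝ] ℝ)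
    (κ : OpenPartialHomeomorph M (Coord n)) (x : Coord n) : Coord n :=
  WithLp.toLp 2 fun k => ∑ l, (metricInChart h κ x)⁻¹ k l * formInChart β κ x l

lemma sum_formInChart_eq (hκ : κ ∈ charts n M) (hx : x ∈ κ.target) (y : Coord n) :
    ∑ i, formInChart β κ x i * y i = innerAt (metricInChart h κ) x (dualInChart h β κ x) y := by
  have hbx : ∀ k, formInChart β κ x k = ∑ l, metricInChart h κ x k l * dualInChart h β κ x l :=
    fun k => (sum_mul_inv_mul (metricInChart_det_ne_zero hκ hx h)
      (fun l => formInChart β κ x l) k).symm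
  simp only [innerAt]
  rw [Finset.sum_comm]
  refine Finset.sum_congr rfl fun i _ => ?_
  rw [hbx, Finset.sum_mul]
  refine Finset.sum_congr rfl fun j _ => ?_
  rw [metricInChart_symm h κ x j i]

lemma innerAt_sq_le (hκ : κ ∈ charts n M) (hx : x ∈ κ.target) (h : RiemMetric n M)
    (y z : Coord n) : innerAt (metricInChart h κ) x y z ^ 2 ≤
      innerAt (metricInChart h κ) x y y * innerAt (metricInChart h κ) x z z := by
  by_cases hz : z = 0
  · rw [hz]; simp [innerAt]
  have hzz := innerAt_metricInChart_pos hκ hx h hz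
  have h1 := innerAt_metricInChart_nonneg hκ hx h
    (innerAt (metricInChart h κ) x z z • y + (-innerAt (metricInChart h κ) x y z) • z)
  simp only [innerAt_add_left, innerAt_add_right, innerAt_smul_left, innerAt_smul_right,
    innerAt_comm (metricInChart_symm h κ x) z y] at h1
  have h2 : 0 ≤ innerAt (metricInChart h κ) x z z * (innerAt (metricInChart h κ) x y y *
      innerAt (metricInChart h κ) x z z - innerAt (metricInChart h κ) x y z ^ 2) := by linarith
  have := nonneg_of_mul_nonneg_right h2 hzz
  linarith

lemma formNormSq_eq_innerAt (hκ : κ ∈ charts n M) (hx : x ∈ κ.target) :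
    formNormSq h β (κ.symm x) =
      innerAt (metricInChart h κ) x (dualInChart h β κ x) (dualInChart h β κ x) := by
  set ζ := dualInChart h β κ x with hζ
  set B := innerAt (metricInChart h κ) x ζ ζ with hB
  have hB0 : 0 ≤ B := innerAt_metricInChart_nonneg hκ hx h ζ
  have hform : ∀ y, β (κ.symm x) (tangentOf κ x y) = innerAt (metricInChart h κ) x ζ y :=
      fun y => by
    rw [form_tangentOf, sum_formInChart_eq hκ hx]
  refine IsGreatest.csSup_eq ⟨⟨tangentOf κ x ((√B)⁻¹ • ζ), ?_, ?_⟩, ?_⟩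
  · rw [inner_tangentOf, innerAt_smul_left, innerAt_smul_right, ← hB, ← div_eq_inv_mul B,
      Real.div_sqrt]
    exact inv_mul_le_one
  · rw [hform, innerAt_smul_right, ← hB, ← div_eq_inv_mul, Real.div_sqrt, Real.sq_sqrt hB0]
  · rintro t ⟨w, hw, rfl⟩
    obtain ⟨y, rfl⟩ := tangentOf_surjective hκ hx w
    rw [inner_tangentOf] at hw
    rw [hform]
    have := innerAt_sq_le hκ hx h ζ y
    exact this.trans (mul_le_of_le_one_right hB0 hw)

lemma formNormSq_eq_sum (hκ : κ ∈ charts n M) (hx : x ∈ κ.target) :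
    formNormSq h β (κ.symm x) = ∑ k, formInChart β κ x k *
      ∑ l, (metricInChart h κ x)⁻¹ k l * formInChart β κ x l := by
  rw [formNormSq_eq_innerAt hκ hx, ← sum_formInChart_eq hκ hx]
  rfl

lemma form_ne_zero_iff (hκ : κ ∈ charts n M) (hx : x ∈ κ.target) :
    β (κ.symm x) = 0 ↔ dualInChart h β κ x = 0 := by
  constructor
  · intro h0
    by_contra hne
    have := innerAt_metricInChart_pos hκ hx h hne
    rw [← sum_formInChart_eq hκ hx, ← form_tangentOf, h0] at this
    simp at this
  · intro h0
    ext w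
    obtain ⟨y, rfl⟩ := tangentOf_surjective hκ hx w
    rw [form_tangentOf, sum_formInChart_eq (h := h) hκ hx, h0]
    simp [innerAt]

lemma exists_chart (z : M) : ∃ κ ∈ charts n M, z ∈ κ.source :=
  ⟨chartAt (Coord n) z, IsManifold.chart_mem_maximalAtlas z, mem_chart_source _ z⟩

lemma ratio_sq_le (z : M) (y : TangentSpace 𝓘(ℝ, Coord n) z) :
    ratio h β z y ^ 2 ≤ formNormSq h β z := by
  obtain ⟨κ, hκ, hz⟩ := exists_chart (n := n) z
  obtain ⟨x, hx, rfl⟩ : ∃ x ∈ κ.target, z = κ.symm x :=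
    ⟨κ z, κ.map_source hz, (κ.left_inv hz).symm⟩
  obtain ⟨y, rfl⟩ := tangentOf_surjective hκ hx y
  rw [ratio, inner_tangentOf, form_tangentOf, sum_formInChart_eq (h := h) hκ hx,
    formNormSq_eq_innerAt hκ hx, div_pow, Real.sq_sqrt (innerAt_metricInChart_nonneg hκ hx h y)]
  refine div_le_of_le_mul₀ (innerAt_metricInChart_nonneg hκ hx h y)
    (innerAt_metricInChart_nonneg hκ hx h _) (innerAt_sq_le hκ hx h _ y)

/-! ### Coordinates in which `h` has the model form -/

lemma MetricHasForm.pos (hn : 1 ≤ n) (hκ : κ ∈ charts n M) (hm : MetricHasForm h κ μ)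
    (hx : x ∈ κ.target) : 0 < 1 + μ * ‖x‖ ^ 2 := by
  have hb : (basisVec (⟨0, hn⟩ : Fin n) : Coord n) ≠ 0 := by simp
  have h1 := hm x hx (basisVec ⟨0, hn⟩)
  rw [inner_tangentOf, PiLp.norm_single, norm_one, mul_one] at h1
  have h2 := Real.sqrt_pos.2 (innerAt_metricInChart_pos hκ hx h hb)
  rw [h1] at h2
  by_contra hneg
  exact absurd h2 (not_lt.2 (div_nonpos_of_nonneg_of_nonpos zero_le_two (not_lt.1 hneg)))

lemma MetricHasForm.innerAt_eq (hκ : κ ∈ charts n M) (hm : MetricHasForm h κ μ)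
    (hx : x ∈ κ.target) (y : Coord n) :
    innerAt (metricInChart h κ) x y y = modelFactor μ x * ‖y‖ ^ 2 := by
  have h1 := hm x hx y
  rw [inner_tangentOf] at h1
  rw [← Real.sq_sqrt (innerAt_metricInChart_nonneg hκ hx h y), h1, mul_pow, modelFactor]

lemma MetricHasForm.apply_eq (hκ : κ ∈ charts n M) (hm : MetricHasForm h κ μ)
    (hx : x ∈ κ.target) (i j : Fin n) :
    metricInChart h κ x i j = modelFactor μ x * if i = j then 1 else 0 := by
  have h1 := hm.innerAt_eq hκ hx (basisVec i + basisVec j)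
  rw [innerAt_add_left, innerAt_add_right, innerAt_add_right,
    innerAt_comm (metricInChart_symm h κ x) (basisVec j) (basisVec i), hm.innerAt_eq hκ hx,
    hm.innerAt_eq hκ hx, norm_add_sq_real, innerAt_basisVec, inner_basisVec] at h1
  have h2 : (basisVec i : Coord n) j = if i = j then 1 else 0 := by simp [eq_comm]
  rw [h2] at h1
  linarith

omit [IsManifold 𝓘(ℝ, Coord n) ∞ M] in
lemma formHasForm_iff {l : ℝ} {d e : Coord n} {P : Matrix (Fin n) (Fin n) ℝ} :
    FormHasForm ρ κ μ l d e P ↔ ∀ x ∈ κ.target, ∀ y : Coord n,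
      ∑ i, formInChart ρ κ x i * y i = modelFactor μ x * ⟪confField l d P e x, y⟫_ℝ := by
  refine forall_congr' fun x => forall_congr' fun _ => forall_congr' fun y => ?_
  rw [form_tangentOf]
  have h1 : modelFactor μ x = 4 / (1 + μ * ‖x‖ ^ 2) ^ 2 := by
    rw [modelFactor, div_pow]; norm_num
  rw [h1]
  simp only [confField, inner_add_left, real_inner_smul_left]

omit [ChartedSpace (Coord n) M] [IsManifold 𝓘(ℝ, Coord n) ∞ M] in
lemma isPreconnected_target (hc : IsConnected κ.source) : IsPreconnected κ.target := by
  rw [← κ.image_source_eq_target]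
  exact hc.isPreconnected.image _ κ.continuousOn

/-- A conformal 1-form of the model metric is given by a conformal vector field of `ℝⁿ`. -/
theorem exists_formHasForm (hn : 3 ≤ n) (hκ : κ ∈ charts n M) (hc : IsConnected κ.source)
    (hm : MetricHasForm h κ μ) (hconf : IsConformalForm h ρ) :
    ∃ (l : ℝ) (d e : Coord n) (P : Matrix (Fin n) (Fin n) ℝ), Pᵀ = -P ∧
      FormHasForm ρ κ μ l d e P := by
  have hpos : ∀ x ∈ κ.target, 0 < 1 + μ * ‖x‖ ^ 2 := fun x hx => hm.pos (by omega) hκ hx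
  obtain ⟨θ, hθ⟩ := hconf.conformal
  set ξ : Coord n → Coord n := fun x =>
    WithLp.toLp 2 fun i => (modelFactor μ x)⁻¹ * formInChart ρ κ x i with hξ
  have hE : ContDiffOn ℝ ∞ (modelFactor μ : Coord n → ℝ) κ.target :=
    contDiffOn_modelFactor fun x hx => (hpos x hx).ne'
  have hξs : ContDiffOn ℝ ∞ ξ κ.target := contDiffOn_coord_iff.2 fun i =>
    (hE.inv fun x hx => (modelFactor_pos (hpos x hx)).ne').mul (hconf.smooth κ hκ i)
  have hp : ∀ x ∈ κ.target, ∀ i, formInChart ρ κ x i = modelFactor μ x * ξ x i := by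
    intro x hx i
    simp only [hξ]
    rw [mul_inv_cancel_left₀ (modelFactor_pos (hpos x hx)).ne']
  obtain ⟨l, d, e, P, hP, hPx⟩ := exists_eq_confField hn κ.open_target
    (isPreconnected_target hc) hξs
    (σ := fun x => -2 * θ (κ.symm x)
      - (∑ k, pd (modelFactor μ) k x * ξ x k) / (2 * modelFactor μ x))
    (by
      intro x hx i j
      have h1 := hθ κ hκ x hx i j
      have hE0 := (modelFactor_pos (hpos x hx)).ne'
      rw [formCovDeriv_add_model κ.open_target hx hpos (fun x hx => hm.apply_eq hκ hx)
        (differentiableAt_of_contDiffOn κ.open_target hξs hx) hp, hm.apply_eq hκ hx] at h1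
      refine mul_left_cancel₀ hE0 ?_
      field_simp
      linarith)
  refine ⟨l, d, e, P, hP, formHasForm_iff.2 fun x hx y => ?_⟩
  rw [← hPx x hx, inner_eq_sum, Finset.mul_sum]
  exact Finset.sum_congr rfl fun i _ => by rw [hp x hx]; ring

lemma inner_tangentOf_trans (hκ : κ ∈ charts n M) (h : RiemMetric n M)
    {ψ : OpenPartialHomeomorph (Coord n) (Coord n)} (hx : x ∈ (κ ≫ₕ ψ).target)
    (h2 : DifferentiableAt ℝ ψ.symm x) (y : Coord n) :
    h.inner ((κ ≫ₕ ψ).symm x) (tangentOf (κ ≫ₕ ψ) x y) (tangentOf (κ ≫ₕ ψ) x y) =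
      innerAt (metricInChart h κ) (ψ.symm x) (fderiv ℝ ψ.symm x y) (fderiv ℝ ψ.symm x y) := by
  rw [← inner_tangentOf]
  exact congrArg (fun w => h.inner (κ.symm (ψ.symm x)) w w) (tangentOf_trans hκ hx h2 y)

omit [IsManifold 𝓘(ℝ, Coord n) ∞ M] in
lemma form_tangentOf_trans (hκ : κ ∈ charts n M)
    {ψ : OpenPartialHomeomorph (Coord n) (Coord n)} (hx : x ∈ (κ ≫ₕ ψ).target)
    (h2 : DifferentiableAt ℝ ψ.symm x) (y : Coord n) :
    ρ ((κ ≫ₕ ψ).symm x) (tangentOf (κ ≫ₕ ψ) x y) =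
      ρ (κ.symm (ψ.symm x)) (tangentOf κ (ψ.symm x) (fderiv ℝ ψ.symm x y)) :=
  congrArg (fun w => ρ (κ.symm (ψ.symm x)) w) (tangentOf_trans hκ hx h2 y)

/-- Around every point of a manifold of constant sectional curvature there are coordinates in
which the metric has the model form. -/
theorem exists_model_chart (hμ : HasConstSectionalCurvature h μ) (z : M) :
    ∃ κ ∈ charts n M, z ∈ κ.source ∧ IsConnected κ.source ∧ MetricHasForm h κ μ := by
  obtain ⟨κ, hκ, hz⟩ := exists_chart (n := n) z
  set x₀ := κ z with hx₀
  have hx₀t : x₀ ∈ κ.target := κ.map_source hz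
  obtain ⟨r, hr, hrs, Φ, hΦ, hΦe⟩ := exists_local_isometry κ.open_target
    (contDiffOn_metricInChart hκ h) (fun x hx => metricInChart_posDef hκ hx h) (hμ κ hκ) hx₀t
  have hΦd : ∀ x ∈ ball x₀ r, DifferentiableAt ℝ Φ x := fun x hx =>
    differentiableAt_of_contDiffOn isOpen_ball hΦ hx
  have heq : ∀ x ∈ ball x₀ r, ∃ L : Coord n ≃L[ℝ] Coord n,
      HasFDerivAt Φ (L : Coord n →L[ℝ] Coord n) x := by
    intro x hx
    have hinj : Function.Injective (fderiv ℝ Φ x : Coord n →ₗ[ℝ] Coord n) := by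
      rw [← LinearMap.ker_eq_bot, LinearMap.ker_eq_bot']
      intro y hy
      by_contra hne
      have h1 := innerAt_metricInChart_pos hκ (hrs hx) h hne
      rw [(hΦe x hx).2 y, show fderiv ℝ Φ x y = 0 from hy] at h1
      simp at h1
    refine ⟨(LinearEquiv.ofInjectiveEndo _ hinj).toContinuousLinearEquiv, ?_⟩
    have : ((LinearEquiv.ofInjectiveEndo _ hinj).toContinuousLinearEquiv : Coord n →L[ℝ] Coord n) =
        fderiv ℝ Φ x := by ext1 y; rfl
    rw [this]
    exact (hΦd x hx).hasFDerivAt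
  have hΦat : ∀ x ∈ ball x₀ r, ContDiffAt ℝ ∞ Φ x := fun x hx =>
    hΦ.contDiffAt (isOpen_ball.mem_nhds hx)
  have hx₀b : x₀ ∈ ball x₀ r := mem_ball_self hr
  obtain ⟨L₀, hL₀⟩ := heq x₀ hx₀b
  -- the inverse function theorem, restricted so that the new chart has a ball as its target
  set ψ₀ := (hΦat x₀ hx₀b).toOpenPartialHomeomorph Φ hL₀ (by simp) with hψ₀
  have hψ₀Φ : ∀ x, ψ₀ x = Φ x := fun x => rfl
  have hx₀ψ : x₀ ∈ ψ₀.source := (hΦat x₀ hx₀b).mem_toOpenPartialHomeomorph_source hL₀ (by simp)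
  set ψ₁ := ψ₀.restrOpen (ball x₀ r) isOpen_ball with hψ₁
  have hx₀ψ₁ : x₀ ∈ ψ₁.source := ⟨hx₀ψ, hx₀b⟩
  obtain ⟨ε, hε, hεt⟩ := Metric.isOpen_iff.1 ψ₁.open_target (Φ x₀) (ψ₁.map_source hx₀ψ₁)
  set ψ := (ψ₁.symm.restrOpen (ball (Φ x₀) ε) isOpen_ball).symm with hψ
  have hψΦ : ∀ x, ψ x = Φ x := fun x => rfl
  have hψt : ψ.target = ball (Φ x₀) ε := by
    change ψ₁.target ∩ ball (Φ x₀) ε = _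
    exact inter_eq_right.2 hεt
  have hψs : ψ.source ⊆ ball x₀ r := by
    intro x hx
    have h1 := ψ.map_source hx
    have h2 : ψ.symm (ψ x) = x := ψ.left_inv hx
    have h3 : ψ₁.symm (ψ x) ∈ ψ₁.source := ψ₁.map_target (hεt (hψt ▸ h1))
    have h4 : ψ₁.symm (ψ x) = x := h2
    rw [h4] at h3
    exact h3.2
  have hsymm : ∀ y ∈ ψ.target, ψ.symm y ∈ ball x₀ r := fun y hy => hψs (ψ.map_target hy)
  have hψsm : ContDiffOn ℝ ∞ ψ ψ.source := hΦ.mono hψs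
  have hψsymm : ∀ y ∈ ψ.target, ContDiffAt ℝ ∞ ψ.symm y := by
    intro y hy
    obtain ⟨L, hL⟩ := heq _ (hsymm y hy)
    exact ψ.contDiffAt_symm hy hL (hΦat _ (hsymm y hy))
  have hψsymm' : ContDiffOn ℝ ∞ ψ.symm ψ.target := fun y hy => (hψsymm y hy).contDiffWithinAt
  have htarget : (κ ≫ₕ ψ).target = ball (Φ x₀) ε := by
    rw [OpenPartialHomeomorph.trans_target, ← hψt, inter_eq_left]
    exact fun y hy => hrs (hsymm y hy)
  have hzs : z ∈ (κ ≫ₕ ψ).source := by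
    rw [OpenPartialHomeomorph.trans_source]
    refine ⟨hz, ?_⟩
    have h1 : ψ₁.symm (Φ x₀) = x₀ := ψ₁.left_inv hx₀ψ₁
    have h2 : Φ x₀ ∈ ψ.target := by rw [hψt]; exact mem_ball_self hε
    have h3 := ψ.map_target h2
    have h4 : ψ.symm (Φ x₀) = x₀ := h1
    rw [h4] at h3
    exact h3
  refine ⟨κ ≫ₕ ψ, trans_mem_charts hκ hψsm hψsymm', hzs, ?_, fun x hx y => ?_⟩
  · rw [← (κ ≫ₕ ψ).symm_image_target_eq_source, htarget]
    refine ((convex_ball _ _).isConnected ⟨_, mem_ball_self hε⟩).image _ ?_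
    rw [← htarget]
    exact (κ ≫ₕ ψ).continuousOn_symm
  · have hxt : x ∈ ψ.target := by rw [hψt, ← htarget]; exact hx
    have hd := (hψsymm x hxt).differentiableAt (by simp)
    obtain ⟨hp, he⟩ := hΦe _ (hsymm x hxt)
    have h1 : Φ (ψ.symm x) = x := ψ.right_inv hxt
    have h2 : fderiv ℝ Φ (ψ.symm x) (fderiv ℝ ψ.symm x y) = y := by
      have e1 : HasFDerivAt (fun w => Φ (ψ.symm w)) ((fderiv ℝ Φ (ψ.symm x)).comp
          (fderiv ℝ ψ.symm x)) x := (hΦd _ (hsymm x hxt)).hasFDerivAt.comp x hd.hasFDerivAt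
      have e2 : HasFDerivAt (fun w => Φ (ψ.symm w)) (ContinuousLinearMap.id ℝ (Coord n)) x :=
        (hasFDerivAt_id x).congr_of_eventuallyEq
          (Filter.eventuallyEq_of_mem (ψ.open_target.mem_nhds hxt) fun w hw => ψ.right_inv hw)
      exact DFunLike.congr_fun (e1.unique e2) y
    rw [inner_tangentOf_trans hκ h hx hd, he, h1, h2, ← mul_pow]
    rw [h1] at hp
    exact Real.sqrt_sq (by positivity)

end Charts

section Generic
open Metric Set

variable {n : ℕ} {M : Type*} [TopologicalSpace M] [ChartedSpace (Coord n) M]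
  [IsManifold 𝓘(ℝ, Coord n) ∞ M] {κ : OpenPartialHomeomorph M (Coord n)} {h α : RiemMetric n M}
  {β ρ : ∀ x : M, TangentSpace 𝓘(ℝ, Coord n) x →L[ℝ] ℝ} {μ : ℝ} {φ : ℝ → ℝ}
  {F : TangentBundle 𝓘(ℝ, Coord n) M → ℝ}

/-! ### Unique continuation and generic points -/

lemma FormHasForm.eq_zero_iff (hn : 1 ≤ n) (hκ : κ ∈ charts n M) (hm : MetricHasForm h κ μ) {l : ℝ}
    {d e : Coord n} {P : Matrix (Fin n) (Fin n) ℝ} (hf : FormHasForm ρ κ μ l d e P) {x : Coord n}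
    (hx : x ∈ κ.target) : ρ (κ.symm x) = 0 ↔ confField l d P e x = 0 := by
  have hE := (modelFactor_pos (hm.pos hn hκ hx)).ne'
  have hf' := formHasForm_iff.1 hf x hx
  constructor
  · intro h0
    refine ext_inner_right ℝ fun y => ?_
    have h1 := hf' y
    rw [← form_tangentOf, h0, zero_apply, eq_comm, mul_eq_zero] at h1
    rw [inner_zero_left]
    exact h1.resolve_left hE
  · intro h0
    ext w
    obtain ⟨y, rfl⟩ := tangentOf_surjective hκ hx w
    rw [form_tangentOf, hf', h0, inner_zero_left, mul_zero, zero_apply]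

/-- Unique continuation: a conformal 1-form of a space of constant curvature that does not vanish
identically does not vanish on any open set. -/
theorem exists_form_ne_zero [ConnectedSpace M] (hn : 3 ≤ n) (hconf : IsConformalForm h ρ)
    (hμ : HasConstSectionalCurvature h μ) (hρ : ∃ z, ρ z ≠ 0) {W : Set M} (hW : IsOpen W)
    (hne : W.Nonempty) : ∃ z ∈ W, ρ z ≠ 0 := by
  by_contra! hzero
  set Z : Set M := interior {z | ρ z = 0} with hZ
  have hsub : ∀ z ∈ Z, ρ z = 0 := fun z hz => interior_subset (s := {z | ρ z = 0}) hz
  have hZne : Z.Nonempty := hne.mono (interior_maximal hzero hW)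
  have hZc : IsClosed Z := by
    refine isClosed_of_closure_subset fun z hz => ?_
    obtain ⟨κ, hκ, hzκ, hc, hm⟩ := exists_model_chart hμ z
    obtain ⟨l, d, e, P, -, hf⟩ := exists_formHasForm hn hκ hc hm hconf
    obtain ⟨z', hz'κ, hz'⟩ := _root_.mem_closure_iff.1 hz κ.source κ.open_source hzκ
    have hO : IsOpen (κ.target ∩ κ.symm ⁻¹' Z) := κ.isOpen_inter_preimage_symm isOpen_interior
    have hconst : confField l d P e = fun _ => 0 := by
      refine eq_of_eqOn_open (contDiff_confField _ _ _ _) contDiff_const hO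
        ⟨κ z', κ.map_source hz'κ, by rwa [mem_preimage, κ.left_inv hz'κ]⟩ fun x hx => ?_
      exact (hf.eq_zero_iff (by omega) hκ hm hx.1).1 (hsub _ hx.2)
    refine mem_interior.2 ⟨κ.source, fun y hy => ?_, κ.open_source, hzκ⟩
    have h1 := (hf.eq_zero_iff (by omega) hκ hm (κ.map_source hy)).2 (congrFun hconst _)
    rwa [κ.left_inv hy] at h1
  have huniv : Z = univ := IsClopen.eq_univ ⟨hZc, isOpen_interior⟩ hZne
  obtain ⟨z, hz⟩ := hρ
  have : z ∈ Z := huniv ▸ mem_univ z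
  exact hz (hsub z this)

/-- The points at which `β ≠ 0` and the indicatrix of `α φ(β/α)` is not an ellipsoid. -/
def genericPoints (α : RiemMetric n M) (β : ∀ x : M, TangentSpace 𝓘(ℝ, Coord n) x →L[ℝ] ℝ)
    (φ : ℝ → ℝ) : Set M :=
  {z | β z ≠ 0 ∧ ¬∃ k : ℝ, ∀ s, s ^ 2 ≤ formNormSq α β z → φ s ^ 2 = 1 + k * s ^ 2}

lemma contDiffOn_dualInChart (hκ : κ ∈ charts n M) (hβ : IsSmoothForm β) :
    ContDiffOn ℝ ∞ (dualInChart α β κ) κ.target :=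
  contDiffOn_coord_iff.2 fun k => by
    have h1 : ContDiffOn ℝ ∞ (fun x => ∑ l, (metricInChart α κ x)⁻¹ k l * formInChart β κ x l)
        κ.target := ContDiffOn.sum fun l _ =>
      (contDiffOn_inv_apply (contDiffOn_metricInChart hκ α)
        (fun _ hx => metricInChart_det_ne_zero hκ hx α) k l).mul (hβ κ hκ l)
    exact h1

lemma formNormSq_pos {z : M} (hz : β z ≠ 0) : 0 < formNormSq α β z := by
  obtain ⟨κ, hκ, hzκ⟩ := exists_chart (n := n) z
  obtain ⟨x, hx, rfl⟩ : ∃ x ∈ κ.target, z = κ.symm x :=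
    ⟨κ z, κ.map_source hzκ, (κ.left_inv hzκ).symm⟩
  rw [formNormSq_eq_innerAt hκ hx]
  exact innerAt_metricInChart_pos hκ hx α fun h0 => hz ((form_ne_zero_iff (h := α) hκ hx).2 h0)

lemma IsAlphaBetaMetric.phi_ratio_pos (hF : IsAlphaBetaMetric α β φ F) (z : M)
    (y : TangentSpace 𝓘(ℝ, Coord n) z) (hy : y ≠ 0) : 0 < φ (ratio α β z y) := by
  have h1 := hF.finsler.pos z y hy
  rw [hF.eq] at h1
  exact pos_of_mul_pos_right h1 (Real.sqrt_nonneg _)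

/-- If `β` does not vanish on any open set and `F` is non-Riemannian, then generic points are
dense. -/
theorem exists_mem_genericPoints (hF : IsAlphaBetaMetric α β φ F)
    (hφ : ∀ (k : ℝ) (U : Set M), IsOpen U →
      (∀ x ∈ U, ∀ y : TangentSpace 𝓘(ℝ, Coord n) x, y ≠ 0 →
        φ (ratio α β x y) = √(1 + k * ratio α β x y ^ 2)) →
      ∀ x ∈ U, β x = 0)
    (hne : ∀ W : Set M, IsOpen W → W.Nonempty → ∃ z ∈ W, β z ≠ 0) {W : Set M} (hW : IsOpen W)
    (hWne : W.Nonempty) : ∃ z ∈ W, z ∈ genericPoints α β φ := by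
  by_contra! hbad
  obtain ⟨z₀, hz₀, hβz₀⟩ := hne W hW hWne
  obtain ⟨κ, hκ, hzκ⟩ := exists_chart (n := n) z₀
  have hO : IsOpen (κ.target ∩ dualInChart α β κ ⁻¹' {0}ᶜ) :=
    (contDiffOn_dualInChart hκ hF.smooth_form).continuousOn.isOpen_inter_preimage κ.open_target
      isOpen_compl_singleton
  set W₀ : Set M := W ∩ (κ.source ∩ κ ⁻¹' (κ.target ∩ dualInChart α β κ ⁻¹' {0}ᶜ)) with hW₀
  have hW₀o : IsOpen W₀ := hW.inter (κ.isOpen_inter_preimage hO)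
  have hiff : ∀ z ∈ κ.source, β z = 0 ↔ dualInChart α β κ (κ z) = 0 := fun z hz => by
    have := form_ne_zero_iff (h := α) (β := β) hκ (κ.map_source hz)
    rwa [κ.left_inv hz] at this
  have hβW : ∀ z ∈ W₀, β z ≠ 0 := fun z hz h0 => hz.2.2.2 ((hiff z hz.2.1).1 h0)
  have hz₀W : z₀ ∈ W₀ := ⟨hz₀, hzκ, κ.map_source hzκ, fun h0 => hβz₀ ((hiff z₀ hzκ).2 h0)⟩
  have hk : ∀ z ∈ W₀, ∃ k : ℝ, ∀ s, s ^ 2 ≤ formNormSq α β z → φ s ^ 2 = 1 + k * s ^ 2 := by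
    intro z hz
    by_contra hcon
    exact hbad z hz.1 ⟨hβW z hz, hcon⟩
  obtain ⟨k, hk₀⟩ := hk z₀ hz₀W
  -- the constants `k` at different points agree because they are determined by small `s`
  have hcommon : ∀ z ∈ W₀, ∀ s, s ^ 2 ≤ formNormSq α β z → φ s ^ 2 = 1 + k * s ^ 2 := by
    intro z hz s hs
    obtain ⟨k', hk'⟩ := hk z hz
    set m := min (formNormSq α β z) (formNormSq α β z₀) with hm
    have hm0 : 0 < m := lt_min (formNormSq_pos (hβW z hz)) (formNormSq_pos hβz₀)
    have hsq : √m ^ 2 = m := Real.sq_sqrt hm0.le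
    have e1 := hk' (√m) (hsq.le.trans (min_le_left _ _))
    have e2 := hk₀ (√m) (hsq.le.trans (min_le_right _ _))
    rw [e1, hsq] at e2
    have e3 : k' * m = k * m := by linarith
    rw [hk' s hs, mul_right_cancel₀ hm0.ne' e3]
  refine hβz₀ (hφ k W₀ hW₀o (fun z hz y hy => ?_) z₀ hz₀W)
  rw [← hcommon z hz _ (ratio_sq_le z y), Real.sqrt_sq (hF.phi_ratio_pos z y hy).le]

/-! ### Conformal fields in model coordinates -/

lemma finslerInChart_smul (hF : IsFinslerMetric F) (x y : Coord n) (t : ℝ) (ht : 0 < t) :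
    finslerInChart F κ x (t • y) = t * finslerInChart F κ x y := by
  rw [finslerInChart, tangentOf_smul]
  exact hF.homogeneous _ _ t ht.le

lemma finslerInChart_pos (hF : IsFinslerMetric F) (hκ : κ ∈ charts n M) {x y : Coord n}
    (hx : x ∈ κ.target) (hy : y ≠ 0) : 0 < finslerInChart F κ x y :=
  hF.pos _ _ fun h0 => hy ((tangentOf_eq_zero_iff hκ hx y).1 h0)

/-- At a generic point a conformal field of `F` rescales `h` and `ρ`. -/
theorem conformal_relations_of_generic (hn : 3 ≤ n) (hF : IsAlphaBetaMetric α β φ F)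
    (hφ0 : φ 0 = 1) {u v w : ℝ → ℝ} {S : Set ℝ} (hS : IsOpen S) (hbS : ∀ x, formNormSq α β x ∈ S)
    (hu : ContDiffOn ℝ ∞ u S) (hv : ContDiffOn ℝ ∞ v S) (hw : ContDiffOn ℝ ∞ w S)
    (hh : ∀ (x : M) (y : TangentSpace 𝓘(ℝ, Coord n) x),
      h.inner x y y = u (formNormSq α β x) * α.inner x y y
        + v (formNormSq α β x) * (β x y) ^ 2)
    (hρ : ∀ x, ρ x = w (formNormSq α β x) • β x) (hρs : IsSmoothForm ρ)
    (hκ : κ ∈ charts n M) (hm : MetricHasForm h κ μ) {l : ℝ} {d e : Coord n}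
    {P : Matrix (Fin n) (Fin n) ℝ} (hf : FormHasForm ρ κ μ l d e P)
    {V : ∀ x : M, TangentSpace 𝓘(ℝ, Coord n) x} {c : M → ℝ}
    (hV : IsConformalFieldOn F V c κ.source) {x : Coord n} (hx : x ∈ κ.target)
    (hgen : κ.symm x ∈ genericPoints α β φ) :
    (∀ y, ⟪y, fderiv ℝ (fieldInChart V κ) x y⟫_ℝ = (-2 * c (κ.symm x)
      + 2 * μ * ⟪x, fieldInChart V κ x⟫_ℝ / (1 + μ * ‖x‖ ^ 2)) * ‖y‖ ^ 2) ∧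
    fderiv ℝ (confField l d P e) x (fieldInChart V κ x)
      - fderiv ℝ (fieldInChart V κ) x (confField l d P e x) =
      (2 * c (κ.symm x)) • confField l d P e x := by
  have ho := κ.open_target
  have hVs := contDiffOn_fieldInChart hκ hV.smooth
  have hpos : ∀ x ∈ κ.target, 0 < 1 + μ * ‖x‖ ^ 2 := fun x hx => hm.pos (by omega) hκ hx
  obtain ⟨Sφ, hSφ, hφs, hφS⟩ := hF.smooth_phi
  have hζ0 : dualInChart α β κ x ≠ 0 := fun h0 => hgen.1 ((form_ne_zero_iff hκ hx).2 h0)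
  have halt := lie_alternative (by omega) ho hx (contDiffOn_metricInChart hκ α)
    (fun x _ => metricInChart_symm α κ x) (fun x hx y hy => innerAt_metricInChart_pos hκ hx α hy)
    (b := formInChart β κ) (hF.smooth_form κ hκ) hSφ hφs hφ0
    (fun y hy => by
      have := hφS (κ.symm x) (tangentOf κ x y) fun h0 => hy ((tangentOf_eq_zero_iff hκ hx y).1 h0)
      rwa [ratio, inner_tangentOf, form_tangentOf] at this)
    (F := finslerInChart F κ) (contDiffOn_finslerInChart hκ hF.finsler.smooth)
    (fun y hy => finslerInChart_pos hF.finsler hκ hx hy)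
    (fun x _ y t ht => finslerInChart_smul hF.finsler x y t ht)
    (fun x hx y hy => (hF.finsler.convex κ hκ x hx y hy).det_pos.ne')
    (fun x _ y => by rw [finslerInChart, hF.eq, ratio, inner_tangentOf, form_tangentOf])
    hζ0 (fun y => sum_formInChart_eq hκ hx y)
    (differentiableAt_of_contDiffOn ho hVs hx) (c := c (κ.symm x))
    (fun y hy => hV.conformal κ hκ x hx (κ.map_target hx) y hy)
  rw [← formNormSq_eq_innerAt hκ hx] at halt
  have hL := halt.resolve_right hgen.2
  have hLa := fun y => (hL y).1
  have hLb := fun y => (hL y).2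
  have hds : ∀ (g : RiemMetric n M) i j, DifferentiableAt ℝ (fun z => metricInChart g κ z i j) x :=
    fun g i j => differentiableAt_of_contDiffOn ho (contDiffOn_metricInChart hκ g i j) hx
  have hdb : ∀ i, DifferentiableAt ℝ (fun z => formInChart β κ z i) x := fun i =>
    differentiableAt_of_contDiffOn ho (hF.smooth_form κ hκ i) hx
  have hdp : ∀ i, DifferentiableAt ℝ (fun z => formInChart ρ κ z i) x := fun i =>
    differentiableAt_of_contDiffOn ho (hρs κ hκ i) hx
  set B : Coord n → ℝ := fun z => ∑ k, formInChart β κ z k *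
    ∑ l, (metricInChart α κ z)⁻¹ k l * formInChart β κ z l with hB
  have hBeq : ∀ z ∈ κ.target, B z = formNormSq α β (κ.symm z) := fun z hz =>
    (formNormSq_eq_sum hκ hz).symm
  have hBd : DifferentiableAt ℝ B x := by
    refine differentiableAt_of_contDiffOn ho (s := κ.target) ?_ hx
    exact ContDiffOn.sum fun k _ => (hF.smooth_form κ hκ k).mul (ContDiffOn.sum fun l _ =>
      (contDiffOn_inv_apply (contDiffOn_metricInChart hκ α)
        (fun _ hx => metricInChart_det_ne_zero hκ hx α) k l).mul (hF.smooth_form κ hκ l))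
  have hB0 : fderiv ℝ B x (fieldInChart V κ x) = 0 :=
    fderiv_normSq_eq_zero ho hx (contDiffOn_metricInChart hκ α)
      (fun x _ => metricInChart_symm α κ x) (fun _ hx => metricInChart_det_ne_zero hκ hx α)
      (hF.smooth_form κ hκ) hLa hLb
  have hBS : B x ∈ S := by rw [hBeq x hx]; exact hbS _
  have hLh := lieMetric_of_lieMetric_add (H := metricInChart h κ) hS hu hv ho hx hBS hBd hB0
    (hds α) hdb (hds h) (fun z hz y => by
      rw [hBeq z hz, ← inner_tangentOf, ← inner_tangentOf, ← form_tangentOf, hh]) hLa hLb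
  have hLρ := lieForm_of_lieForm_mul (p := formInChart ρ κ) hS hw ho hx hBS hBd hB0 hdb hdp
    (fun z hz y => by
      rw [hBeq z hz, ← form_tangentOf, ← form_tangentOf, hρ, smul_apply,
        smul_eq_mul]) hLb
  have hA := inner_apply_of_lieMetric_model ho hx hpos (hds h)
    (fun z hz y => hm.innerAt_eq hκ hz y) hLh
  exact ⟨hA, bracket_eq_of_lieForm_model ho hx hpos hdp
    ((contDiff_confField (k := 1) l d P e).differentiable (by simp) x)
    (formHasForm_iff.1 hf) hA hLρ⟩

/-- The conformal factor of a conformal field is continuous. -/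
lemma continuousOn_conformalFactor (hn : 1 ≤ n) (hF : IsFinslerMetric F) (hκ : κ ∈ charts n M)
    {V : ∀ x : M, TangentSpace 𝓘(ℝ, Coord n) x} {c : M → ℝ}
    (hV : IsConformalFieldOn F V c κ.source) :
    ContinuousOn (fun x => c (κ.symm x)) κ.target := by
  have ho := κ.open_target
  have hVs := contDiffOn_fieldInChart hκ hV.smooth
  set y₀ : Coord n := basisVec ⟨0, hn⟩ with hy₀
  have hy0 : y₀ ≠ 0 := by simp [hy₀]
  have hFs : SmoothOffZero κ.target (finslerInChart F κ) := contDiffOn_finslerInChart hκ hF.smooth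
  have hF2 : SmoothOffZero κ.target (fun x y => finslerInChart F κ x y ^ 2) := ContDiffOn.pow hFs 2
  have hcF : ContinuousOn (fun x => finslerInChart F κ x y₀ ^ 2) κ.target :=
    hF2.continuousOn.comp (f := fun x : Coord n => (x, y₀)) (by fun_prop) fun x hx => ⟨hx, hy0⟩
  have hcd : ContinuousOn (fun x => fderiv ℝ
      (fun p : Coord n × Coord n => finslerInChart F κ p.1 p.2 ^ 2) (x, y₀)
      (fieldInChart V κ x, fderiv ℝ (fieldInChart V κ) x y₀)) κ.target := by
    have h1 : ContinuousOn (fun x : Coord n => fderiv ℝ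
        (fun p : Coord n × Coord n => finslerInChart F κ p.1 p.2 ^ 2) (x, y₀)) κ.target :=
      (hF2.continuousOn_fderiv_of_isOpen (isOpen_prod_compl_zero ho) (by simp)).comp
        (f := fun x : Coord n => (x, y₀)) (by fun_prop) fun x hx => ⟨hx, hy0⟩
    have h2 : ContinuousOn (fun x => fderiv ℝ (fieldInChart V κ) x y₀) κ.target :=
      (hVs.continuousOn_fderiv_of_isOpen ho (by simp)).clm_apply continuousOn_const
    exact h1.clm_apply (hVs.continuousOn.prodMk h2)
  have hFx : ∀ x ∈ κ.target, finslerInChart F κ x y₀ ^ 2 ≠ 0 := fun x hx =>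
    pow_ne_zero 2 (finslerInChart_pos hF hκ hx hy0).ne'
  refine ((hcd.div hcF hFx).const_smul (-1 / 4 : ℝ)).congr fun x hx => ?_
  have h1 := hV.conformal κ hκ x hx (κ.map_target hx) y₀ hy0
  rw [hCovDeriv00_eq ho hFs (fun x _ y t ht => finslerInChart_smul hF x y t ht)
    (fun x hx y hy => (hF.convex κ hκ x hx y hy).det_pos.ne') hx
    (differentiableAt_of_contDiffOn ho hVs hx) hy0] at h1
  have h2 := hFx x hx
  change c (κ.symm x) = (-1 / 4) * (_ / _)
  rw [← mul_div_assoc, eq_div_iff h2]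
  linarith

/-- Conformal vector fields in model coordinates: the three families. The relations that hold at
generic points hold in the whole chart by density, Liouville's theorem makes `V` a field
`confField`, and `confField_relations` compares its coefficients with those of `ρ`. -/
theorem conformalField_classification [ConnectedSpace M] (hn : 3 ≤ n)
    (hF : IsAlphaBetaMetric α β φ F) (hφ0 : φ 0 = 1) (hβ : ∃ x, β x ≠ 0)
    (hφ : ∀ (k : ℝ) (U : Set M), IsOpen U →
      (∀ x ∈ U, ∀ y : TangentSpace 𝓘(ℝ, Coord n) x, y ≠ 0 →
        φ (ratio α β x y) = √(1 + k * ratio α β x y ^ 2)) →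
      ∀ x ∈ U, β x = 0)
    {u v w : ℝ → ℝ} {S : Set ℝ} (hS : IsOpen S) (hbS : ∀ x, formNormSq α β x ∈ S)
    (hu : ContDiffOn ℝ ∞ u S) (hv : ContDiffOn ℝ ∞ v S) (hw : ContDiffOn ℝ ∞ w S)
    (hw0 : ∀ t ∈ S, w t ≠ 0)
    (hh : ∀ (x : M) (y : TangentSpace 𝓘(ℝ, Coord n) x),
      h.inner x y y = u (formNormSq α β x) * α.inner x y y
        + v (formNormSq α β x) * (β x y) ^ 2)
    (hρ : ∀ x, ρ x = w (formNormSq α β x) • β x)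
    (hconf : IsConformalForm h ρ) (hμ : HasConstSectionalCurvature h μ)
    (hκ : κ ∈ charts n M) (hc : IsConnected κ.source) (hm : MetricHasForm h κ μ) {l : ℝ}
    {d e : Coord n} {P : Matrix (Fin n) (Fin n) ℝ} (hP : Pᵀ = -P)
    (hf : FormHasForm ρ κ μ l d e P)
    {V : ∀ x : M, TangentSpace 𝓘(ℝ, Coord n) x} {c : M → ℝ}
    (hV : IsConformalFieldOn F V c κ.source) :
    (μ = 0 ∧ l = 0 ∧ d = 0 ∧ FirstFamily V c κ e P) ∨
    (μ = 0 ∧ (l ≠ 0 ∨ d ≠ 0) ∧ SecondFamily V c κ l d e P) ∨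
    (μ ≠ 0 ∧ ThirdFamily V c κ μ l d e P) := by
  have ho := κ.open_target
  have hVs := contDiffOn_fieldInChart hκ hV.smooth
  have hpos : ∀ x ∈ κ.target, 0 < 1 + μ * ‖x‖ ^ 2 := fun x hx => hm.pos (by omega) hκ hx
  have hρβ : ∀ z, ρ z = 0 ↔ β z = 0 := fun z => by
    rw [hρ, smul_eq_zero, or_iff_right (hw0 _ (hbS z))]
  have hne : ∀ W : Set M, IsOpen W → W.Nonempty → ∃ z ∈ W, ρ z ≠ 0 := fun W hW hWne =>
    exists_form_ne_zero hn hconf hμ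
      (by obtain ⟨z, hz⟩ := hβ; exact ⟨z, fun h0 => hz ((hρβ z).1 h0)⟩)
      hW hWne
  -- generic points are dense in the chart
  have hdense : κ.target ⊆ closure {x | x ∈ κ.target ∧ κ.symm x ∈ genericPoints α β φ} := by
    intro x hx
    rw [_root_.mem_closure_iff]
    intro O hO hxO
    obtain ⟨z, hz, hzg⟩ := exists_mem_genericPoints hF hφ
      (fun W hW hWne => by
        obtain ⟨z, hz, hz0⟩ := hne W hW hWne
        exact ⟨z, hz, fun h0 => hz0 ((hρβ z).2 h0)⟩)
      (κ.isOpen_inter_preimage (hO.inter ho))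
      ⟨κ.symm x, κ.map_target hx, by rw [mem_preimage, κ.right_inv hx]; exact ⟨hxO, hx⟩⟩
    refine ⟨κ z, hz.2.1, κ.map_source hz.1, ?_⟩
    rwa [κ.left_inv hz.1]
  have hgen : ∀ x ∈ {x | x ∈ κ.target ∧ κ.symm x ∈ genericPoints α β φ}, _ := fun x hx =>
    conformal_relations_of_generic hn hF hφ0 hS hbS hu hv hw hh hρ hconf.smooth hκ hm hf hV hx.1
      hx.2
  have hcc := continuousOn_conformalFactor (by omega) hF.finsler hκ hV
  have hVc := hVs.continuousOn
  have hdVc : ContinuousOn (fderiv ℝ (fieldInChart V κ)) κ.target :=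
    hVs.continuousOn_fderiv_of_isOpen ho (by simp)
  have hξ1 := contDiff_confField (k := 1) l d P e
  -- the relations at generic points extend by continuity
  have hA : ∀ x ∈ κ.target, ∀ y, ⟪y, fderiv ℝ (fieldInChart V κ) x y⟫_ℝ = (-2 * c (κ.symm x)
      + 2 * μ * ⟪x, fieldInChart V κ x⟫_ℝ / (1 + μ * ‖x‖ ^ 2)) * ‖y‖ ^ 2 := by
    intro x hx y
    refine EqOn.of_subset_closure (fun x hx => (hgen x hx).1 y) ?_ ?_ (fun x hx => hx.1) hdense hx
    · exact continuousOn_const.inner (hdVc.clm_apply continuousOn_const)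
    · refine ContinuousOn.mul ((continuousOn_const.mul hcc).add (ContinuousOn.div ?_ ?_ ?_))
        continuousOn_const
      · exact continuousOn_const.mul (continuousOn_id.inner hVc)
      · fun_prop
      · exact fun x hx => (hpos x hx).ne'
  have hB : ∀ x ∈ κ.target, fderiv ℝ (confField l d P e) x (fieldInChart V κ x)
      - fderiv ℝ (fieldInChart V κ) x (confField l d P e x) =
      (2 * c (κ.symm x)) • confField l d P e x := by
    intro x hx
    refine EqOn.of_subset_closure (fun x hx => (hgen x hx).2) ?_ ?_ (fun x hx => hx.1) hdense hx
    · exact ((hξ1.continuous_fderiv (by simp)).continuousOn.clm_apply hVc).sub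
        (hdVc.clm_apply hξ1.continuous.continuousOn)
    · exact (continuousOn_const.mul hcc).smul hξ1.continuous.continuousOn
  -- by `hA`, `V` is a conformal vector field of Euclidean space
  have hpd : ∀ x ∈ κ.target, ∀ i j, pd (fun z => fieldInChart V κ z i) j x =
      ⟪(basisVec i : Coord n), fderiv ℝ (fieldInChart V κ) x (basisVec j)⟫_ℝ := by
    intro x hx i j
    rw [real_inner_comm, inner_basisVec,
      fderiv_apply_coord (differentiableAt_of_contDiffOn ho hVs hx)]
    simp
  obtain ⟨τ, η, γ, Q, hQ, hVQ⟩ := exists_eq_confField hn ho (isPreconnected_target hc) hVs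
    (σ := fun x => -2 * c (κ.symm x)
      + 2 * μ * ⟪x, fieldInChart V κ x⟫_ℝ / (1 + μ * ‖x‖ ^ 2)) (by
      intro x hx i j
      have h1 := hA x hx (basisVec i + basisVec j)
      rw [map_add, inner_add_left, inner_add_right, inner_add_right, hA x hx, hA x hx,
        norm_add_sq_real, inner_basisVec, ← hpd x hx, ← hpd x hx] at h1
      have h2 : (basisVec i : Coord n) j = if i = j then 1 else 0 := by simp [eq_comm]
      rw [h2] at h1
      linarith)
  have hVd : ∀ x ∈ κ.target, fderiv ℝ (fieldInChart V κ) x = fderiv ℝ (confField τ η Q γ) x :=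
    fun x hx => (Filter.eventuallyEq_of_mem (ho.mem_nhds hx) hVQ).fderiv_eq
  obtain ⟨hη, hμτ, hcτ, r1, r2, r3, r4⟩ := confField_relations (by omega) ho hpos hP hQ
    (by
      obtain ⟨z, hz, hz0⟩ := hne κ.source κ.open_source hc.nonempty
      refine ⟨κ z, κ.map_source hz, fun h0 => hz0 ?_⟩
      have := (hf.eq_zero_iff (by omega) hκ hm (κ.map_source hz)).2 h0
      rwa [κ.left_inv hz] at this)
    (c := fun x => c (κ.symm x))
    (fun x hx y => by rw [← hVd x hx, ← hVQ x hx]; exact hA x hx y)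
    (fun x hx => by rw [← hVd x hx, ← hVQ x hx]; exact hB x hx)
  have hcz : ∀ z ∈ κ.source, c z = τ := fun z hz => by
    have := hcτ (κ z) (κ.map_source hz)
    rwa [κ.left_inv hz] at this
  by_cases hμ0 : μ = 0
  · subst hμ0
    have hη0 : η = 0 := by simpa using hη
    subst hη0
    have hcomm : P * Q - Q * P = (2 * τ) • P
        + (2 : ℝ) • Matrix.of fun i j => γ i * d j - γ j * d i := by
      rw [← r3, bracketMatrix]
      ext i j
      simp only [Matrix.sub_apply, Matrix.add_apply, Matrix.smul_apply, Matrix.of_apply,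
        smul_eq_mul, PiLp.zero_apply]
      ring
    have hfield : ∀ x ∈ κ.target,
        fieldInChart V κ x = (-2 * τ) • x + Q.toEuclideanLin x + γ := by
      intro x hx
      rw [hVQ x hx, confField, inner_zero_left, smul_zero, add_zero, add_zero]
    have hQd : Q.toEuclideanLin d = (-4 * τ) • d := by
      rw [map_zero, smul_zero, add_zero, add_zero] at r2
      have : Q.toEuclideanLin d = (-2 * τ) • d - (2 * τ) • d := by rw [← r2]; abel
      rw [this]; module
    have hdγ : ⟪d, γ⟫_ℝ = 2 * τ * l := by rw [← r1, inner_zero_left, sub_zero]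
    by_cases hld : l = 0 ∧ d = 0
    · obtain ⟨rfl, rfl⟩ := hld
      refine Or.inl ⟨rfl, rfl, rfl, τ, γ, Q, hQ, ?_, ?_, hfield, hcz⟩
      · rw [r4]; simp
      · rw [hcomm]
        ext i j
        simp
    · -- `τ ⟨d, d⟩ = 0` because `Q` is skew-symmetric, and `τ l = 0` if `d = 0`
      have hτ : τ = 0 := by
        by_cases hd : d = 0
        · have hl : l ≠ 0 := fun hl => hld ⟨hl, hd⟩
          rw [hd, inner_zero_left] at hdγ
          have := (mul_eq_zero.1 hdγ.symm).resolve_right hl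
          linarith
        · have h1 := inner_self_toEuclideanLin_of_skew hQ d
          rw [hQd, inner_smul_right] at h1
          have := (mul_eq_zero.1 h1).resolve_right (inner_self_ne_zero.2 hd)
          linarith
      subst hτ
      refine Or.inr (Or.inl ⟨rfl, ?_, γ, Q, hQ, ?_, ?_, r4, ?_, ?_, hcz⟩)
      · by_contra! hcon
        exact hld hcon
      · rw [hdγ]; ring
      · rw [hQd]; simp
      · rw [hcomm]; simp
      · intro x hx
        rw [hfield x hx]; simp
  · have hτ : τ = 0 := (mul_eq_zero.1 hμτ).resolve_left hμ0
    subst hτ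
    refine Or.inr (Or.inr ⟨hμ0, γ, Q, hQ, ?_, ?_, r4, ?_, ?_, hcz⟩)
    · rw [hη, inner_neg_left, inner_smul_left, conj_trivial, real_inner_comm] at r1
      rw [inner_add_left, inner_smul_left, conj_trivial]
      rw [real_inner_comm γ d, real_inner_comm γ e] at *
      linarith
    · rw [hη, map_neg, map_smul] at r2
      have : Q.toEuclideanLin d = (2 * l) • -(μ • γ) + -(μ • P.toEuclideanLin γ) := by
        rw [← sub_eq_zero, ← neg_eq_zero]
        simpa [sub_eq_add_neg, add_assoc, add_comm, add_left_comm] using r2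
      rw [this]; module
    · rw [bracketMatrix, hη] at r3
      ext i j
      have := congrFun (congrFun r3 i) j
      simp only [Matrix.sub_apply, Matrix.add_apply, Matrix.smul_apply, Matrix.of_apply,
        smul_eq_mul, PiLp.neg_apply, PiLp.smul_apply] at this ⊢
      linarith
    · intro x hx
      rw [hVQ x hx, confField, hη, inner_neg_left, inner_smul_left, conj_trivial]
      module

end Generic

/-! ### Translation of flat coordinates -/

section Translation

variable {n : ℕ} {M : Type*} [TopologicalSpace M] [ChartedSpace (Coord n) M]
  [IsManifold 𝓘(ℝ, Coord n) ∞ M] {κ : OpenPartialHomeomorph M (Coord n)} {h : RiemMetric n M}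
  {ρ : ∀ x : M, TangentSpace 𝓘(ℝ, Coord n) x →L[ℝ] ℝ}

/-- In the flat case with `l = 0` the translation by `d` leads to the constant `l = |d|²`. -/
lemma exists_translated_chart (hκ : κ ∈ charts n M) (hm : MetricHasForm h κ 0) {d e : Coord n}
    {P : Matrix (Fin n) (Fin n) ℝ} (hf : FormHasForm ρ κ 0 0 d e P) :
    ∃ κ' ∈ charts n M, κ'.source = κ.source ∧ MetricHasForm h κ' 0 ∧
      FormHasForm ρ κ' 0 (‖d‖ ^ 2) d (confField 0 d P e d) P := by
  set ψ : OpenPartialHomeomorph (Coord n) (Coord n) :=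
    (Homeomorph.addRight (-d)).toOpenPartialHomeomorph with hψ
  have hψs : ∀ x, ψ.symm x = x + d := fun x => by
    change x + -(-d) = x + d
    rw [neg_neg]
  have hψ' : (ψ.symm : Coord n → Coord n) = fun x => x + d := funext hψs
  have hd : ∀ x, HasFDerivAt ψ.symm (ContinuousLinearMap.id ℝ (Coord n)) x := fun x => by
    rw [hψ']; exact (hasFDerivAt_id x).add_const d
  have ht : ∀ x ∈ (κ ≫ₕ ψ).target, x + d ∈ κ.target := fun x hx => by
    rw [OpenPartialHomeomorph.trans_target] at hx
    have := hx.2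
    rwa [Set.mem_preimage, hψs] at this
  refine ⟨κ ≫ₕ ψ, trans_mem_charts hκ ?_ ?_, ?_, fun x hx y => ?_, fun x hx y => ?_⟩
  · have : (ψ : Coord n → Coord n) = fun x => x + -d := rfl
    rw [this]
    exact (contDiff_id.add contDiff_const).contDiffOn
  · rw [hψ']
    exact (contDiff_id.add contDiff_const).contDiffOn
  · rw [OpenPartialHomeomorph.trans_source]
    exact Set.inter_eq_left.2 fun _ _ => trivial
  · rw [inner_tangentOf_trans hκ h hx (hd x).differentiableAt, (hd x).fderiv,
      ContinuousLinearMap.id_apply, hψs, ← inner_tangentOf, hm _ (ht x hx)]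
    simp
  · rw [form_tangentOf_trans hκ hx (hd x).differentiableAt, (hd x).fderiv,
      ContinuousLinearMap.id_apply, hψs, hf _ (ht x hx)]
    simp only [confField, zero_mul, map_add, inner_add_left, inner_add_right, inner_smul_left,
      norm_add_sq_real, real_inner_self_eq_norm_sq, conj_trivial, real_inner_comm d x]
    ring

end Translation

end FinslerConformal

theorem theorem1p2 {n : ℕ} (hn : 3 ≤ n) {M : Type*} [TopologicalSpace M]
    [ChartedSpace (Coord n) M] [IsManifold 𝓘(ℝ, Coord n) ∞ M] [ConnectedSpace M]
    -- the (α, β)-metric `F = α φ(β/α)`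
    (α : RiemMetric n M) (β : ∀ x : M, TangentSpace 𝓘(ℝ, Coord n) x →L[ℝ] ℝ) (φ : ℝ → ℝ)
    (F : TangentBundle 𝓘(ℝ, Coord n) M → ℝ) (hF : IsAlphaBetaMetric α β φ F)
    (hφ0 : φ 0 = 1)
    -- `F` is not Riemannian: `β ≢ 0`, and `φ(s) = √(1 + k s²)` does not hold for all values
    -- `s = β/α` over an open set on which `β ≢ 0`
    (hβ : ∃ x, β x ≠ 0)
    (hφ : ∀ (k : ℝ) (U : Set M), IsOpen U →
      (∀ x ∈ U, ∀ y : TangentSpace 𝓘(ℝ, Coord n) x, y ≠ 0 →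
        φ (ratio α β x y) = √(1 + k * ratio α β x y ^ 2)) →
      ∀ x ∈ U, β x = 0)
    -- `h = √(u(b²) α² + v(b²) β²)` and `ρ = w(b²) β`
    (u v w : ℝ → ℝ) (S : Set ℝ) (hS : IsOpen S) (hbS : ∀ x, formNormSq α β x ∈ S)
    (hu : ContDiffOn ℝ ∞ u S) (hv : ContDiffOn ℝ ∞ v S) (hw : ContDiffOn ℝ ∞ w S)
    (hu0 : ∀ t ∈ S, u t ≠ 0) (hw0 : ∀ t ∈ S, w t ≠ 0)
    (h : RiemMetric n M) (ρ : ∀ x : M, TangentSpace 𝓘(ℝ, Coord n) x →L[ℝ] ℝ)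
    (hh : ∀ (x : M) (y : TangentSpace 𝓘(ℝ, Coord n) x),
      h.inner x y y = u (formNormSq α β x) * α.inner x y y
        + v (formNormSq α β x) * (β x y) ^ 2)
    (hρ : ∀ x, ρ x = w (formNormSq α β x) • β x)
    (hconf : IsConformalForm h ρ)
    (μ : ℝ) (hμ : HasConstSectionalCurvature h μ) :
    -- around every point there are coordinates with the explicit form and the three cases
    (∀ z : M, ∃ κ ∈ charts n M, z ∈ κ.source ∧ IsConnected κ.source ∧ MetricHasForm h κ μ ∧
      ∃ (l : ℝ) (d e : Coord n) (P : Matrix (Fin n) (Fin n) ℝ), Pᵀ = -P ∧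
        FormHasForm ρ κ μ l d e P ∧
        ∀ (V : ∀ x : M, TangentSpace 𝓘(ℝ, Coord n) x) (c : M → ℝ),
          IsConformalFieldOn F V c κ.source →
          (μ = 0 ∧ l = 0 ∧ d = 0 ∧ FirstFamily V c κ e P) ∨
          (μ = 0 ∧ l ≠ 0 ∧ SecondFamily V c κ l d e P) ∨
          (μ ≠ 0 ∧ ThirdFamily V c κ μ l d e P)) ∧
    -- in arbitrary coordinates that put `h` in the explicit form
    (∀ κ ∈ charts n M, IsConnected κ.source → MetricHasForm h κ μ →
      ∃ (l : ℝ) (d e : Coord n) (P : Matrix (Fin n) (Fin n) ℝ), Pᵀ = -P ∧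
        FormHasForm ρ κ μ l d e P ∧
        ∀ (V : ∀ x : M, TangentSpace 𝓘(ℝ, Coord n) x) (c : M → ℝ),
          IsConformalFieldOn F V c κ.source →
          (μ = 0 ∧ l = 0 ∧ d = 0 ∧ FirstFamily V c κ e P) ∨
          (μ = 0 ∧ (l ≠ 0 ∨ d ≠ 0) ∧ SecondFamily V c κ l d e P) ∨
          (μ ≠ 0 ∧ ThirdFamily V c κ μ l d e P)) := by
  refine ⟨fun z => ?_, fun κ hκ hc hm => ?_⟩
  · obtain ⟨κ, hκ, hz, hc, hm⟩ := exists_model_chart hμ z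
    obtain ⟨l, d, e, P, hP, hf⟩ := exists_formHasForm hn hκ hc hm hconf
    by_cases hsp : μ = 0 ∧ l = 0 ∧ d ≠ 0
    · -- a translation reduces to the case `l ≠ 0`
      obtain ⟨rfl, rfl, hd⟩ := hsp
      obtain ⟨κ', hκ', hs, hm', hf'⟩ := exists_translated_chart hκ hm hf
      have hl : ‖d‖ ^ 2 ≠ 0 := pow_ne_zero 2 (norm_ne_zero_iff.2 hd)
      refine ⟨κ', hκ', hs ▸ hz, hs ▸ hc, hm', _, d, _, P, hP, hf', fun V c hV => ?_⟩
      rcases conformalField_classification hn hF hφ0 hβ hφ hS hbS hu hv hw hw0 hh hρ hconf hμ hκ'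
        (hs ▸ hc) hm' hP hf' hV with h1 | h2 | h3
      · exact Or.inl h1
      · exact Or.inr (Or.inl ⟨h2.1, hl, h2.2.2⟩)
      · exact Or.inr (Or.inr h3)
    · refine ⟨κ, hκ, hz, hc, hm, l, d, e, P, hP, hf, fun V c hV => ?_⟩
      rcases conformalField_classification hn hF hφ0 hβ hφ hS hbS hu hv hw hw0 hh hρ hconf hμ hκ
        hc hm hP hf hV with h1 | h2 | h3
      · exact Or.inl h1
      · refine Or.inr (Or.inl ⟨h2.1, fun hl => ?_, h2.2.2⟩)
        exact hsp ⟨h2.1, hl, h2.2.1.resolve_left (not_not.2 hl)⟩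
      · exact Or.inr (Or.inr h3)
  · obtain ⟨l, d, e, P, hP, hf⟩ := exists_formHasForm hn hκ hc hm hconf
    exact ⟨l, d, e, P, hP, hf, fun V c hV => conformalField_classification hn hF hφ0 hβ hφ hS hbS hu
      hv hw hw0 hh hρ hconf hμ hκ hc hm hP hf hV⟩
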